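/- **Setting.** Let $\mathcal S,\mathcal A$ be finite nonempty sets, $H\ge 1$, and let $\mathbb P_h(\cdot\mid x,a)$, $h\in[H]$, be transition probabilities on $\mathcal S$, $r_h,g_h:\mathcal S\times\mathcal A\to[0,1]$ deterministic reward and utility functions, $x_1\in\mathcal S$ a fixed initial state and $b\in(0,H]$. For a policy $\pi=\{\pi_h(\cdot\mid x)\}$ (a probability vector on $\mathcal A$ for each $h,x$) and $\diamond\in\{r,g\}$ let $V^\pi_{\diamond,1}(x_1)=\mathbb E_\pi[\sum_{h=1}^H\diamond_h(x_h,a_h)]$, where $a_h\sim\pi_h(\cdot\mid x_h)$, $x_{h+1}\sim\mathbb P_h(\cdot\mid x_h,a_h)$. Let $\pi^\star$ maximize $V^\pi_{r,1}(x_1)$ over all policies with $V^\pi_{g,1}(x_1)\ge b$. Assume the Slater condition: $\gamma>0$ and some policy $\bar\pi$ satisfies $V^{\bar\pi}_{g,1}(x_1)\ge b+\gamma$. Let $\psi(x,a,x')=\mathbf e_{(x,a,x')}\in\mathbb R^{|\mathcal S|^2|\mathcal A|}$ and $\varphi(x,a)=\mathbf e_{(x,a)}\in\mathbb R^{|\mathcal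 S||\mathcal A|}$ be canonical basis vectors (so the CMDP is a linear kernel CMDP with $d=|\mathcal S|^2|\mathcal A|$). **Algorithm (OPDOP with LSTD+UCB evaluation).** Initialize $Q^0_{\diamond,h}=0$, $\pi^0_h$ uniform, $V^0_{g,1}=b$, $Y^0=0$, $\chi=2H/\gamma$. In episode $k=1,2,\dots$: 1. With $\tilde\pi^{k-1}_h=(1-\theta)\pi^{k-1}_h+\theta\,\mathrm{Unif}(\mathcal A)$ set $\pi^k_h(\cdot\mid x)\propto\tilde\pi^{k-1}_h(\cdot\mid x)\,e^{\alpha(Q^{k-1}_{r,h}+Y^{k-1}Q^{k-1}_{g,h})(x,\cdot)}$, and execute $\pi^k$ from $x^k_1=x_1$, observing $x^k_h,a^k_h$, $r_h(x^k_h,a^k_h)$, $g_h(x^k_h,a^k_h)$, $x^k_{h+1}$, $h\in[H]$. 2. Set $Y^k=\mathrm{Proj}_{[0,\chi]}\big(Y^{k-1}+\eta(b-V^{k-1}_{g,1}(x_1))\big)$. 3. Set $V^k_{\diamond,H+1}=0$, and for $h=H,\dots,1$ and $\diamond\in\{r,g\}$, with $\phi^\tau_{\diamond,h}(x,a)=\sum_{x'}\psi(x,a,x')V^\tau_{\diamond,h+1}(x')$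 for $\tau\le k$, $$\Lambda^k_{\diamond,h}=\lambda I+\sum_{\tau=1}^{k-1}\phi^\tau_{\diamond,h}(x^\tau_h,a^\tau_h)\phi^\tau_{\diamond,h}(x^\tau_h,a^\tau_h)^\top,\qquad w^k_{\diamond,h}=(\Lambda^k_{\diamond,h})^{-1}\sum_{\tau=1}^{k-1}\phi^\tau_{\diamond,h}(x^\tau_h,a^\tau_h)V^\tau_{\diamond,h+1}(x^\tau_{h+1}),$$ $$\Lambda^k_h=\lambda I+\sum_{\tau=1}^{k-1}\varphi(x^\tau_h,a^\tau_h)\varphi(x^\tau_h,a^\tau_h)^\top,\qquad u^k_{\diamond,h}=(\Lambda^k_h)^{-1}\sum_{\tau=1}^{k-1}\varphi(x^\tau_h,a^\tau_h)\diamond_h(x^\tau_h,a^\tau_h),$$ $$\Gamma^k_{\diamond,h}=\beta\big((\phi^k_{\diamond,h})^\top(\Lambda^k_{\diamond,h})^{-1}\phi^k_{\diamond,h}\big)^{1/2},\qquad \Gamma^k_h=\beta\big(\varphi^\top(\Lambda^k_h)^{-1}\varphi\big)^{1/2},$$ $$Q^k_{\diamond,h}=\max\Big(0,\min\big(\varphi^\top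 u^k_{\diamond,h}+(\phi^k_{\diamond,h})^\top w^k_{\diamond,h}+\Gamma^k_h+\Gamma^k_{\diamond,h},\,H-h+1\big)\Big),\qquad V^k_{\diamond,h}(x)=\sum_{a}Q^k_{\diamond,h}(x,a)\,\pi^k_h(a\mid x).$$ **Statement.** There are absolute constants $C_1,C,C'>0$ such that, for every CMDP as above, every such $\gamma$, every $K\ge1$ and $p\in(0,1)$, with $T=HK$: if the algorithm is run with $$\alpha=\frac{\sqrt{\log|\mathcal A|}}{H^2\sqrt K},\quad \beta=C_1\sqrt{|\mathcal S|^2|\mathcal A|H^2\log\tfrac{|\mathcal S||\mathcal A|T}{p}},\quad \eta=\frac1{\sqrt K},\quad \theta=\frac1K,\quad \lambda=1,$$ then with probability at least $1-p$ both $$\mathrm{Regret}(K)=\sum_{k=1}^K\big(V^{\pi^\star}_{r,1}(x_1)-V^{\pi^k}_{r,1}(x_1)\big)\le C\,(1+\gamma^{-2})\,|\mathcal S|^2|\mathcal A|H^{2.5}\sqrt T\,\log\tfrac{|\mathcal S||\mathcal A|T}{p},$$ $$\mathrm{Violation}(K)=\Big[\sum_{k=1}^K\big(b-V^{\pi^k}_{g,1}(x_1)\big)\Big]_+\le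 C'\,(1+\gamma^{-2})\,|\mathcal S|^2|\mathcal A|H^{2.5}\sqrt T\,\log\tfrac{|\mathcal S||\mathcal A|T}{p}.$$ -/

import Mathlib

open MeasureTheory
open scoped Matrix

noncomputable section

namespace OPDOP

/-- The two signals of a constrained MDP: the reward `r` and the utility `g`. -/
inductive Signal
  | reward
  | utility

/-- A finite-horizon tabular constrained MDP with deterministic reward and utility functions, a
fixed initial state and a constraint threshold `b`. The step `h : Fin H` is the `(h+1)`-st step of
an episode. -/
structure CMDP (S A : Type*) [Fintype S] (H : ℕ) where
  /-- `P h x a x'` is the probability of moving from `x` to `x'` under the action `a`. -/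
  P : Fin H → S → A → S → ℝ
  P_mem : ∀ h x a, P h x a ∈ stdSimplex ℝ S
  r : Fin H → S → A → ℝ
  r_mem : ∀ h x a, r h x a ∈ Set.Icc (0 : ℝ) 1
  g : Fin H → S → A → ℝ
  g_mem : ∀ h x a, g h x a ∈ Set.Icc (0 : ℝ) 1
  /-- The initial state. -/
  x₁ : S
  /-- The constraint threshold. -/
  b : ℝ
  b_mem : b ∈ Set.Ioc (0 : ℝ) H

/-- The reward or the utility functions. -/
def CMDP.signal {S A : Type*} [Fintype S] {H : ℕ} (M : CMDP S A H) :
    Signal → Fin H → S → A → ℝ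
  | .reward => M.r
  | .utility => M.g

/-- `π h x` is a probability vector on the actions for every step `h` and state `x`. -/
def IsPolicy {S A : Type*} [Fintype A] {H : ℕ} (π : Fin H → S → A → ℝ) : Prop :=
  ∀ h x, π h x ∈ stdSimplex ℝ A

/-- The state-action sequence `x_1, a_1, …, x_H, a_H, x_{H+1}` of one episode. -/
structure Trajectory (S A : Type*) (H : ℕ) where
  state : Fin (H + 1) → S
  action : Fin H → A

/-- A trajectory as a pair. -/
def Trajectory.equivProd (S A : Type*) (H : ℕ) :
    Trajectory S A H ≃ (Fin (H + 1) → S) × (Fin H → A) where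
  toFun τ := (τ.state, τ.action)
  invFun q := ⟨q.1, q.2⟩
  left_inv _ := rfl
  right_inv _ := rfl

instance {S A : Type*} [Fintype S] [Fintype A] {H : ℕ} : Fintype (Trajectory S A H) :=
  Fintype.ofEquiv _ (Trajectory.equivProd S A H).symm

instance {S A : Type*} {H : ℕ} : MeasurableSpace (Trajectory S A H) := ⊤

instance {S A : Type*} {H : ℕ} : DiscreteMeasurableSpace (Trajectory S A H) := ⟨fun _ => trivial⟩

section Model

variable {S A : Type*} [Fintype S] [DecidableEq S] [Fintype A] {H : ℕ}

/-- The probability of the trajectory `τ` when the policy `π` is executed from the initial state: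
`a_h ∼ π_h(· | x_h)` and `x_{h+1} ∼ P_h(· | x_h, a_h)`. -/
def trajWeight (M : CMDP S A H) (π : Fin H → S → A → ℝ) (τ : Trajectory S A H) : ℝ :=
  (if τ.state 0 = M.x₁ then 1 else 0) *
    ∏ h : Fin H, π h (τ.state h.castSucc) (τ.action h) *
      M.P h (τ.state h.castSucc) (τ.action h) (τ.state h.succ)

/-- The value `V_{⋄,1}^π(x₁) = 𝔼_π[∑_h ⋄_h(x_h, a_h)]`, for `⋄` the reward or the utility. -/
def value (M : CMDP S A H) (s : Signal) (π : Fin H → S → A → ℝ) : ℝ :=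
  ∑ τ : Trajectory S A H, trajWeight M π τ *
    ∑ h : Fin H, M.signal s h (τ.state h.castSucc) (τ.action h)

/-- `π` solves: maximize `V_{r,1}^π(x₁)` over all policies subject to `V_{g,1}^π(x₁) ≥ b`. -/
def IsOptimalPolicy (M : CMDP S A H) (π : Fin H → S → A → ℝ) : Prop :=
  IsPolicy π ∧ M.b ≤ value M .utility π ∧
    ∀ π' : Fin H → S → A → ℝ, IsPolicy π' → M.b ≤ value M .utility π' →
      value M .reward π' ≤ value M .reward π

/-- The Slater condition with slack `γ`. -/
def Slater (M : CMDP S A H) (γ : ℝ) : Prop :=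
  0 < γ ∧ ∃ π : Fin H → S → A → ℝ, IsPolicy π ∧ M.b + γ ≤ value M .utility π

end Model

/-- The feature maps of a linear kernel CMDP: a kernel feature `ψ(x, a, x')` and a value feature
`φ(x, a)`; the vectors are indexed by finite types `ι₁` and `ι₂`. -/
structure Features (S A ι₁ ι₂ : Type*) where
  ψ : S → A → S → ι₁ → ℝ
  φ : S → A → ι₂ → ℝ

/-- The tabular features: `ψ(x, a, x')` and `φ(x, a)` are the canonical basis vectors
of `ℝ^{S × A × S}` and of `ℝ^{S × A}`. -/
def tabularFeatures (S A : Type*) [DecidableEq S] [DecidableEq A] :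
    Features S A (S × A × S) (S × A) where
  ψ x a x' := Pi.single (x, a, x') 1
  φ x a := Pi.single (x, a) 1

/-- The parameters of the algorithm. -/
structure Params where
  α : ℝ
  β : ℝ
  η : ℝ
  θ : ℝ
  lam : ℝ
  χ : ℝ

/-- What the algorithm holds at the end of an episode `k`: the policy `π^k`, the dual variable
`Y^k`, and the estimates `Q_{⋄,h}^k` and `V_{⋄,h}^k`. In `Q` and `V` the index `h` stands for the
`(h+1)`-st step; `V` also has the index `h = H`. -/
structure Iterate (S A : Type*) (H : ℕ) where
  policy : Fin H → S → A → ℝ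
  Y : ℝ
  Q : Signal → Fin H → S → A → ℝ
  V : Signal → ℕ → S → ℝ

section Algorithm

variable {S A ι₁ ι₂ : Type*} [Fintype S] [DecidableEq S] [Fintype A]
  [Fintype ι₁] [DecidableEq ι₁] [Fintype ι₂] [DecidableEq ι₂] {H n : ℕ}

/-- The regression feature `∑_{x'} ψ(x, a, x') V(x')`. -/
def phiOf (F : Features S A ι₁ ι₂) (V : S → ℝ) (x : S) (a : A) : ι₁ → ℝ :=
  ∑ x' : S, V x' • F.ψ x a x'

/-- The action value estimate `Q_{⋄,h}^k(x, a)` of the least-squares temporal difference method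
with UCB exploration, given the next estimate `V = V_{⋄,h+1}^k`. The data consist of the
trajectories `ω` (`ω τ` is that of episode `τ + 1`) and of the iterates `prev` of the earlier
episodes; all sums run over the episodes `1, …, k - 1`. -/
def lstdQ (M : CMDP S A H) (F : Features S A ι₁ ι₂) (c : Params) (ω : Fin n → Trajectory S A H)
    (prev : ℕ → Iterate S A H) (k : ℕ) (s : Signal) (h : Fin H) (V : S → ℝ) (x : S) (a : A) : ℝ :=
  let past : Finset (Fin n) := Finset.univ.filter fun τ => (τ : ℕ) + 1 < k
  let xs : Fin n → S := fun τ => (ω τ).state h.castSucc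
  let as : Fin n → A := fun τ => (ω τ).action h
  let xs' : Fin n → S := fun τ => (ω τ).state h.succ
  let Vp : Fin n → S → ℝ := fun τ => (prev ((τ : ℕ) + 1)).V s ((h : ℕ) + 1)
  let f : Fin n → ι₁ → ℝ := fun τ => phiOf F (Vp τ) (xs τ) (as τ)
  let Λ₁ : Matrix ι₁ ι₁ ℝ := (∑ τ ∈ past, Matrix.vecMulVec (f τ) (f τ)) + c.lam • 1
  let w : ι₁ → ℝ := Λ₁⁻¹ *ᵥ ∑ τ ∈ past, Vp τ (xs' τ) • f τ
  let Γ₁ : ℝ := c.β * √(phiOf F V x a ⬝ᵥ Λ₁⁻¹ *ᵥ phiOf F V x a)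
  let e : Fin n → ι₂ → ℝ := fun τ => F.φ (xs τ) (as τ)
  let Λ₂ : Matrix ι₂ ι₂ ℝ := (∑ τ ∈ past, Matrix.vecMulVec (e τ) (e τ)) + c.lam • 1
  let u : ι₂ → ℝ := Λ₂⁻¹ *ᵥ ∑ τ ∈ past, M.signal s h (xs τ) (as τ) • e τ
  let Γ₂ : ℝ := c.β * √(F.φ x a ⬝ᵥ Λ₂⁻¹ *ᵥ F.φ x a)
  max 0 (min (F.φ x a ⬝ᵥ u + phiOf F V x a ⬝ᵥ w + (Γ₂ + Γ₁)) ((H : ℝ) - h))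

/-- The state value estimate `V_{⋄,h}^k(x) = ⟨Q_{⋄,h}^k(x, ·), π_h^k(· | x)⟩`, computed backwards
from `V_{⋄,H+1}^k = 0`. -/
def lstdV (M : CMDP S A H) (F : Features S A ι₁ ι₂) (c : Params) (ω : Fin n → Trajectory S A H)
    (prev : ℕ → Iterate S A H) (k : ℕ) (π : Fin H → S → A → ℝ) (s : Signal) (h : ℕ) : S → ℝ :=
  if hh : h < H then fun x =>
    ∑ a : A, lstdQ M F c ω prev k s ⟨h, hh⟩ (lstdV M F c ω prev k π s (h + 1)) x a *
      π ⟨h, hh⟩ x a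
  else 0
termination_by H - h

/-- The mixed policy `(1 - θ) π + θ Unif(A)`. -/
def mixPolicy (θ : ℝ) (π : Fin H → S → A → ℝ) (h : Fin H) (x : S) (a : A) : ℝ :=
  (1 - θ) * π h x a + θ * (1 / (Fintype.card A : ℝ))

/-- The new policy `π^k ∝ π̃^{k-1} exp(α (Q_r^{k-1} + Y^{k-1} Q_g^{k-1}))`. -/
def improve (c : Params) (I : Iterate S A H) (h : Fin H) (x : S) (a : A) : ℝ :=
  let wt : A → ℝ := fun a' => mixPolicy c.θ I.policy h x a' *
    Real.exp (c.α * (I.Q .reward h x a' + I.Y * I.Q .utility h x a'))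
  wt a / ∑ a' : A, wt a'

/-- The projection of the real line onto `[0, χ]`. -/
def projDual (χ y : ℝ) : ℝ := max 0 (min y χ)

/-- The initialization: `Q^0 = 0`, uniform policy, `V_{g,1}^0 = b`, `Y^0 = 0`. -/
def initIterate (M : CMDP S A H) : Iterate S A H where
  policy _ _ _ := 1 / (Fintype.card A : ℝ)
  Y := 0
  Q _ _ _ _ := 0
  V
    | .utility, 0, _ => M.b
    | _, _, _ => 0

/-- Episode `k ≥ 1` of the algorithm, given the iterates `prev` of the episodes `0, …, k - 1`. -/
def nextIterate (M : CMDP S A H) (F : Features S A ι₁ ι₂) (c : Params)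
    (ω : Fin n → Trajectory S A H) (prev : ℕ → Iterate S A H) (k : ℕ) : Iterate S A H where
  policy := improve c (prev (k - 1))
  Y := projDual c.χ
    ((prev (k - 1)).Y + c.η * (M.b - (prev (k - 1)).V .utility 0 M.x₁))
  Q s h := lstdQ M F c ω prev k s h
    (lstdV M F c ω prev k (improve c (prev (k - 1))) s ((h : ℕ) + 1))
  V s h := lstdV M F c ω prev k (improve c (prev (k - 1))) s h

/-- The `k`-th iterate of the algorithm on the trajectories `ω`. It is determined by the
trajectories of the episodes `1, …, k - 1`. -/
def iterate (M : CMDP S A H) (F : Features S A ι₁ ι₂) (c : Params)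
    (ω : Fin n → Trajectory S A H) (k : ℕ) : Iterate S A H :=
  if k = 0 then initIterate M
  else nextIterate M F c ω
    (fun τ => if _h : τ < k then iterate M F c ω τ else initIterate M) k
termination_by k

/-- The policy `π^{k+1}` that is executed in episode `k + 1`, computed from the trajectories of
the first `k` episodes. -/
def episodePolicy {K : ℕ} (M : CMDP S A H) (F : Features S A ι₁ ι₂) (c : Params)
    (ω : Fin K → Trajectory S A H) (k : Fin K) : Fin H → S → A → ℝ :=
  (iterate M F c (fun i : Fin (k : ℕ) => ω (Fin.castLE k.isLt.le i)) ((k : ℕ) + 1)).policy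

/-- The probability that the first `K` episodes of the algorithm have the trajectories `ω`. -/
def runWeight {K : ℕ} (M : CMDP S A H) (F : Features S A ι₁ ι₂) (c : Params)
    (ω : Fin K → Trajectory S A H) : ℝ :=
  ∏ k : Fin K, trajWeight M (episodePolicy M F c ω k) (ω k)

/-- The law of the trajectories of the first `K` episodes of the algorithm. -/
def runLaw (M : CMDP S A H) (F : Features S A ι₁ ι₂) (c : Params) (K : ℕ) :
    Measure (Fin K → Trajectory S A H) :=
  ∑ ω : Fin K → Trajectory S A H, ENNReal.ofReal (runWeight M F c ω) • Measure.dirac ω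

/-- `Regret(K) = ∑_k (V_{r,1}^{π⋆}(x₁) - V_{r,1}^{π^k}(x₁))`. -/
def regret {K : ℕ} (M : CMDP S A H) (F : Features S A ι₁ ι₂) (c : Params)
    (πstar : Fin H → S → A → ℝ) (ω : Fin K → Trajectory S A H) : ℝ :=
  ∑ k : Fin K, (value M .reward πstar - value M .reward (episodePolicy M F c ω k))

/-- `Violation(K) = [∑_k (b - V_{g,1}^{π^k}(x₁))]₊`. -/
def violation {K : ℕ} (M : CMDP S A H) (F : Features S A ι₁ ι₂) (c : Params)
    (ω : Fin K → Trajectory S A H) : ℝ :=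
  max 0 (∑ k : Fin K, (M.b - value M .utility (episodePolicy M F c ω k)))

end Algorithm

section Mass

set_option linter.unusedSectionVars false

variable {S A ι₁ ι₂ : Type*} [Fintype S] [DecidableEq S] [Fintype A]
  [Fintype ι₁] [DecidableEq ι₁] [Fintype ι₂] [DecidableEq ι₂] {H : ℕ}

theorem sum_path_eq_one (x₁ : S) : ∀ (H : ℕ) (π : Fin H → S → A → ℝ) (P : Fin H → S → A → S → ℝ),
    IsPolicy π → (∀ h x a, P h x a ∈ stdSimplex ℝ S) →
    ∑ x : Fin (H + 1) → S, ∑ a : Fin H → A, (if x 0 = x₁ then (1 : ℝ) else 0) *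
      ∏ h : Fin H, π h (x h.castSucc) (a h) * P h (x h.castSucc) (a h) (x h.succ) = 1
  | 0, π, P, _, _ => by
    rw [← (Equiv.funUnique (Fin 1) S).symm.sum_comp]
    simp
  | H + 1, π, P, hπ, hP => by
    have ih := sum_path_eq_one x₁ H (fun h => π h.castSucc) (fun h => P h.castSucc)
      (fun h x => hπ _ x) (fun h x a => hP _ x a)
    rw [← (Fin.snocEquiv (fun _ : Fin (H + 2) => S)).sum_comp, Fintype.sum_prod_type_right]
    refine Eq.trans (Finset.sum_congr rfl fun x _ => ?_) ih
    have key : ∀ s : S, ∑ a : Fin (H + 1) → A,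
        (if (Fin.snocEquiv (fun _ : Fin (H + 2) => S)) (s, x) 0 = x₁ then (1 : ℝ) else 0) *
        ∏ h : Fin (H + 1), π h ((Fin.snocEquiv (fun _ : Fin (H + 2) => S)) (s, x) h.castSucc) (a h) *
          P h ((Fin.snocEquiv (fun _ : Fin (H + 2) => S)) (s, x) h.castSucc) (a h)
            ((Fin.snocEquiv (fun _ : Fin (H + 2) => S)) (s, x) h.succ) =
        ∑ a : Fin H → A, ∑ a' : A, ((if x 0 = x₁ then (1 : ℝ) else 0) *
          ∏ h : Fin H, π h.castSucc (x h.castSucc) (a h) *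
            P h.castSucc (x h.castSucc) (a h) (x h.succ)) *
          (π (Fin.last H) (x (Fin.last H)) a' * P (Fin.last H) (x (Fin.last H)) a' s) := by
      intro s
      rw [← (Fin.snocEquiv (fun _ : Fin (H + 1) => A)).sum_comp, Fintype.sum_prod_type_right]
      refine Finset.sum_congr rfl fun a _ => Finset.sum_congr rfl fun a' _ => ?_
      rw [Fin.prod_univ_castSucc, ← mul_assoc]
      congr 1
      · have h0 : (0 : Fin (H + 2)) = Fin.castSucc 0 := rfl
        rw [h0]
        simp only [Fin.snocEquiv, Equiv.coe_fn_mk, Fin.snoc_castSucc]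
        congr 1
        refine Finset.prod_congr rfl fun h _ => ?_
        rw [Fin.succ_castSucc, Fin.snoc_castSucc]
      · simp [Fin.snocEquiv, Fin.succ_last]
    rw [Finset.sum_congr rfl fun s _ => key s, Finset.sum_comm]
    refine Finset.sum_congr rfl fun a _ => ?_
    rw [Finset.sum_comm]
    simp_rw [← Finset.mul_sum, (hP (Fin.last H) _ _).2, mul_one,
      (hπ (Fin.last H) (x (Fin.last H))).2, mul_one]

theorem sum_trajWeight (M : CMDP S A H) {π : Fin H → S → A → ℝ} (hπ : IsPolicy π) :
    ∑ τ : Trajectory S A H, trajWeight M π τ = 1 := by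
  rw [← (Trajectory.equivProd S A H).symm.sum_comp, Fintype.sum_prod_type]
  exact sum_path_eq_one M.x₁ H π M.P hπ M.P_mem

theorem trajWeight_nonneg (M : CMDP S A H) {π : Fin H → S → A → ℝ} (hπ : IsPolicy π)
    (τ : Trajectory S A H) : 0 ≤ trajWeight M π τ :=
  mul_nonneg (by split_ifs <;> norm_num)
    (Finset.prod_nonneg fun h _ => mul_nonneg ((hπ _ _).1 _) ((M.P_mem _ _ _).1 _))

theorem isPolicy_uniform {S A : Type*} [Fintype A] {H : ℕ} [Nonempty A] :
    IsPolicy (fun (_ : Fin H) (_ : S) (_ : A) => 1 / (Fintype.card A : ℝ)) :=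
  fun _ _ => ⟨fun _ => by positivity, by simp⟩

theorem isPolicy_improve {S A : Type*} [Fintype A] {H : ℕ} (c : Params) (hθ : c.θ ∈ Set.Icc (0 : ℝ) 1) [Nonempty A]
    (I : Iterate S A H) (hI : IsPolicy I.policy) : IsPolicy (improve c I) := by
  intro h x
  have hθ' : 0 ≤ 1 - c.θ := sub_nonneg.2 hθ.2
  have hm : ∀ a, 0 ≤ mixPolicy c.θ I.policy h x a := fun a =>
    add_nonneg (mul_nonneg hθ' ((hI h x).1 a)) (mul_nonneg hθ.1 (by positivity))
  have hs : ∑ a, mixPolicy c.θ I.policy h x a = 1 := by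
    simp only [mixPolicy, Finset.sum_add_distrib, ← Finset.mul_sum, (hI h x).2]
    simp
  obtain ⟨a₀, -, ha₀⟩ : ∃ a ∈ Finset.univ, 0 < mixPolicy c.θ I.policy h x a :=
    (Finset.sum_pos_iff_of_nonneg fun a _ => hm a).1 (by rw [hs]; norm_num)
  refine ⟨fun a => div_nonneg (mul_nonneg (hm a) (Real.exp_pos _).le)
    (Finset.sum_nonneg fun a' _ => mul_nonneg (hm a') (Real.exp_pos _).le), ?_⟩
  simp only [improve, ← Finset.sum_div]
  refine div_self (ne_of_gt ?_)
  exact Finset.sum_pos' (fun a' _ => mul_nonneg (hm a') (Real.exp_pos _).le)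
    ⟨a₀, Finset.mem_univ _, mul_pos ha₀ (Real.exp_pos _)⟩

theorem isPolicy_iterate {n : ℕ} (M : CMDP S A H) (F : Features S A ι₁ ι₂) (c : Params)
    (hθ : c.θ ∈ Set.Icc (0 : ℝ) 1) [Nonempty A] (ω : Fin n → Trajectory S A H) (k : ℕ) :
    IsPolicy (iterate M F c ω k).policy := by
  induction k with
  | zero => rw [iterate]; exact isPolicy_uniform
  | succ k ih =>
    rw [iterate, if_neg k.succ_ne_zero]
    refine isPolicy_improve c hθ _ ?_
    simpa using ih

/-- The weights of the runs add up to one. -/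
theorem sum_runWeight (M : CMDP S A H) (F : Features S A ι₁ ι₂) (c : Params)
    (hθ : c.θ ∈ Set.Icc (0 : ℝ) 1) [Nonempty A] (K : ℕ) :
    ∑ ω : Fin K → Trajectory S A H, runWeight M F c ω = 1 := by
  induction K with
  | zero => simp [runWeight]
  | succ K ih =>
    rw [← (Fin.snocEquiv (fun _ : Fin (K + 1) => Trajectory S A H)).sum_comp,
      Fintype.sum_prod_type_right]
    refine Eq.trans (Finset.sum_congr rfl fun ω _ => ?_) ih
    have key : ∀ τ : Trajectory S A H,
        runWeight M F c ((Fin.snocEquiv (fun _ : Fin (K + 1) => Trajectory S A H)) (τ, ω)) =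
          runWeight M F c ω * trajWeight M (iterate M F c ω (K + 1)).policy τ := by
      intro τ
      have hl : ∀ k : Fin K, ∀ i : Fin (k : ℕ),
          (Fin.snocEquiv (fun _ : Fin (K + 1) => Trajectory S A H)) (τ, ω)
            (Fin.castLE (Fin.castSucc k).isLt.le i) = ω (Fin.castLE k.isLt.le i) := by
        intro k i
        exact Fin.snoc_castSucc (α := fun _ => Trajectory S A H) τ ω (Fin.castLE k.isLt.le i)
      have hl' : ∀ i : Fin K,
          (Fin.snocEquiv (fun _ : Fin (K + 1) => Trajectory S A H)) (τ, ω)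
            (Fin.castLE (Fin.last K).isLt.le i) = ω i := by
        intro i
        exact Fin.snoc_castSucc (α := fun _ => Trajectory S A H) τ ω i
      rw [runWeight, Fin.prod_univ_castSucc]
      congr 1
      · refine Finset.prod_congr rfl fun k _ => ?_
        have h1 : episodePolicy M F c
            ((Fin.snocEquiv (fun _ : Fin (K + 1) => Trajectory S A H)) (τ, ω)) k.castSucc =
            episodePolicy M F c ω k := by
          unfold episodePolicy
          exact congrArg (fun v => (iterate M F c v ((k : ℕ) + 1)).policy) (funext (hl k))
        rw [h1]
        simp [Fin.snocEquiv]
      · have h1 : episodePolicy M F c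
            ((Fin.snocEquiv (fun _ : Fin (K + 1) => Trajectory S A H)) (τ, ω)) (Fin.last K) =
            (iterate M F c ω (K + 1)).policy := by
          unfold episodePolicy
          exact congrArg (fun v => (iterate M F c v (K + 1)).policy) (funext hl')
        rw [h1]
        simp [Fin.snocEquiv]
    rw [Finset.sum_congr rfl fun τ _ => key τ, ← Finset.mul_sum,
      sum_trajWeight M (isPolicy_iterate M F c hθ ω _), mul_one]

/-- The law of the run is a probability measure. -/
theorem isProbabilityMeasure_runLaw (M : CMDP S A H) (F : Features S A ι₁ ι₂) (c : Params)
    (hθ : c.θ ∈ Set.Icc (0 : ℝ) 1) [Nonempty A] (K : ℕ) :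
    IsProbabilityMeasure (runLaw M F c K) := by
  constructor
  simp only [runLaw, Measure.coe_finsetSum, Finset.sum_apply, Measure.smul_apply,
    measure_univ, smul_eq_mul, mul_one]
  rw [← ENNReal.ofReal_sum_of_nonneg, sum_runWeight M F c hθ K, ENNReal.ofReal_one]
  exact fun ω _ => Finset.prod_nonneg fun k _ =>
    trajWeight_nonneg M (isPolicy_iterate M F c hθ _ _) _

end Mass

/-- The parameters that are used in the tabular case with `nS` states, `nA` actions, horizon `H`,
`K` episodes, failure probability `p` and Slater constant `γ`. -/
def tabularParams (C₁ : ℝ) (nS nA H K : ℕ) (p γ : ℝ) : Params where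
  α := √(Real.log nA) / ((H : ℝ) ^ 2 * √(K : ℝ))
  β := C₁ * √((nS : ℝ) ^ 2 * nA * (H : ℝ) ^ 2 * Real.log (nS * nA * (H * K) / p))
  η := 1 / √(K : ℝ)
  θ := 1 / K
  lam := 1
  χ := 2 * H / γ

end OPDOP

end

open MeasureTheory
open scoped Matrix

noncomputable section

namespace OPDOP

/-! ### Rank-one updates, the determinant of the Gram matrix, ridge regression. -/

section RankOne

set_option linter.unusedSectionVars false

variable {ι : Type*} [Fintype ι] [DecidableEq ι]

/-! The algorithm plays a saddle-point game on estimated Lagrangians `V_r + Y (V_g - b)`: the policy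
follows mirror descent, the multiplier `Y` projected gradient descent, and the estimates are
optimistic. The bounds combine four ingredients.

Optimism. Each regression target is linear in the features plus the noise `V(x') - (P V)(x, a)`,
where `V` is the value estimate of the episode in which `x'` is drawn. This `V` is determined by
earlier episodes, so the noise is a bounded martingale difference and no covering of a class of
value functions is needed. The ridge error is at most the bonus norm times the self-normalized noise
plus the norm of the true parameter (`abs_ridge_sub_le`), and the self-normalized noise is
controlled by an exponential supermartingale (`sum_mul_selfNormExp_succ_le`). Hence the action value
estimate exceeds its Bellman target by an amount between zero and a clipped bonus
(`iterate_Q_sub_bellmanTarget_mem`).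

Bonuses. Along the observed trajectories they sum to order `√K` up to logarithms by the elliptical
potential lemma (`sum_trajBonus_le`); an Azuma-type supermartingale passes to their conditional
expectations (`sum_bonusDeviation_le`).

Online learning. The performance difference lemma reduces the comparison of the optimal policy with
the estimates to a mirror descent problem at every step and state (`primal_regret_le`). With the
regret of the multipliers (`dual_regret_le`), the sum of the reward gap and `y` times the estimated
constraint gap is bounded for every `y` in `[0, χ]`.

Conclusion (`regret_violation_le`). Taking `y = 0` gives the regret. Taking `y = χ = 2H/γ` bounds
the regret plus `2H/γ` times the violation. Under the Slater condition a deficit can raise the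
reward by at most `H/γ` times its size (`neg_le_sum_value_sub`), so `H/γ` times the violation
remains on the bounded side.

All exceptional events are handled at once: the nonnegative exponential processes are averaged and
Markov's inequality is applied to the average. -/

theorem mulVec_mulVec_inv {Λ : Matrix ι ι ℝ} (hΛ : Λ.PosDef) (v : ι → ℝ) :
    Λ *ᵥ (Λ⁻¹ *ᵥ v) = v := by
  rw [Matrix.mulVec_mulVec, Matrix.mul_nonsing_inv _ ((Matrix.isUnit_iff_isUnit_det _).1 hΛ.isUnit),
    Matrix.one_mulVec]

theorem inv_mulVec_mulVec {Λ : Matrix ι ι ℝ} (hΛ : Λ.PosDef) (v : ι → ℝ) :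
    Λ⁻¹ *ᵥ (Λ *ᵥ v) = v := by
  rw [Matrix.mulVec_mulVec, Matrix.nonsing_inv_mul _ ((Matrix.isUnit_iff_isUnit_det _).1 hΛ.isUnit),
    Matrix.one_mulVec]

theorem dotProduct_inv_mulVec_comm {Λ : Matrix ι ι ℝ} (hΛ : Λ.PosDef) (u v : ι → ℝ) :
    u ⬝ᵥ Λ⁻¹ *ᵥ v = v ⬝ᵥ Λ⁻¹ *ᵥ u := by
  have h : (Λ⁻¹)ᵀ = Λ⁻¹ := by
    simpa [Matrix.IsHermitian, Matrix.conjTranspose_eq_transpose_of_trivial] using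
      hΛ.inv.isHermitian
  rw [Matrix.dotProduct_mulVec, ← Matrix.mulVec_transpose, h, dotProduct_comm]

theorem dotProduct_inv_mulVec_nonneg {Λ : Matrix ι ι ℝ} (hΛ : Λ.PosDef) (v : ι → ℝ) :
    0 ≤ v ⬝ᵥ Λ⁻¹ *ᵥ v := by
  simpa using hΛ.inv.posSemidef.dotProduct_mulVec_nonneg v

/-- The norm `‖v‖_{Λ⁻¹}`. -/
def invNorm (Λ : Matrix ι ι ℝ) (v : ι → ℝ) : ℝ := √(v ⬝ᵥ Λ⁻¹ *ᵥ v)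

theorem invNorm_nonneg (Λ : Matrix ι ι ℝ) (v : ι → ℝ) : 0 ≤ invNorm Λ v := Real.sqrt_nonneg _

theorem sq_invNorm {Λ : Matrix ι ι ℝ} (hΛ : Λ.PosDef) (v : ι → ℝ) :
    invNorm Λ v ^ 2 = v ⬝ᵥ Λ⁻¹ *ᵥ v :=
  Real.sq_sqrt (dotProduct_inv_mulVec_nonneg hΛ v)

/-- Cauchy–Schwarz for the form of `Λ⁻¹`, from the discriminant of the nonnegative quadratic `x ↦ ‖u
+ x v‖²`. -/
theorem abs_dotProduct_inv_mulVec_le {Λ : Matrix ι ι ℝ} (hΛ : Λ.PosDef) (u v : ι → ℝ) :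
    |u ⬝ᵥ Λ⁻¹ *ᵥ v| ≤ invNorm Λ u * invNorm Λ v := by
  refine abs_le_of_sq_le_sq ?_ (mul_nonneg (invNorm_nonneg _ _) (invNorm_nonneg _ _))
  rw [mul_pow, sq_invNorm hΛ, sq_invNorm hΛ]
  have h := discrim_le_zero (a := v ⬝ᵥ Λ⁻¹ *ᵥ v) (b := 2 * (u ⬝ᵥ Λ⁻¹ *ᵥ v))
    (c := u ⬝ᵥ Λ⁻¹ *ᵥ u) (fun x => by
      have h0 := dotProduct_inv_mulVec_nonneg hΛ (u + x • v)
      have : (u + x • v) ⬝ᵥ Λ⁻¹ *ᵥ (u + x • v) = v ⬝ᵥ Λ⁻¹ *ᵥ v * (x * x) +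
          2 * (u ⬝ᵥ Λ⁻¹ *ᵥ v) * x + u ⬝ᵥ Λ⁻¹ *ᵥ u := by
        simp only [Matrix.mulVec_add, Matrix.mulVec_smul, add_dotProduct, dotProduct_add,
          smul_dotProduct, dotProduct_smul, smul_eq_mul, dotProduct_inv_mulVec_comm hΛ v u]
        ring
      linarith)
  simp only [discrim] at h
  nlinarith

theorem invNorm_sub_le {Λ : Matrix ι ι ℝ} (hΛ : Λ.PosDef) (u v : ι → ℝ) :
    invNorm Λ (u - v) ≤ invNorm Λ u + invNorm Λ v := by
  refine abs_le_of_sq_le_sq' ?_ (add_nonneg (invNorm_nonneg _ _) (invNorm_nonneg _ _)) |>.2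
  have h := neg_le_of_abs_le (abs_dotProduct_inv_mulVec_le hΛ u v)
  have h2 : (u - v) ⬝ᵥ Λ⁻¹ *ᵥ (u - v) = u ⬝ᵥ Λ⁻¹ *ᵥ u - 2 * (u ⬝ᵥ Λ⁻¹ *ᵥ v) + v ⬝ᵥ Λ⁻¹ *ᵥ v := by
    simp only [Matrix.mulVec_sub, sub_dotProduct, dotProduct_sub, dotProduct_inv_mulVec_comm hΛ v u]
    ring
  rw [sq_invNorm hΛ, h2, add_sq, sq_invNorm hΛ, sq_invNorm hΛ]
  linarith

/-- Rank-one update of the inverse. -/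
theorem add_vecMulVec_inv_mulVec {Λ : Matrix ι ι ℝ} (hΛ : Λ.PosDef) (f : ι → ℝ)
    (hΛ' : (Λ + Matrix.vecMulVec f f).PosDef) (v : ι → ℝ) :
    (Λ + Matrix.vecMulVec f f)⁻¹ *ᵥ v =
      Λ⁻¹ *ᵥ v - ((f ⬝ᵥ Λ⁻¹ *ᵥ v) / (1 + f ⬝ᵥ Λ⁻¹ *ᵥ f)) • Λ⁻¹ *ᵥ f := by
  have hm : (1 + f ⬝ᵥ Λ⁻¹ *ᵥ f) ≠ 0 := by
    have := dotProduct_inv_mulVec_nonneg hΛ f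
    positivity
  set w := Λ⁻¹ *ᵥ v - ((f ⬝ᵥ Λ⁻¹ *ᵥ v) / (1 + f ⬝ᵥ Λ⁻¹ *ᵥ f)) • Λ⁻¹ *ᵥ f with hw
  have : (Λ + Matrix.vecMulVec f f) *ᵥ w = v := by
    rw [Matrix.add_mulVec, Matrix.vecMulVec_mulVec, hw, Matrix.mulVec_sub, Matrix.mulVec_smul,
      mulVec_mulVec_inv hΛ, mulVec_mulVec_inv hΛ, dotProduct_sub, dotProduct_smul]
    ext i
    simp only [Pi.add_apply, Pi.sub_apply, Pi.smul_apply, smul_eq_mul, MulOpposite.smul_eq_mul_unop,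
      MulOpposite.unop_op]
    field_simp
    ring
  rw [← this, inv_mulVec_mulVec hΛ']

/-- Gives the increment of the squared self-normalized norm when a feature `f` with noise `e` is
added; it depends on the past only through `f ⬝ᵥ Λ⁻¹ *ᵥ f` and `f ⬝ᵥ Λ⁻¹ *ᵥ v`. -/
theorem quad_add_vecMulVec {Λ : Matrix ι ι ℝ} (hΛ : Λ.PosDef) (f : ι → ℝ)
    (hΛ' : (Λ + Matrix.vecMulVec f f).PosDef) (v : ι → ℝ) (e : ℝ) :
    (v + e • f) ⬝ᵥ (Λ + Matrix.vecMulVec f f)⁻¹ *ᵥ (v + e • f) = v ⬝ᵥ Λ⁻¹ *ᵥ v +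
      ((f ⬝ᵥ Λ⁻¹ *ᵥ f) * e ^ 2 + 2 * e * (f ⬝ᵥ Λ⁻¹ *ᵥ v) - (f ⬝ᵥ Λ⁻¹ *ᵥ v) ^ 2) /
        (1 + f ⬝ᵥ Λ⁻¹ *ᵥ f) := by
  have hm : (1 + f ⬝ᵥ Λ⁻¹ *ᵥ f) ≠ 0 := by
    have := dotProduct_inv_mulVec_nonneg hΛ f
    positivity
  rw [add_vecMulVec_inv_mulVec hΛ f hΛ']
  simp only [Matrix.mulVec_add, Matrix.mulVec_smul, add_dotProduct, dotProduct_add, dotProduct_sub,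
    smul_dotProduct, dotProduct_smul, smul_eq_mul, dotProduct_inv_mulVec_comm hΛ v f]
  field_simp
  ring

theorem det_add_vecMulVec {Λ : Matrix ι ι ℝ} (hΛ : Λ.PosDef) (f : ι → ℝ) :
    (Λ + Matrix.vecMulVec f f).det = Λ.det * (1 + f ⬝ᵥ Λ⁻¹ *ᵥ f) := by
  rw [Matrix.vecMulVec_eq Unit, Matrix.det_add_replicateCol_mul_replicateRow
    ((Matrix.isUnit_iff_isUnit_det _).1 hΛ.isUnit)]
  congr 1
  simp only [Matrix.det_unique, Matrix.add_apply, Matrix.one_apply_eq]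
  congr 1
  rw [Matrix.mul_assoc, ← Matrix.replicateCol_mulVec]
  rfl

/-- The regularized Gram matrix `I + ∑_{i < n} f_i f_iᵀ`. -/
def gram (f : ℕ → ι → ℝ) (n : ℕ) : Matrix ι ι ℝ :=
  (∑ i ∈ Finset.range n, Matrix.vecMulVec (f i) (f i)) + 1

theorem gram_succ (f : ℕ → ι → ℝ) (n : ℕ) :
    gram f (n + 1) = gram f n + Matrix.vecMulVec (f n) (f n) := by
  simp only [gram, Finset.sum_range_succ]
  abel

theorem gram_posDef (f : ℕ → ι → ℝ) (n : ℕ) : (gram f n).PosDef := by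
  induction n with
  | zero => simpa [gram] using Matrix.PosDef.one
  | succ n ih =>
    rw [gram_succ]
    exact ih.add_posSemidef (by simpa using Matrix.posSemidef_vecMulVec_self_star (f n))

theorem gram_congr {f f' : ℕ → ι → ℝ} {n : ℕ} (h : ∀ i < n, f i = f' i) : gram f n = gram f' n := by
  simp only [gram]
  congr 1
  exact Finset.sum_congr rfl fun i hi => by rw [h i (Finset.mem_range.1 hi)]

theorem det_gram_succ (f : ℕ → ι → ℝ) (n : ℕ) :
    (gram f (n + 1)).det = (gram f n).det * (1 + invNorm (gram f n) (f n) ^ 2) := by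
  rw [gram_succ, det_add_vecMulVec (gram_posDef f n), sq_invNorm (gram_posDef f n)]

theorem gram_mulVec (f : ℕ → ι → ℝ) (n : ℕ) (v : ι → ℝ) :
    gram f n *ᵥ v = ∑ i ∈ Finset.range n, (f i ⬝ᵥ v) • f i + v := by
  rw [gram, Matrix.add_mulVec, Matrix.one_mulVec, Matrix.sum_mulVec]
  congr 1
  refine Finset.sum_congr rfl fun i _ => ?_
  rw [Matrix.vecMulVec_mulVec]
  ext j
  simp [mul_comm]

theorem dotProduct_self_le_gram (f : ℕ → ι → ℝ) (n : ℕ) (v : ι → ℝ) :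
    v ⬝ᵥ v ≤ v ⬝ᵥ gram f n *ᵥ v := by
  rw [gram_mulVec, dotProduct_add, dotProduct_sum]
  refine le_add_of_nonneg_left (Finset.sum_nonneg fun i _ => ?_)
  rw [dotProduct_smul, dotProduct_comm v, smul_eq_mul]
  exact mul_self_nonneg _

/-- The Gram matrix dominates the identity, hence its inverse is dominated by it. Bounds the
regularization bias in ridge regression. -/
theorem sq_invNorm_gram_le (f : ℕ → ι → ℝ) (n : ℕ) (v : ι → ℝ) :
    invNorm (gram f n) v ^ 2 ≤ v ⬝ᵥ v := by
  have hΛ := gram_posDef f n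
  rw [sq_invNorm hΛ]
  set y := (gram f n)⁻¹ *ᵥ v
  have h1 : y ⬝ᵥ y ≤ v ⬝ᵥ y := by
    have := dotProduct_self_le_gram f n y
    rwa [mulVec_mulVec_inv hΛ, dotProduct_comm y v] at this
  have h2 : 0 ≤ (v - y) ⬝ᵥ (v - y) := by simpa using dotProduct_star_self_nonneg (v - y)
  simp only [sub_dotProduct, dotProduct_sub, dotProduct_comm y v] at h2
  linarith

/-- Each eigenvalue is positive and at most the trace. This is cruder than the arithmetic-geometric
mean inequality, but the loss stays inside a logarithm. -/
theorem det_gram_le (f : ℕ → ι → ℝ) (n : ℕ) {B : ℝ} (hf : ∀ i < n, f i ⬝ᵥ f i ≤ B) :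
    (gram f n).det ≤ (Fintype.card ι + n * B) ^ Fintype.card ι := by
  have hΛ := gram_posDef f n
  have htr : (gram f n).trace ≤ Fintype.card ι + n * B := by
    rw [gram, Matrix.trace_add, Matrix.trace_one, Matrix.trace_sum, add_comm]
    refine add_le_add le_rfl ?_
    refine (Finset.sum_le_sum (g := fun _ => B) fun i hi => ?_).trans (by simp)
    rw [Matrix.trace_vecMulVec]
    exact hf i (Finset.mem_range.1 hi)
  have hpos := hΛ.eigenvalues_pos
  have hsum : ∑ i, hΛ.isHermitian.eigenvalues i = (gram f n).trace := by
    rw [hΛ.isHermitian.trace_eq_sum_eigenvalues]; simp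
  rw [hΛ.isHermitian.det_eq_prod_eigenvalues]
  refine (Finset.prod_le_prod (g := fun _ => Fintype.card ι + n * B)
    (fun i _ => (hpos i).le) fun i _ => ?_).trans (by simp)
  refine le_trans ?_ (hsum.le.trans htr)
  exact Finset.single_le_sum (f := fun i => hΛ.isHermitian.eigenvalues i)
    (fun j _ => (hpos j).le) (Finset.mem_univ i)

theorem one_le_det_gram (f : ℕ → ι → ℝ) (n : ℕ) : 1 ≤ (gram f n).det := by
  induction n with
  | zero => simp [gram]
  | succ n ih =>
    rw [det_gram_succ]
    nlinarith [sq_nonneg (invNorm (gram f n) (f n))]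

theorem log_det_gram_le (f : ℕ → ι → ℝ) (n : ℕ) {B : ℝ} (hf : ∀ i < n, f i ⬝ᵥ f i ≤ B) :
    Real.log (gram f n).det ≤ Fintype.card ι * Real.log (Fintype.card ι + n * B) := by
  rw [← Real.log_pow]
  exact Real.log_le_log (by linarith [one_le_det_gram f n]) (det_gram_le f n hf)

/-- With `t = min 1 x / 2`, the bound `exp t ≤ 1 + t + t²` gives `exp t ≤ 1 + min 1 x`; taking
logarithms finishes. -/
theorem min_one_le_two_mul_log {x : ℝ} (hx : 0 ≤ x) : min 1 x ≤ 2 * Real.log (1 + x) := by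
  have h0 : 0 ≤ min 1 x := le_min zero_le_one hx
  have h1 : min 1 x ≤ 1 := min_le_left _ _
  have h2 : Real.exp (min 1 x / 2) ≤ 1 + min 1 x := by
    have := Real.abs_exp_sub_one_sub_id_le (x := min 1 x / 2) (by rw [abs_of_nonneg] <;> linarith)
    have := (abs_le.1 this).2
    nlinarith
  have h3 : min 1 x / 2 ≤ Real.log (1 + x) :=
    (Real.le_log_iff_exp_le (by linarith)).2 (h2.trans (by linarith [min_le_right 1 x]))
  linarith

/-- The elliptical potential lemma. -/
theorem sum_min_one_sq_invNorm_le (f : ℕ → ι → ℝ) (n : ℕ) :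
    ∑ i ∈ Finset.range n, min 1 (invNorm (gram f i) (f i)) ^ 2 ≤
      2 * Real.log (gram f n).det := by
  induction n with
  | zero => simp [gram]
  | succ n ih =>
    have hd := one_le_det_gram f n
    have hx := sq_nonneg (invNorm (gram f n) (f n))
    rw [Finset.sum_range_succ, det_gram_succ, Real.log_mul (by positivity) (by positivity), mul_add]
    refine add_le_add ih (le_trans ?_ (min_one_le_two_mul_log hx))
    have hn := invNorm_nonneg (gram f n) (f n)
    rcases le_total 1 (invNorm (gram f n) (f n)) with h | h
    · rw [min_eq_left h, min_eq_left] <;> nlinarith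
    · rw [min_eq_right h, min_eq_right]; nlinarith

theorem sum_min_one_invNorm_le (f : ℕ → ι → ℝ) (n : ℕ) :
    ∑ i ∈ Finset.range n, min 1 (invNorm (gram f i) (f i)) ≤
      √(n * (2 * Real.log (gram f n).det)) := by
  refine Real.le_sqrt_of_sq_le ?_
  refine (sq_sum_le_card_mul_sum_sq).trans ?_
  rw [Finset.card_range]
  exact mul_le_mul_of_nonneg_left (sum_min_one_sq_invNorm_le f n) (Nat.cast_nonneg n)

/-- The error of the ridge regression estimate with targets `⟨f_i, v⟩ + e_i`. -/
theorem abs_ridge_sub_le (f : ℕ → ι → ℝ) (e : ℕ → ℝ) (n : ℕ) (v x : ι → ℝ) :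
    |x ⬝ᵥ (gram f n)⁻¹ *ᵥ (∑ i ∈ Finset.range n, (f i ⬝ᵥ v + e i) • f i) - x ⬝ᵥ v| ≤
      invNorm (gram f n) x *
        (invNorm (gram f n) (∑ i ∈ Finset.range n, e i • f i) + √(v ⬝ᵥ v)) := by
  have hΛ := gram_posDef f n
  have h1 : x ⬝ᵥ (gram f n)⁻¹ *ᵥ (∑ i ∈ Finset.range n, (f i ⬝ᵥ v + e i) • f i) - x ⬝ᵥ v =
      x ⬝ᵥ (gram f n)⁻¹ *ᵥ ((∑ i ∈ Finset.range n, e i • f i) - v) := by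
    -- Noiseless targets reproduce `v` except for the regularization term; this isolates the error
    -- as noise minus `v`.
    have h2 : v = (gram f n)⁻¹ *ᵥ (∑ i ∈ Finset.range n, (f i ⬝ᵥ v) • f i + v) := by
      rw [← gram_mulVec, inv_mulVec_mulVec hΛ]
    conv_lhs => rw [h2]
    rw [← dotProduct_sub, ← Matrix.mulVec_sub, ← h2]
    congr 2
    simp only [add_smul, Finset.sum_add_distrib]
    abel
  rw [h1]
  refine (abs_dotProduct_inv_mulVec_le hΛ _ _).trans ?_
  refine mul_le_mul_of_nonneg_left ((invNorm_sub_le hΛ _ _).trans ?_) (invNorm_nonneg _ _)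
  exact add_le_add le_rfl (Real.le_sqrt_of_sq_le (sq_invNorm_gram_le f n v))

end RankOne

/-! ### Hoeffding's lemma and the self-normalized supermartingale. -/

section Subgaussian

theorem sum_mul_mem_Icc {X : Type*} [Fintype X] {w : X → ℝ} (hw : w ∈ stdSimplex ℝ X)
    {f : X → ℝ} {a b : ℝ} (hf : ∀ x, f x ∈ Set.Icc a b) : ∑ x, w x * f x ∈ Set.Icc a b := by
  constructor
  · calc a = ∑ x, w x * a := by rw [← Finset.sum_mul, hw.2, one_mul]
      _ ≤ _ := Finset.sum_le_sum fun x _ => mul_le_mul_of_nonneg_left (hf x).1 (hw.1 x)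
  · calc _ ≤ ∑ x, w x * b :=
          Finset.sum_le_sum fun x _ => mul_le_mul_of_nonneg_left (hf x).2 (hw.1 x)
      _ = b := by rw [← Finset.sum_mul, hw.2, one_mul]

/-- Hoeffding's lemma for a finite distribution. -/
theorem sum_mul_exp_le {X : Type*} [Fintype X] {w : X → ℝ} (hw : w ∈ stdSimplex ℝ X)
    {f : X → ℝ} {a b : ℝ} (hf : ∀ x, f x ∈ Set.Icc a b) (t : ℝ) :
    ∑ x, w x * Real.exp (t * (f x - ∑ y, w y * f y)) ≤ Real.exp (t ^ 2 * ((b - a) ^ 2 / 4) / 2) := by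
  let _ : MeasurableSpace X := ⊤
  have : DiscreteMeasurableSpace X := ⟨fun _ => trivial⟩
  let μ : Measure X := ∑ x, ENNReal.ofReal (w x) • Measure.dirac x
  have : IsProbabilityMeasure μ := by
    constructor
    simp only [μ, Measure.coe_finsetSum, Finset.sum_apply, Measure.smul_apply,
      measure_univ, smul_eq_mul, mul_one]
    rw [← ENNReal.ofReal_sum_of_nonneg fun x _ => hw.1 x, hw.2, ENNReal.ofReal_one]
  have hint : ∀ g : X → ℝ, ∫ x, g x ∂μ = ∑ x, w x * g x := by
    intro g
    simp only [μ]
    rw [integral_finsetSum_measure fun x _ =>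
      (Integrable.of_finite (μ := Measure.dirac x)).smul_measure ENNReal.ofReal_ne_top]
    refine Finset.sum_congr rfl fun x _ => ?_
    rw [integral_smul_measure, integral_dirac, ENNReal.toReal_ofReal (hw.1 x), smul_eq_mul]
  have h := (ProbabilityTheory.hasSubgaussianMGF_of_mem_Icc (μ := μ) (X := f) (a := a) (b := b)
    (Measurable.of_discrete).aemeasurable (Filter.Eventually.of_forall hf)).mgf_le t
  rw [ProbabilityTheory.mgf, hint, hint] at h
  refine h.trans_eq ?_
  congr 1
  simp only [NNReal.coe_pow, NNReal.coe_div, coe_nnnorm, Real.norm_eq_abs, NNReal.coe_ofNat,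
    div_pow, sq_abs]
  ring

theorem integral_exp_quadratic {p : ℝ} (hp : 0 < p) (q : ℝ) :
    Integrable (fun y : ℝ => Real.exp (-p * y ^ 2 + q * y)) ∧
    ∫ y : ℝ, Real.exp (-p * y ^ 2 + q * y) = √(Real.pi / p) * Real.exp (q ^ 2 / (4 * p)) := by
  have h : ∀ y : ℝ, Real.exp (-p * y ^ 2 + q * y) =
      Real.exp (-p * (y - q / (2 * p)) ^ 2) * Real.exp (q ^ 2 / (4 * p)) := by
    intro y
    rw [← Real.exp_add]
    congr 1
    field_simp
    ring
  simp_rw [h]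
  refine ⟨((integrable_exp_neg_mul_sq hp).comp_sub_right _).mul_const _, ?_⟩
  rw [integral_mul_const, integral_sub_right_eq_self (fun y : ℝ => Real.exp (-p * y ^ 2)),
    integral_gaussian]

/-- The exponential moment of a quadratic function of a sub-Gaussian variable that drives the
self-normalized supermartingale. -/
theorem sum_mul_exp_quadratic_le {X : Type*} [Fintype X] {w : X → ℝ}
    {e : X → ℝ} {v : ℝ} (hv : 0 < v)
    (he : ∀ t : ℝ, ∑ x, w x * Real.exp (t * e x) ≤ Real.exp (t ^ 2 * v / 2))
    {m : ℝ} (hm : 0 < m) (s : ℝ) :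
    ∑ x, w x * Real.exp ((m * e x ^ 2 + 2 * e x * s - s ^ 2) / (1 + m) / (2 * v)) ≤ √(1 + m) := by
  set p : ℝ := (1 + m) / (2 * v * m) with hp
  have hp0 : 0 < p := by positivity
  set p' : ℝ := 1 / (2 * v * m) with hp'
  have hp'0 : 0 < p' := by positivity
  have hpi := Real.pi_pos
  -- The quadratic exponent is linearized as a Gaussian integral over an auxiliary `y`, so that the
  -- moment hypothesis, which concerns linear exponents only, applies under the integral.
  have key : ∀ x, √(Real.pi / p) *
      Real.exp ((m * e x ^ 2 + 2 * e x * s - s ^ 2) / (1 + m) / (2 * v)) =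
      Real.exp (-s ^ 2 / (2 * v * m)) *
        ∫ y : ℝ, Real.exp (-p * y ^ 2 + (e x / v + s / (v * m)) * y) := by
    intro x
    rw [(integral_exp_quadratic hp0 _).2, mul_left_comm, ← Real.exp_add]
    congr 2
    rw [hp]
    field_simp
    ring
  -- The moment bound turns the decay rate `p` into `p' = p - 1/(2v)`; the ratio of the two Gaussian
  -- normalizations is exactly the factor claimed.
  have hsq : √(Real.pi / p') = √(Real.pi / p) * √(1 + m) := by
    rw [← Real.sqrt_mul (by positivity)]
    congr 1
    rw [hp, hp']
    field_simp
  have hpos : 0 < √(Real.pi / p) := Real.sqrt_pos.2 (by positivity)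
  refine le_of_mul_le_mul_left ?_ hpos
  rw [Finset.mul_sum]
  calc ∑ x, √(Real.pi / p) *
        (w x * Real.exp ((m * e x ^ 2 + 2 * e x * s - s ^ 2) / (1 + m) / (2 * v)))
      = Real.exp (-s ^ 2 / (2 * v * m)) *
        ∫ y : ℝ, ∑ x, w x * Real.exp (-p * y ^ 2 + (e x / v + s / (v * m)) * y) := by
        rw [integral_finsetSum _ fun x _ => (integral_exp_quadratic hp0 _).1.const_mul _,
          Finset.mul_sum]
        refine Finset.sum_congr rfl fun x _ => ?_
        rw [integral_const_mul, mul_left_comm, key x]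
        ring
    _ ≤ Real.exp (-s ^ 2 / (2 * v * m)) *
        ∫ y : ℝ, Real.exp (-p' * y ^ 2 + (s / (v * m)) * y) := by
        refine mul_le_mul_of_nonneg_left ?_ (Real.exp_pos _).le
        refine integral_mono (integrable_finsetSum _ fun x _ =>
          (integral_exp_quadratic hp0 _).1.const_mul _) (integral_exp_quadratic hp'0 _).1 fun y => ?_
        have h1 : ∀ x, w x * Real.exp (-p * y ^ 2 + (e x / v + s / (v * m)) * y) =
            Real.exp (-p * y ^ 2 + s / (v * m) * y) * (w x * Real.exp (y / v * e x)) := by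
          intro x
          rw [mul_left_comm, ← Real.exp_add]
          congr 2
          ring
        simp only [h1]
        rw [← Finset.mul_sum]
        refine (mul_le_mul_of_nonneg_left (he _) (Real.exp_pos _).le).trans_eq ?_
        rw [← Real.exp_add]
        congr 1
        rw [hp, hp']
        field_simp
        ring
    _ = √(Real.pi / p) * √(1 + m) := by
        rw [(integral_exp_quadratic hp'0 _).2, hsq, mul_left_comm, ← Real.exp_add]
        have : -s ^ 2 / (2 * v * m) + (s / (v * m)) ^ 2 / (4 * p') = 0 := by
          rw [hp']
          field_simp
          ring
        rw [this, Real.exp_zero, mul_one]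

variable {ι : Type*} [Fintype ι] [DecidableEq ι]

/-- The process `exp(‖∑_{i < n} e_i f_i‖²_{Λ_n⁻¹} / (2v)) / √det Λ_n`. -/
def selfNormExp (v : ℝ) (f : ℕ → ι → ℝ) (e : ℕ → ℝ) (n : ℕ) : ℝ :=
  Real.exp (invNorm (gram f n) (∑ i ∈ Finset.range n, e i • f i) ^ 2 / (2 * v)) /
    √(gram f n).det

theorem selfNormExp_zero (v : ℝ) (f : ℕ → ι → ℝ) (e : ℕ → ℝ) : selfNormExp v f e 0 = 1 := by
  simp [selfNormExp, gram, invNorm]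

theorem selfNormExp_nonneg (v : ℝ) (f : ℕ → ι → ℝ) (e : ℕ → ℝ) (n : ℕ) :
    0 ≤ selfNormExp v f e n := div_nonneg (Real.exp_pos _).le (Real.sqrt_nonneg _)

theorem selfNormExp_congr {v : ℝ} {f f' : ℕ → ι → ℝ} {e e' : ℕ → ℝ} {n : ℕ}
    (hf : ∀ i < n, f i = f' i) (he : ∀ i < n, e i = e' i) :
    selfNormExp v f e n = selfNormExp v f' e' n := by
  have : ∑ i ∈ Finset.range n, e i • f i = ∑ i ∈ Finset.range n, e' i • f' i :=
    Finset.sum_congr rfl fun i hi => by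
      rw [hf i (Finset.mem_range.1 hi), he i (Finset.mem_range.1 hi)]
  rw [selfNormExp, selfNormExp, gram_congr hf, this]

/-- The quadratic rank-one update acts in the exponent and the determinant update in the
denominator; the new factor `√(1 + m)` is what the conditional exponential moment costs. -/
theorem selfNormExp_succ (v : ℝ) (f : ℕ → ι → ℝ) (e : ℕ → ℝ) (n : ℕ) :
    selfNormExp v f e (n + 1) = selfNormExp v f e n *
      (Real.exp (((f n ⬝ᵥ (gram f n)⁻¹ *ᵥ f n) * e n ^ 2 +
          2 * e n * (f n ⬝ᵥ (gram f n)⁻¹ *ᵥ ∑ i ∈ Finset.range n, e i • f i) -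
          (f n ⬝ᵥ (gram f n)⁻¹ *ᵥ ∑ i ∈ Finset.range n, e i • f i) ^ 2) /
            (1 + f n ⬝ᵥ (gram f n)⁻¹ *ᵥ f n) / (2 * v)) /
        √(1 + f n ⬝ᵥ (gram f n)⁻¹ *ᵥ f n)) := by
  have hΛ := gram_posDef f n
  have hΛ' := gram_posDef f (n + 1)
  have hd := one_le_det_gram f n
  rw [selfNormExp, selfNormExp, sq_invNorm hΛ', sq_invNorm hΛ, Finset.sum_range_succ, det_gram_succ,
    sq_invNorm hΛ]
  rw [gram_succ] at hΛ' ⊢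
  rw [quad_add_vecMulVec hΛ _ hΛ', add_div, Real.exp_add, Real.sqrt_mul (by linarith),
    mul_div_mul_comm]

/-- One step of the self-normalized supermartingale. The variable `e_n` takes the value `ε x` with
probability `w x`; everything else is known. -/
theorem sum_mul_selfNormExp_succ_le {X : Type*} [Fintype X] {w : X → ℝ} (hw : w ∈ stdSimplex ℝ X)
    {ε : X → ℝ} {v : ℝ} (hv : 0 < v)
    (hε : ∀ t : ℝ, ∑ x, w x * Real.exp (t * ε x) ≤ Real.exp (t ^ 2 * v / 2))
    (f : ℕ → ι → ℝ) (e : X → ℕ → ℝ) (e₀ : ℕ → ℝ) (n : ℕ)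
    (he : ∀ x, ∀ i < n, e x i = e₀ i) (hen : ∀ x, e x n = ε x) :
    ∑ x, w x * selfNormExp v f (e x) (n + 1) ≤ selfNormExp v f e₀ n := by
  have hΛ := gram_posDef f n
  set m := f n ⬝ᵥ (gram f n)⁻¹ *ᵥ f n with hm
  set s := f n ⬝ᵥ (gram f n)⁻¹ *ᵥ ∑ i ∈ Finset.range n, e₀ i • f i with hs
  have h1 : ∀ x, selfNormExp v f (e x) (n + 1) = selfNormExp v f e₀ n *
      (Real.exp ((m * ε x ^ 2 + 2 * ε x * s - s ^ 2) / (1 + m) / (2 * v)) / √(1 + m)) := by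
    intro x
    have hsum : ∑ i ∈ Finset.range n, e x i • f i = ∑ i ∈ Finset.range n, e₀ i • f i :=
      Finset.sum_congr rfl fun i hi => by rw [he x i (Finset.mem_range.1 hi)]
    rw [selfNormExp_succ, hsum, hen, selfNormExp_congr (fun _ _ => rfl) (he x)]
  have hm0 : 0 ≤ m := dotProduct_inv_mulVec_nonneg hΛ _
  have h2 : ∑ x, w x * Real.exp ((m * ε x ^ 2 + 2 * ε x * s - s ^ 2) / (1 + m) / (2 * v)) ≤
      √(1 + m) := by
    -- The Gaussian integral needs `m > 0`. If `m = 0`, Cauchy–Schwarz forces `s = 0` and every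
    -- exponent vanishes.
    rcases hm0.eq_or_lt with h | h
    · have hs0 : s = 0 := by
        have := abs_dotProduct_inv_mulVec_le hΛ (f n) (∑ i ∈ Finset.range n, e₀ i • f i)
        rw [← hs, invNorm, ← hm, ← h, Real.sqrt_zero, zero_mul] at this
        exact abs_nonpos_iff.1 this
      simp [← h, hs0, hw.2]
    · exact sum_mul_exp_quadratic_le hv hε h s
  calc ∑ x, w x * selfNormExp v f (e x) (n + 1)
      = selfNormExp v f e₀ n *
        ((∑ x, w x * Real.exp ((m * ε x ^ 2 + 2 * ε x * s - s ^ 2) / (1 + m) / (2 * v))) /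
          √(1 + m)) := by
        rw [Finset.sum_div, Finset.mul_sum]
        refine Finset.sum_congr rfl fun x _ => ?_
        rw [h1 x]
        ring
    _ ≤ selfNormExp v f e₀ n * 1 := by
        refine mul_le_mul_of_nonneg_left ?_ (selfNormExp_nonneg _ _ _ _)
        exact div_le_one_of_le₀ h2 (Real.sqrt_nonneg _)
    _ = _ := mul_one _

/-- If the self-normalized process is below `1/δ`, the self-normalized norm is bounded. -/
theorem invNorm_le_of_selfNormExp_lt {v δ : ℝ} (hv : 0 < v) (hδ : 0 < δ) (f : ℕ → ι → ℝ)
    (e : ℕ → ℝ) (n : ℕ) (h : selfNormExp v f e n < 1 / δ) :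
    invNorm (gram f n) (∑ i ∈ Finset.range n, e i • f i) ≤
      √(v * (2 * Real.log (1 / δ) + Real.log (gram f n).det)) := by
  refine Real.le_sqrt_of_sq_le ?_
  have hd : 0 < (gram f n).det := by linarith [one_le_det_gram f n]
  rw [selfNormExp, div_lt_iff₀ (Real.sqrt_pos.2 hd)] at h
  have h2 := (Real.log_lt_log (Real.exp_pos _) h).le
  rw [Real.log_exp, Real.log_mul (by positivity) (Real.sqrt_pos.2 hd).ne', Real.log_sqrt hd.le,
    div_le_iff₀ (by positivity)] at h2
  linarith

end Subgaussian

/-! ### State occupancy measures and the performance difference lemma. -/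

section Occupancy

variable {S A : Type*} [Fintype S] [DecidableEq S] [Fintype A]

/-- The weight of a path under the kernels `π` and `P`. -/
def pathWeight (x₁ : S) (π : ℕ → S → A → ℝ) (P : ℕ → S → A → S → ℝ) {H : ℕ}
    (x : Fin (H + 1) → S) (a : Fin H → A) : ℝ :=
  (if x 0 = x₁ then 1 else 0) *
    ∏ h : Fin H, π h (x h.castSucc) (a h) * P h (x h.castSucc) (a h) (x h.succ)

/-- The law of the `n`-th state of a path. -/
def pathState (x₁ : S) (π : ℕ → S → A → ℝ) (P : ℕ → S → A → S → ℝ) : ℕ → S → ℝ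
  | 0 => fun x => if x = x₁ then 1 else 0
  | n + 1 => fun x' => ∑ x, ∑ a, pathState x₁ π P n x * π n x a * P n x a x'

/-- Conditioning on all but the last transition. Kernels are indexed by `ℕ` so that lengthening the
horizon does not change their type. -/
theorem sum_pathWeight_succ (x₁ : S) (π : ℕ → S → A → ℝ) (P : ℕ → S → A → S → ℝ) {H : ℕ}
    (G : (Fin (H + 1) → S) → (Fin H → A) → A → S → ℝ) :
    ∑ x : Fin (H + 2) → S, ∑ a : Fin (H + 1) → A, pathWeight x₁ π P x a *
        G (fun i => x i.castSucc) (fun i => a i.castSucc) (a (Fin.last H)) (x (Fin.last (H + 1))) =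
      ∑ x : Fin (H + 1) → S, ∑ a : Fin H → A, pathWeight x₁ π P x a *
        ∑ a' : A, ∑ x' : S, π H (x (Fin.last H)) a' * P H (x (Fin.last H)) a' x' * G x a a' x' := by
  rw [← (Fin.snocEquiv (fun _ : Fin (H + 2) => S)).sum_comp, Fintype.sum_prod_type_right]
  refine Finset.sum_congr rfl fun x _ => ?_
  have key : ∀ s : S, ∑ a : Fin (H + 1) → A,
      pathWeight x₁ π P ((Fin.snocEquiv (fun _ : Fin (H + 2) => S)) (s, x)) a *
        G (fun i => (Fin.snocEquiv (fun _ : Fin (H + 2) => S)) (s, x) i.castSucc)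
          (fun i => a i.castSucc) (a (Fin.last H))
          ((Fin.snocEquiv (fun _ : Fin (H + 2) => S)) (s, x) (Fin.last (H + 1))) =
      ∑ a : Fin H → A, ∑ a' : A, pathWeight x₁ π P x a *
        (π H (x (Fin.last H)) a' * P H (x (Fin.last H)) a' s * G x a a' s) := by
    intro s
    rw [← (Fin.snocEquiv (fun _ : Fin (H + 1) => A)).sum_comp, Fintype.sum_prod_type_right]
    refine Finset.sum_congr rfl fun a _ => Finset.sum_congr rfl fun a' _ => ?_
    have hw : pathWeight x₁ π P ((Fin.snocEquiv (fun _ : Fin (H + 2) => S)) (s, x))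
        ((Fin.snocEquiv (fun _ : Fin (H + 1) => A)) (a', a)) = pathWeight x₁ π P x a *
          (π H (x (Fin.last H)) a' * P H (x (Fin.last H)) a' s) := by
      rw [pathWeight, pathWeight, Fin.prod_univ_castSucc, ← mul_assoc]
      congr 1
      · have h0 : (0 : Fin (H + 2)) = Fin.castSucc 0 := rfl
        rw [h0]
        simp only [Fin.snocEquiv, Equiv.coe_fn_mk, Fin.snoc_castSucc]
        congr 1
        refine Finset.prod_congr rfl fun h _ => ?_
        rw [Fin.succ_castSucc, Fin.snoc_castSucc]
        rfl
      · simp [Fin.snocEquiv, Fin.succ_last]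
    rw [hw, mul_assoc]
    simp [Fin.snocEquiv]
  rw [Finset.sum_congr rfl fun s _ => key s, Finset.sum_comm]
  refine Finset.sum_congr rfl fun a _ => ?_
  rw [Finset.sum_comm]
  simp_rw [← Finset.mul_sum]

theorem sum_pathWeight_mul_last (x₁ : S) (π : ℕ → S → A → ℝ) (P : ℕ → S → A → S → ℝ) (H : ℕ)
    (G : S → ℝ) :
    ∑ x : Fin (H + 1) → S, ∑ a : Fin H → A, pathWeight x₁ π P x a * G (x (Fin.last H)) =
      ∑ s, pathState x₁ π P H s * G s := by
  induction H generalizing G with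
  | zero =>
    rw [← (Equiv.funUnique (Fin 1) S).symm.sum_comp]
    simp [pathWeight, pathState]
  | succ H ih =>
    rw [sum_pathWeight_succ x₁ π P fun _ _ _ s => G s,
      ih (fun s => ∑ a', ∑ x', π H s a' * P H s a' x' * G x')]
    simp only [pathState, Finset.sum_mul, Finset.mul_sum]
    symm
    rw [Finset.sum_comm]
    refine Finset.sum_congr rfl fun x _ => ?_
    rw [Finset.sum_comm]
    refine Finset.sum_congr rfl fun x' _ => Finset.sum_congr rfl fun a _ => ?_
    ring

/-- Transitions after step `h` integrate out to one, so peeling them off from the end reduces to the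
case where `h` is the last step. -/
theorem sum_pathWeight_mul (x₁ : S) (π : ℕ → S → A → ℝ) (P : ℕ → S → A → S → ℝ) (H : ℕ)
    (hπ : ∀ n < H, ∀ x, π n x ∈ stdSimplex ℝ A) (hP : ∀ n < H, ∀ x a, P n x a ∈ stdSimplex ℝ S)
    (h : Fin H) (G : S → A → S → ℝ) :
    ∑ x : Fin (H + 1) → S, ∑ a : Fin H → A,
        pathWeight x₁ π P x a * G (x h.castSucc) (a h) (x h.succ) =
      ∑ x, ∑ a, ∑ x', pathState x₁ π P h x * π h x a * P h x a x' * G x a x' := by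
  induction H with
  | zero => exact h.elim0
  | succ H ih =>
    induction h using Fin.lastCases with
    | last =>
      rw [Fin.succ_last]
      refine (sum_pathWeight_succ x₁ π P fun x _ a' s => G (x (Fin.last H)) a' s).trans ?_
      refine (sum_pathWeight_mul_last x₁ π P H fun s =>
        ∑ a', ∑ x', π H s a' * P H s a' x' * G s a' x').trans ?_
      simp only [Finset.mul_sum, Fin.val_last]
      refine Finset.sum_congr rfl fun x _ => Finset.sum_congr rfl fun a _ =>
        Finset.sum_congr rfl fun x' _ => ?_
      ring
    | cast h =>
      refine (sum_pathWeight_succ x₁ π P fun x a _ _ => G (x h.castSucc) (a h) (x h.succ)).trans ?_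
      refine Eq.trans ?_ (ih (fun n hn => hπ n (by omega)) (fun n hn => hP n (by omega)) h)
      refine Finset.sum_congr rfl fun x _ => Finset.sum_congr rfl fun a _ => ?_
      congr 1
      simp only [← Finset.sum_mul, ← Finset.mul_sum, (hP H (by omega) _ _).2, mul_one,
        (hπ H (by omega) _).2, one_mul]

variable {H : ℕ}

/-- Extension of a family over `Fin H` to a family over `ℕ`. -/
def extendNat {β : Type*} [Inhabited β] (f : Fin H → β) (n : ℕ) : β :=
  if h : n < H then f ⟨n, h⟩ else default

@[simp]
theorem extendNat_val {β : Type*} [Inhabited β] (f : Fin H → β) (h : Fin H) :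
    extendNat f h = f h := by simp [extendNat]

/-- The law of the state at step `n` when `π` is executed in `M`. -/
def occ (M : CMDP S A H) (π : Fin H → S → A → ℝ) (n : ℕ) (x : S) : ℝ :=
  pathState M.x₁ (extendNat π) (extendNat M.P) n x

theorem occ_zero (M : CMDP S A H) (π : Fin H → S → A → ℝ) (x : S) :
    occ M π 0 x = if x = M.x₁ then 1 else 0 := rfl

theorem occ_succ (M : CMDP S A H) (π : Fin H → S → A → ℝ) (h : Fin H) (x' : S) :
    occ M π (h + 1) x' = ∑ x, ∑ a, occ M π h x * π h x a * M.P h x a x' := by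
  simp [occ, pathState]

theorem occ_nonneg (M : CMDP S A H) {π : Fin H → S → A → ℝ} (hπ : IsPolicy π) {n : ℕ} (hn : n ≤ H)
    (x : S) : 0 ≤ occ M π n x := by
  induction n generalizing x with
  | zero => rw [occ_zero]; split_ifs <;> norm_num
  | succ n ih =>
    rw [occ_succ M π ⟨n, hn⟩]
    exact Finset.sum_nonneg fun y _ => Finset.sum_nonneg fun a _ =>
      mul_nonneg (mul_nonneg (ih (by omega) y) ((hπ _ _).1 _)) ((M.P_mem _ _ _).1 _)

theorem sum_occ_mul_policy (M : CMDP S A H) {π : Fin H → S → A → ℝ} (hπ : IsPolicy π) (h : Fin H)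
    (G : S → ℝ) : ∑ x, ∑ a, occ M π h x * π h x a * G x = ∑ x, occ M π h x * G x := by
  refine Finset.sum_congr rfl fun x _ => ?_
  rw [← Finset.sum_mul, ← Finset.mul_sum, (hπ h x).2, mul_one]

theorem sum_occ_succ_mul (M : CMDP S A H) (π : Fin H → S → A → ℝ) (h : Fin H) (G : S → ℝ) :
    ∑ x, occ M π (h + 1) x * G x =
      ∑ x, ∑ a, occ M π h x * π h x a * ∑ x', M.P h x a x' * G x' := by
  simp only [occ_succ, Finset.sum_mul, Finset.mul_sum]
  rw [Finset.sum_comm]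
  refine Finset.sum_congr rfl fun x _ => ?_
  rw [Finset.sum_comm]
  refine Finset.sum_congr rfl fun a _ => Finset.sum_congr rfl fun x' _ => ?_
  ring

theorem sum_occ (M : CMDP S A H) {π : Fin H → S → A → ℝ} (hπ : IsPolicy π) {n : ℕ} (hn : n ≤ H) :
    ∑ x, occ M π n x = 1 := by
  induction n with
  | zero => simp [occ_zero]
  | succ n ih =>
    have h := sum_occ_succ_mul M π ⟨n, hn⟩ (fun _ => 1)
    simp only [mul_one, (M.P_mem _ _ _).2] at h
    rw [h]
    have h2 := sum_occ_mul_policy M hπ ⟨n, hn⟩ (fun _ => 1)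
    simp only [mul_one] at h2
    rw [h2, ih (by omega)]

/-- The joint law of `(x_h, a_h, x_{h+1})`. -/
theorem sum_trajWeight_mul (M : CMDP S A H) {π : Fin H → S → A → ℝ} (hπ : IsPolicy π) (h : Fin H)
    (G : S → A → S → ℝ) :
    ∑ τ : Trajectory S A H,
        trajWeight M π τ * G (τ.state h.castSucc) (τ.action h) (τ.state h.succ) =
      ∑ x, ∑ a, occ M π h x * π h x a * ∑ x', M.P h x a x' * G x a x' := by
  have key := sum_pathWeight_mul M.x₁ (extendNat π) (extendNat M.P) H
    (fun n hn x => by simpa [extendNat, hn] using hπ ⟨n, hn⟩ x)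
    (fun n hn x a => by simpa [extendNat, hn] using M.P_mem ⟨n, hn⟩ x a) h G
  rw [← (Trajectory.equivProd S A H).symm.sum_comp, Fintype.sum_prod_type]
  simp only [pathWeight, extendNat_val] at key
  refine key.trans ?_
  simp only [Finset.mul_sum]
  refine Finset.sum_congr rfl fun x _ => Finset.sum_congr rfl fun a _ =>
    Finset.sum_congr rfl fun x' _ => ?_
  simp only [occ]
  ring

theorem sum_trajWeight_mul' (M : CMDP S A H) {π : Fin H → S → A → ℝ} (hπ : IsPolicy π) (h : Fin H)
    (G : S → A → ℝ) :
    ∑ τ : Trajectory S A H, trajWeight M π τ * G (τ.state h.castSucc) (τ.action h) =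
      ∑ x, ∑ a, occ M π h x * π h x a * G x a := by
  rw [sum_trajWeight_mul M hπ h fun x a _ => G x a]
  simp only [← Finset.sum_mul, (M.P_mem _ _ _).2, one_mul]

theorem sum_trajWeight_mul_le (M : CMDP S A H) {π : Fin H → S → A → ℝ} (hπ : IsPolicy π)
    (h : Fin H) (G : S → A → S → ℝ) {B : ℝ} (hG : ∀ x a, ∑ x', M.P h x a x' * G x a x' ≤ B) :
    ∑ τ : Trajectory S A H,
        trajWeight M π τ * G (τ.state h.castSucc) (τ.action h) (τ.state h.succ) ≤ B := by
  rw [sum_trajWeight_mul M hπ h]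
  calc _ ≤ ∑ x, ∑ a, occ M π h x * π h x a * B :=
        Finset.sum_le_sum fun x _ => Finset.sum_le_sum fun a _ =>
          mul_le_mul_of_nonneg_left (hG x a)
            (mul_nonneg (occ_nonneg M hπ h.2.le x) ((hπ h x).1 a))
    _ = B := by
        rw [sum_occ_mul_policy M hπ h, ← Finset.sum_mul, sum_occ M hπ h.2.le, one_mul]

theorem value_eq_sum_occ (M : CMDP S A H) (s : Signal) {π : Fin H → S → A → ℝ} (hπ : IsPolicy π) :
    value M s π = ∑ h : Fin H, ∑ x, ∑ a, occ M π h x * π h x a * M.signal s h x a := by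
  simp only [value, Finset.mul_sum]
  rw [Finset.sum_comm]
  exact Finset.sum_congr rfl fun h _ => sum_trajWeight_mul' M hπ h (M.signal s h)

theorem signal_mem {S A : Type*} [Fintype S] {H : ℕ} (M : CMDP S A H)
    (s : Signal) (h : Fin H) (x : S) (a : A) :
    M.signal s h x a ∈ Set.Icc (0 : ℝ) 1 := by
  cases s
  · exact M.r_mem h x a
  · exact M.g_mem h x a

theorem value_mem (M : CMDP S A H) (s : Signal) {π : Fin H → S → A → ℝ} (hπ : IsPolicy π) :
    value M s π ∈ Set.Icc (0 : ℝ) H := by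
  refine sum_mul_mem_Icc (X := Trajectory S A H)
    ⟨fun τ => trajWeight_nonneg M hπ τ, sum_trajWeight M hπ⟩ fun τ => ⟨?_, ?_⟩
  · exact Finset.sum_nonneg fun h _ => (signal_mem M s h _ _).1
  · refine (Finset.sum_le_sum fun h _ => (signal_mem M s h _ _).2).trans ?_
    simp

/-- The performance difference lemma for an arbitrary family `V` of functions. -/
theorem value_sub_eq (M : CMDP S A H) (s : Signal) {π : Fin H → S → A → ℝ} (hπ : IsPolicy π)
    (V : ℕ → S → ℝ) (hV : V H = 0) :
    value M s π - V 0 M.x₁ = ∑ h : Fin H, ∑ x, occ M π h x *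
      ((∑ a, π h x a * (M.signal s h x a + ∑ x', M.P h x a x' * V (h + 1) x')) - V h x) := by
  -- The occupancy averages of `V` telescope from the initial state to the vanishing terminal
  -- function.
  have h1 : ∑ h : Fin H, (∑ x, occ M π (h + 1) x * V (h + 1) x - ∑ x, occ M π h x * V h x) =
      - V 0 M.x₁ := by
    rw [Fin.sum_univ_eq_sum_range
      (fun n => ∑ x, occ M π (n + 1) x * V (n + 1) x - ∑ x, occ M π n x * V n x) H,
      Finset.sum_range_sub (fun n => ∑ x, occ M π n x * V n x)]
    simp [hV, occ_zero]
  rw [sub_eq_add_neg, ← h1, value_eq_sum_occ M s hπ, ← Finset.sum_add_distrib]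
  refine Finset.sum_congr rfl fun h _ => ?_
  rw [sum_occ_succ_mul]
  simp only [mul_sub, Finset.sum_sub_distrib, mul_add, Finset.sum_add_distrib, Finset.mul_sum,
    mul_assoc]
  ring

/-- A convex combination of the values of some policies is the value of a policy. -/
theorem exists_policy_value_eq (M : CMDP S A H) [Nonempty A] {I : Type*} [Fintype I] {w : I → ℝ}
    (hw : w ∈ stdSimplex ℝ I) (π : I → Fin H → S → A → ℝ) (hπ : ∀ i, IsPolicy (π i)) :
    ∃ π' : Fin H → S → A → ℝ, IsPolicy π' ∧
      ∀ s, value M s π' = ∑ i, w i * value M s (π i) := by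
  -- Values are linear in the occupancies, not in the policies. The required policy is therefore the
  -- conditional law of the action under the mixed occupancy, with an arbitrary (uniform) choice at
  -- states of mass zero.
  let μ : ℕ → S → ℝ := fun n x => ∑ i, w i * occ M (π i) n x
  let π' : Fin H → S → A → ℝ := fun h x a =>
    if μ h x = 0 then 1 / (Fintype.card A : ℝ)
    else (∑ i, w i * occ M (π i) h x * π i h x a) / μ h x
  have hterm : ∀ (h : Fin H) x i, 0 ≤ w i * occ M (π i) h x := fun h x i =>
    mul_nonneg (hw.1 i) (occ_nonneg M (hπ i) h.2.le x)
  have hμ0 : ∀ (h : Fin H) x, 0 ≤ μ h x := fun h x => Finset.sum_nonneg fun i _ => hterm h x i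
  have hπ' : IsPolicy π' := by
    intro h x
    by_cases hx : μ h x = 0
    · have : π' h x = fun _ => 1 / (Fintype.card A : ℝ) := by
        funext a
        simp only [π', hx, if_true]
      rw [this]
      exact isPolicy_uniform (S := S) h x
    · have : π' h x = fun a => (∑ i, w i * occ M (π i) h x * π i h x a) / μ h x := by
        funext a
        simp only [π', hx, if_false]
      rw [this]
      refine ⟨fun a => div_nonneg (Finset.sum_nonneg fun i _ =>
        mul_nonneg (hterm h x i) ((hπ i h x).1 a)) (hμ0 h x), ?_⟩
      rw [← Finset.sum_div, Finset.sum_comm]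
      simp only [← Finset.mul_sum, (hπ _ h x).2, mul_one]
      exact div_self hx
  have hmul : ∀ (h : Fin H) x a, μ h x * π' h x a = ∑ i, w i * occ M (π i) h x * π i h x a := by
    intro h x a
    by_cases hx : μ h x = 0
    · have h0 := (Finset.sum_eq_zero_iff_of_nonneg fun i _ => hterm h x i).1 hx
      rw [hx, zero_mul]
      exact (Finset.sum_eq_zero fun i hi => by rw [h0 i hi, zero_mul]).symm
    · simp only [π', hx, if_false]
      rw [mul_div_cancel₀ _ hx]
  have hocc : ∀ n ≤ H, ∀ x, occ M π' n x = μ n x := by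
    intro n
    induction n with
    | zero =>
      intro _ x
      simp only [μ, occ_zero, ← Finset.sum_mul, hw.2, one_mul]
    | succ n ih =>
      intro hn x'
      rw [occ_succ M π' ⟨n, hn⟩]
      simp only [ih (by omega), μ]
      simp only [fun i => occ_succ M (π i) ⟨n, hn⟩ x']
      have := fun x a => hmul ⟨n, hn⟩ x a
      simp only [μ] at this
      simp only [this, Finset.sum_mul, Finset.mul_sum]
      symm
      rw [Finset.sum_comm]
      refine Finset.sum_congr rfl fun x _ => ?_
      rw [Finset.sum_comm]
      refine Finset.sum_congr rfl fun a _ => Finset.sum_congr rfl fun i _ => ?_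
      ring
  refine ⟨π', hπ', fun s => ?_⟩
  rw [value_eq_sum_occ M s hπ']
  simp only [fun i => value_eq_sum_occ M s (hπ i), Finset.mul_sum]
  rw [Finset.sum_comm (s := (Finset.univ : Finset I))]
  refine Finset.sum_congr rfl fun h _ => ?_
  rw [Finset.sum_comm (s := (Finset.univ : Finset I))]
  refine Finset.sum_congr rfl fun x _ => ?_
  rw [Finset.sum_comm (s := (Finset.univ : Finset I))]
  refine Finset.sum_congr rfl fun a _ => ?_
  rw [hocc h h.2.le, hmul, Finset.sum_mul]
  exact Finset.sum_congr rfl fun i _ => by ring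

end Occupancy

/-! ### Projected gradient descent and mirror descent. -/

section OnlineLearning

/-- Projection onto an interval does not move away from any of its points. -/
theorem sq_projDual_sub_le {χ y z : ℝ} (hy : y ∈ Set.Icc 0 χ) :
    (projDual χ z - y) ^ 2 ≤ (z - y) ^ 2 := by
  refine sq_le_sq.2 ?_
  have h := hy.1
  have h' := hy.2
  unfold projDual
  rcases le_total z χ with h1 | h1
  · rw [min_eq_left h1]
    rcases le_total 0 z with h2 | h2
    · rw [max_eq_right h2]
    · rw [max_eq_left h2, abs_of_nonpos (by linarith), abs_of_nonpos (by linarith)]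
      linarith
  · rw [min_eq_right h1, max_eq_right (h.trans h'), abs_of_nonneg (by linarith),
      abs_of_nonneg (by linarith)]
    linarith

theorem projDual_mem {χ : ℝ} (hχ : 0 ≤ χ) (z : ℝ) : projDual χ z ∈ Set.Icc 0 χ :=
  ⟨le_max_left _ _, max_le hχ (min_le_right _ _)⟩

/-- Regret of projected gradient descent on `[0, χ]` started at `0`. -/
theorem sum_dual_le {χ η B y : ℝ} (hη : 0 < η) (hy : y ∈ Set.Icc 0 χ) (Y c : ℕ → ℝ)
    (hY0 : Y 0 = 0) (hY : ∀ k, Y (k + 1) = projDual χ (Y k + η * c k)) (hc : ∀ k, |c k| ≤ B)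
    (K : ℕ) :
    ∑ k ∈ Finset.range K, (y - Y k) * c k ≤ y ^ 2 / (2 * η) + η * K * B ^ 2 / 2 := by
  -- The potential is the squared distance to the comparator; expanding one step produces the regret
  -- term and `η² c²`.
  have h : ∀ k, (Y k - y) ^ 2 ≤
      y ^ 2 - 2 * η * ∑ i ∈ Finset.range k, (y - Y i) * c i + k * (η ^ 2 * B ^ 2) := by
    intro k
    induction k with
    | zero => simp [hY0]
    | succ k ih =>
      have h1 := sq_projDual_sub_le (z := Y k + η * c k) hy
      rw [← hY] at h1
      have h2 : c k ^ 2 ≤ B ^ 2 := sq_le_sq' (neg_le_of_abs_le (hc k)) (le_of_abs_le (hc k))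
      have h3 := mul_le_mul_of_nonneg_left h2 (sq_nonneg η)
      rw [Finset.sum_range_succ]
      push_cast
      nlinarith
  have h1 := (sq_nonneg _).trans (h K)
  have h2 : ∑ k ∈ Finset.range K, (y - Y k) * c k ≤
      (y ^ 2 + K * (η ^ 2 * B ^ 2)) / (2 * η) := by
    rw [le_div_iff₀ (by positivity)]
    linarith
  refine h2.trans_eq ?_
  field_simp

variable {A : Type*} [Fintype A]

/-- One step of mirror descent with uniform mixing. -/
theorem mirror_step_le [Nonempty A] {p q q' Q : A → ℝ} (hp : p ∈ stdSimplex ℝ A)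
    (hq : q ∈ stdSimplex ℝ A) (hq0 : ∀ a, 0 < q a) {θ α B : ℝ} (hθ : 0 < θ) (hθ1 : θ ≤ 1)
    (hα : 0 ≤ α) (hQ : ∀ a, Q a ∈ Set.Icc 0 B)
    (hq' : ∀ a, q' a = ((1 - θ) * q a + θ * (1 / (Fintype.card A : ℝ))) * Real.exp (α * Q a) /
      ∑ a', ((1 - θ) * q a' + θ * (1 / (Fintype.card A : ℝ))) * Real.exp (α * Q a')) :
    α * ∑ a, Q a * (p a - q a) ≤ ∑ a, p a * Real.log (q' a) - ∑ a, p a * Real.log (q a) +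
      (θ * Real.log (Fintype.card A) + α ^ 2 * B ^ 2 / 8 + α * (θ * B)) := by
  set m : A → ℝ := fun a => (1 - θ) * q a + θ * (1 / (Fintype.card A : ℝ)) with hm
  have hcard : 0 < (Fintype.card A : ℝ) := by exact_mod_cast Fintype.card_pos
  have hθ' : 0 ≤ 1 - θ := by linarith
  have hm0 : ∀ a, 0 < m a := fun a =>
    add_pos_of_nonneg_of_pos (mul_nonneg hθ' (hq0 a).le) (by positivity)
  have hmS : m ∈ stdSimplex ℝ A := by
    refine ⟨fun a => (hm0 a).le, ?_⟩
    simp only [hm, Finset.sum_add_distrib, ← Finset.mul_sum, hq.2]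
    simp
  set Z := ∑ a, m a * Real.exp (α * Q a) with hZ
  have hZ0 : 0 < Z := Finset.sum_pos (fun a _ => mul_pos (hm0 a) (Real.exp_pos _))
    Finset.univ_nonempty
  -- Hoeffding's lemma under the mixed policy `m`.
  have hlogZ : Real.log Z ≤ α * ∑ a, m a * Q a + α ^ 2 * B ^ 2 / 8 := by
    rw [Real.log_le_iff_le_exp hZ0, Real.exp_add, hZ]
    have h := sum_mul_exp_le hmS hQ α
    have h2 : ∀ a, m a * Real.exp (α * Q a) = Real.exp (α * ∑ a, m a * Q a) *
        (m a * Real.exp (α * (Q a - ∑ y, m y * Q y))) := by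
      intro a
      rw [mul_left_comm, ← Real.exp_add]
      congr 2
      ring
    rw [Finset.sum_congr rfl fun a _ => h2 a, ← Finset.mul_sum]
    refine mul_le_mul_of_nonneg_left (h.trans_eq ?_) (Real.exp_pos _).le
    congr 1
    ring
  -- Concavity of the logarithm gives weight `1 - θ` on `log (q a)`; since `log (q a) ≤ 0`, that
  -- weight may be replaced by one.
  have hlogm : ∀ a, Real.log (q a) - θ * Real.log (Fintype.card A) ≤ Real.log (m a) := by
    intro a
    have h := strictConcaveOn_log_Ioi.concaveOn.2 (Set.mem_Ioi.2 (hq0 a))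
      (Set.mem_Ioi.2 (show (0 : ℝ) < 1 / (Fintype.card A : ℝ) by positivity)) hθ' hθ.le (by ring)
    simp only [smul_eq_mul, one_div, Real.log_inv] at h
    have h2 : Real.log (q a) ≤ 0 := Real.log_nonpos (hq0 a).le
      ((Finset.single_le_sum (fun a _ => hq.1 a) (Finset.mem_univ a)).trans_eq hq.2)
    simp only [hm, one_div]
    nlinarith
  have hlogq' : ∀ a, Real.log (q' a) = Real.log (m a) + α * Q a - Real.log Z := by
    intro a
    rw [hq' a, Real.log_div (mul_pos (hm0 a) (Real.exp_pos _)).ne' hZ0.ne',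
      Real.log_mul (hm0 a).ne' (Real.exp_pos _).ne', Real.log_exp]
  have h1 : ∑ a, p a * Real.log (q a) - θ * Real.log (Fintype.card A) ≤
      ∑ a, p a * Real.log (m a) := by
    calc _ = ∑ a, p a * (Real.log (q a) - θ * Real.log (Fintype.card A)) := by
          simp only [mul_sub, Finset.sum_sub_distrib, ← Finset.sum_mul, hp.2, one_mul]
      _ ≤ _ := Finset.sum_le_sum fun a _ => mul_le_mul_of_nonneg_left (hlogm a) (hp.1 a)
  have h2 : ∑ a, p a * Real.log (q' a) =
      ∑ a, p a * Real.log (m a) + α * ∑ a, p a * Q a - Real.log Z := by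
    simp only [hlogq', mul_sub, mul_add, Finset.sum_sub_distrib, Finset.sum_add_distrib,
      ← Finset.sum_mul, hp.2, one_mul, Finset.mul_sum]
    congr 2
    exact Finset.sum_congr rfl fun a _ => by ring
  have h3 : ∑ a, m a * Q a ≤ ∑ a, q a * Q a + θ * B := by
    have hu : ∑ a, 1 / (Fintype.card A : ℝ) * Q a ≤ B :=
      (sum_mul_mem_Icc ⟨fun _ => by positivity, by simp⟩ hQ).2
    have hqQ := (sum_mul_mem_Icc hq hQ).1
    have : ∑ a, m a * Q a = (1 - θ) * ∑ a, q a * Q a +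
        θ * ∑ a, 1 / (Fintype.card A : ℝ) * Q a := by
      simp only [hm, add_mul, Finset.sum_add_distrib, Finset.mul_sum, mul_assoc]
    nlinarith
  have h4 : ∑ a, Q a * (p a - q a) = ∑ a, p a * Q a - ∑ a, q a * Q a := by
    rw [← Finset.sum_sub_distrib]
    exact Finset.sum_congr rfl fun a _ => by ring
  have h5 := mul_le_mul_of_nonneg_left h3 hα
  rw [h4, h2]
  linarith

/-- Regret of mirror descent with uniform mixing, started at the uniform distribution. -/
theorem sum_mirror_le [Nonempty A] {p : A → ℝ} (hp : p ∈ stdSimplex ℝ A) (q Q : ℕ → A → ℝ)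
    {θ α B : ℝ} (hθ : 0 < θ) (hθ1 : θ ≤ 1) (hα : 0 ≤ α) (hQ : ∀ k a, Q k a ∈ Set.Icc 0 B)
    (hq0 : ∀ a, q 0 a = 1 / (Fintype.card A : ℝ))
    (hq : ∀ k a, q (k + 1) a =
      ((1 - θ) * q k a + θ * (1 / (Fintype.card A : ℝ))) * Real.exp (α * Q k a) /
      ∑ a', ((1 - θ) * q k a' + θ * (1 / (Fintype.card A : ℝ))) * Real.exp (α * Q k a'))
    (K : ℕ) :
    α * ∑ k ∈ Finset.range K, ∑ a, Q k a * (p a - q k a) ≤ Real.log (Fintype.card A) +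
      K * (θ * Real.log (Fintype.card A) + α ^ 2 * B ^ 2 / 8 + α * (θ * B)) := by
  have hcard : 0 < (Fintype.card A : ℝ) := by exact_mod_cast Fintype.card_pos
  have hmem : ∀ k, q k ∈ stdSimplex ℝ A ∧ ∀ a, 0 < q k a := by
    intro k
    induction k with
    | zero =>
      refine ⟨⟨fun a => ?_, ?_⟩, fun a => ?_⟩
      · rw [hq0]; positivity
      · simp [hq0]
      · rw [hq0]; positivity
    | succ k ih =>
      have hm : ∀ a, 0 < ((1 - θ) * q k a + θ * (1 / (Fintype.card A : ℝ))) *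
          Real.exp (α * Q k a) := fun a =>
        mul_pos (add_pos_of_nonneg_of_pos (mul_nonneg (by linarith) (ih.2 a).le) (by positivity))
          (Real.exp_pos _)
      have hS := Finset.sum_pos (fun a _ => hm a) (Finset.univ_nonempty (α := A))
      have hpos : ∀ a, 0 < q (k + 1) a := fun a => by
        rw [hq]
        exact div_pos (hm a) hS
      refine ⟨⟨fun a => (hpos a).le, ?_⟩, hpos⟩
      simp only [hq, ← Finset.sum_div]
      exact div_self hS.ne'
  -- The telescoping potential is the cross term `∑ p log q` instead of the full divergence, since
  -- the entropy of `p` cancels. It is at most zero at the end and equals `-log |A|` at the uniform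
  -- start.
  have h : ∀ k, α * ∑ i ∈ Finset.range k, ∑ a, Q i a * (p a - q i a) ≤
      ∑ a, p a * Real.log (q k a) - ∑ a, p a * Real.log (q 0 a) +
      k * (θ * Real.log (Fintype.card A) + α ^ 2 * B ^ 2 / 8 + α * (θ * B)) := by
    intro k
    induction k with
    | zero => simp
    | succ k ih =>
      have := mirror_step_le hp (hmem k).1 (hmem k).2 hθ hθ1 hα (hQ k) (hq k)
      rw [Finset.sum_range_succ, mul_add]
      push_cast
      linarith
  refine (h K).trans ?_
  have h1 : ∑ a, p a * Real.log (q K a) ≤ 0 := Finset.sum_nonpos fun a _ =>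
    mul_nonpos_of_nonneg_of_nonpos (hp.1 a) (Real.log_nonpos ((hmem K).1.1 a)
      ((Finset.single_le_sum (fun a _ => (hmem K).1.1 a) (Finset.mem_univ a)).trans_eq
        (hmem K).1.2))
  have h2 : ∑ a, p a * Real.log (q 0 a) = - Real.log (Fintype.card A) := by
    simp only [hq0, ← Finset.sum_mul, hp.2, one_mul, one_div, Real.log_inv]
  linarith

end OnlineLearning

/-! ### The estimates as ridge regressions, and their dependence on the past. -/

section Regression

set_option linter.unusedSectionVars false

variable {S A ι₁ ι₂ : Type*} [Fintype S] [DecidableEq S] [Fintype A]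
  [Fintype ι₁] [DecidableEq ι₁] [Fintype ι₂] [DecidableEq ι₂] {H n : ℕ}

/-- A family over `Fin n` evaluated at `i`, or `0` if `n ≤ i`. -/
def extendZero {β : Type*} [Zero β] (f : Fin n → β) (i : ℕ) : β :=
  if h : i < n then f ⟨i, h⟩ else 0

theorem extendZero_of_lt {β : Type*} [Zero β] (f : Fin n → β) {i : ℕ} (h : i < n) :
    extendZero f i = f ⟨i, h⟩ := dif_pos h

/-- Index `τ` carries episode `τ + 1`, so the episodes before episode `N + 1` have the indices in
`range N`. -/
theorem sum_filter_lt_eq_sum_range {β : Type*} [AddCommMonoid β] {N : ℕ} (hN : N ≤ n)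
    (f : Fin n → β) (g : ℕ → β) (hfg : ∀ τ : Fin n, g τ = f τ) :
    ∑ τ ∈ Finset.univ.filter (fun τ : Fin n => (τ : ℕ) + 1 < N + 1), f τ =
      ∑ i ∈ Finset.range N, g i := by
  refine Finset.sum_bij (fun τ _ => (τ : ℕ)) ?_ ?_ ?_ ?_
  · intro τ hτ
    simpa using hτ
  · intro τ _ τ' _ h
    exact Fin.ext h
  · intro i hi
    rw [Finset.mem_range] at hi
    exact ⟨⟨i, by omega⟩, by simpa using hi, rfl⟩
  · intro τ _
    exact (hfg τ).symm

/-- The regression features `φ_{⋄,h}^τ(x_h^τ, a_h^τ)` of the past episodes. -/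
def phiSeq (F : Features S A ι₁ ι₂) (ω : Fin n → Trajectory S A H) (prev : ℕ → Iterate S A H)
    (s : Signal) (h : Fin H) : ℕ → ι₁ → ℝ :=
  extendZero fun τ : Fin n =>
    phiOf F ((prev (τ + 1)).V s (h + 1)) ((ω τ).state h.castSucc) ((ω τ).action h)

/-- The regression targets `V_{⋄,h+1}^τ(x_{h+1}^τ)` of the past episodes. -/
def targetSeq (ω : Fin n → Trajectory S A H) (prev : ℕ → Iterate S A H)
    (s : Signal) (h : Fin H) : ℕ → ℝ :=
  extendZero fun τ : Fin n => (prev (τ + 1)).V s (h + 1) ((ω τ).state h.succ)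

/-- The value features `φ(x_h^τ, a_h^τ)` of the past episodes. -/
def valSeq (F : Features S A ι₁ ι₂) (ω : Fin n → Trajectory S A H) (h : Fin H) : ℕ → ι₂ → ℝ :=
  extendZero fun τ : Fin n => F.φ ((ω τ).state h.castSucc) ((ω τ).action h)

/-- The observed signals of the past episodes. -/
def signalSeq (M : CMDP S A H) (ω : Fin n → Trajectory S A H) (s : Signal) (h : Fin H) : ℕ → ℝ :=
  extendZero fun τ : Fin n => M.signal s h ((ω τ).state h.castSucc) ((ω τ).action h)

/-- The least-squares estimate of the action value after `N` episodes. -/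
def lstdEst (M : CMDP S A H) (F : Features S A ι₁ ι₂) (ω : Fin n → Trajectory S A H)
    (prev : ℕ → Iterate S A H) (N : ℕ) (s : Signal) (h : Fin H) (V : S → ℝ) (x : S) (a : A) : ℝ :=
  F.φ x a ⬝ᵥ (gram (valSeq F ω h) N)⁻¹ *ᵥ
      (∑ i ∈ Finset.range N, signalSeq M ω s h i • valSeq F ω h i) +
    phiOf F V x a ⬝ᵥ (gram (phiSeq F ω prev s h) N)⁻¹ *ᵥ
      (∑ i ∈ Finset.range N, targetSeq ω prev s h i • phiSeq F ω prev s h i)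

/-- The exploration bonus after `N` episodes. -/
def lstdWidth (F : Features S A ι₁ ι₂) (c : Params) (ω : Fin n → Trajectory S A H)
    (prev : ℕ → Iterate S A H) (N : ℕ) (s : Signal) (h : Fin H) (V : S → ℝ) (x : S) (a : A) : ℝ :=
  c.β * invNorm (gram (valSeq F ω h) N) (F.φ x a) +
    c.β * invNorm (gram (phiSeq F ω prev s h) N) (phiOf F V x a)

/-- With regularization one, both regression matrices are instances of `gram`. Sequences over `ℕ`
make the Gram matrices of different episodes comparable. -/
theorem lstdQ_eq (M : CMDP S A H) (F : Features S A ι₁ ι₂) {c : Params} (hlam : c.lam = 1)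
    (ω : Fin n → Trajectory S A H) (prev : ℕ → Iterate S A H) {N : ℕ} (hN : N ≤ n) (s : Signal)
    (h : Fin H) (V : S → ℝ) (x : S) (a : A) :
    lstdQ M F c ω prev (N + 1) s h V x a =
      max 0 (min (lstdEst M F ω prev N s h V x a + lstdWidth F c ω prev N s h V x a)
        ((H : ℝ) - h)) := by
  have e1 : ∀ τ : Fin n, phiSeq F ω prev s h τ =
      phiOf F ((prev (τ + 1)).V s (h + 1)) ((ω τ).state h.castSucc) ((ω τ).action h) :=
    fun τ => extendZero_of_lt _ τ.2
  have e2 : ∀ τ : Fin n, targetSeq ω prev s h τ =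
      (prev (τ + 1)).V s (h + 1) ((ω τ).state h.succ) := fun τ => extendZero_of_lt _ τ.2
  have e3 : ∀ τ : Fin n, valSeq F ω h τ = F.φ ((ω τ).state h.castSucc) ((ω τ).action h) :=
    fun τ => extendZero_of_lt _ τ.2
  have e4 : ∀ τ : Fin n, signalSeq M ω s h τ =
      M.signal s h ((ω τ).state h.castSucc) ((ω τ).action h) := fun τ => extendZero_of_lt _ τ.2
  simp only [lstdQ, ← e1, ← e2, ← e3, ← e4, hlam, one_smul]
  rw [sum_filter_lt_eq_sum_range hN _ (fun i => Matrix.vecMulVec (valSeq F ω h i) (valSeq F ω h i))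
      fun _ => rfl,
    sum_filter_lt_eq_sum_range hN _ (fun i => signalSeq M ω s h i • valSeq F ω h i) fun _ => rfl,
    sum_filter_lt_eq_sum_range hN _ (fun i => Matrix.vecMulVec (phiSeq F ω prev s h i)
      (phiSeq F ω prev s h i)) fun _ => rfl,
    sum_filter_lt_eq_sum_range hN _ (fun i => targetSeq ω prev s h i • phiSeq F ω prev s h i)
      fun _ => rfl]
  rfl

/-- The estimate and the bonus depend only on the first `N` episodes. -/
theorem lstdEst_congr (M : CMDP S A H) (F : Features S A ι₁ ι₂) {n' : ℕ}
    {ω : Fin n → Trajectory S A H} {ω' : Fin n' → Trajectory S A H} {prev prev' : ℕ → Iterate S A H}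
    {N : ℕ} (hN : N ≤ n) (hN' : N ≤ n')
    (hω : ∀ i (hi : i < N), ω ⟨i, hi.trans_le hN⟩ = ω' ⟨i, hi.trans_le hN'⟩)
    (hprev : ∀ i ≤ N, prev i = prev' i) (s : Signal) (h : Fin H) :
    lstdEst M F ω prev N s h = lstdEst M F ω' prev' N s h ∧
      ∀ c, lstdWidth F c ω prev N s h = lstdWidth F c ω' prev' N s h := by
  have e1 : ∀ i < N, phiSeq F ω prev s h i = phiSeq F ω' prev' s h i := fun i hi => by
    rw [phiSeq, phiSeq, extendZero_of_lt _ (hi.trans_le hN), extendZero_of_lt _ (hi.trans_le hN'),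
      hω i hi, hprev (i + 1) hi]
  have e2 : ∀ i < N, targetSeq ω prev s h i = targetSeq ω' prev' s h i := fun i hi => by
    rw [targetSeq, targetSeq, extendZero_of_lt _ (hi.trans_le hN),
      extendZero_of_lt _ (hi.trans_le hN'), hω i hi, hprev (i + 1) hi]
  have e3 : ∀ i < N, valSeq F ω h i = valSeq F ω' h i := fun i hi => by
    rw [valSeq, valSeq, extendZero_of_lt _ (hi.trans_le hN), extendZero_of_lt _ (hi.trans_le hN'),
      hω i hi]
  have e4 : ∀ i < N, signalSeq M ω s h i = signalSeq M ω' s h i := fun i hi => by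
    rw [signalSeq, signalSeq, extendZero_of_lt _ (hi.trans_le hN),
      extendZero_of_lt _ (hi.trans_le hN'), hω i hi]
  have s1 : ∑ i ∈ Finset.range N, signalSeq M ω s h i • valSeq F ω h i =
      ∑ i ∈ Finset.range N, signalSeq M ω' s h i • valSeq F ω' h i :=
    Finset.sum_congr rfl fun i hi => by rw [e3 i (Finset.mem_range.1 hi), e4 i (Finset.mem_range.1 hi)]
  have s2 : ∑ i ∈ Finset.range N, targetSeq ω prev s h i • phiSeq F ω prev s h i =
      ∑ i ∈ Finset.range N, targetSeq ω' prev' s h i • phiSeq F ω' prev' s h i :=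
    Finset.sum_congr rfl fun i hi => by rw [e1 i (Finset.mem_range.1 hi), e2 i (Finset.mem_range.1 hi)]
  constructor
  · funext V x a
    simp only [lstdEst, gram_congr e1, gram_congr e3, s1, s2]
  · intro c
    funext V x a
    simp only [lstdWidth, gram_congr e1, gram_congr e3]

theorem lstdQ_congr (M : CMDP S A H) (F : Features S A ι₁ ι₂) {c : Params} (hlam : c.lam = 1)
    {n' : ℕ} {ω : Fin n → Trajectory S A H} {ω' : Fin n' → Trajectory S A H}
    {prev prev' : ℕ → Iterate S A H} {N : ℕ} (hN : N ≤ n) (hN' : N ≤ n')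
    (hω : ∀ i (hi : i < N), ω ⟨i, hi.trans_le hN⟩ = ω' ⟨i, hi.trans_le hN'⟩)
    (hprev : ∀ i ≤ N, prev i = prev' i) (s : Signal) (h : Fin H) :
    lstdQ M F c ω prev (N + 1) s h = lstdQ M F c ω' prev' (N + 1) s h := by
  funext V x a
  obtain ⟨h1, h2⟩ := lstdEst_congr M F hN hN' hω hprev s h
  rw [lstdQ_eq M F hlam ω prev hN, lstdQ_eq M F hlam ω' prev' hN', h1, h2]

theorem lstdV_congr (M : CMDP S A H) (F : Features S A ι₁ ι₂) {c : Params} (hlam : c.lam = 1)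
    {n' : ℕ} {ω : Fin n → Trajectory S A H} {ω' : Fin n' → Trajectory S A H}
    {prev prev' : ℕ → Iterate S A H} {N : ℕ} (hN : N ≤ n) (hN' : N ≤ n')
    (hω : ∀ i (hi : i < N), ω ⟨i, hi.trans_le hN⟩ = ω' ⟨i, hi.trans_le hN'⟩)
    (hprev : ∀ i ≤ N, prev i = prev' i) (π : Fin H → S → A → ℝ) (s : Signal) (h : ℕ) :
    lstdV M F c ω prev (N + 1) π s h = lstdV M F c ω' prev' (N + 1) π s h := by
  rw [lstdV]
  conv_rhs => rw [lstdV]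
  split_ifs with hh
  · rw [lstdV_congr M F hlam hN hN' hω hprev π s (h + 1), lstdQ_congr M F hlam hN hN' hω hprev]
  · rfl
termination_by H - h

theorem iterate_zero (M : CMDP S A H) (F : Features S A ι₁ ι₂) (c : Params)
    (ω : Fin n → Trajectory S A H) : iterate M F c ω 0 = initIterate M := by
  rw [iterate, if_pos rfl]

/-- The iterate `k` depends only on the episodes before episode `k`. -/
theorem iterate_congr (M : CMDP S A H) (F : Features S A ι₁ ι₂) {c : Params} (hlam : c.lam = 1)
    {n' : ℕ} {ω : Fin n → Trajectory S A H} {ω' : Fin n' → Trajectory S A H} {N : ℕ} (hN : N ≤ n)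
    (hN' : N ≤ n') (hω : ∀ i (hi : i < N), ω ⟨i, hi.trans_le hN⟩ = ω' ⟨i, hi.trans_le hN'⟩)
    (k : ℕ) (hk : k ≤ N + 1) : iterate M F c ω k = iterate M F c ω' k := by
  induction k using Nat.strong_induction_on with
  | _ k ih =>
    rcases k with _ | k
    · rw [iterate_zero, iterate_zero]
    · have hp : (fun τ => if _h : τ < k + 1 then iterate M F c ω τ else initIterate M) =
          fun τ => if _h : τ < k + 1 then iterate M F c ω' τ else initIterate M := by
        funext τ
        split_ifs with hτ
        · exact ih τ hτ (by omega)
        · rfl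
      have hω' : ∀ i (hi : i < k), ω ⟨i, by omega⟩ = ω' ⟨i, by omega⟩ :=
        fun i hi => hω i (by omega)
      rw [iterate, if_neg k.succ_ne_zero]
      conv_rhs => rw [iterate, if_neg k.succ_ne_zero]
      rw [hp]
      simp only [nextIterate]
      congr 1
      · funext s h
        rw [lstdQ_congr M F hlam (by omega : k ≤ n) (by omega : k ≤ n') hω' fun _ _ => rfl,
          lstdV_congr M F hlam (by omega : k ≤ n) (by omega : k ≤ n') hω' fun _ _ => rfl]
      · funext s h
        rw [lstdV_congr M F hlam (by omega : k ≤ n) (by omega : k ≤ n') hω' fun _ _ => rfl]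

theorem iterate_policy (M : CMDP S A H) (F : Features S A ι₁ ι₂) (c : Params)
    (ω : Fin n → Trajectory S A H) (N : ℕ) :
    (iterate M F c ω (N + 1)).policy = improve c (iterate M F c ω N) := by
  rw [iterate, if_neg N.succ_ne_zero]
  simp [nextIterate]

theorem iterate_Y (M : CMDP S A H) (F : Features S A ι₁ ι₂) (c : Params)
    (ω : Fin n → Trajectory S A H) (N : ℕ) :
    (iterate M F c ω (N + 1)).Y = projDual c.χ ((iterate M F c ω N).Y +
      c.η * (M.b - (iterate M F c ω N).V .utility 0 M.x₁)) := by
  rw [iterate, if_neg N.succ_ne_zero]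
  simp [nextIterate]

theorem iterate_V_last (M : CMDP S A H) (F : Features S A ι₁ ι₂) (c : Params)
    (ω : Fin n → Trajectory S A H) (N : ℕ) (s : Signal) :
    (iterate M F c ω (N + 1)).V s H = 0 := by
  rw [iterate, if_neg N.succ_ne_zero]
  simp only [nextIterate]
  rw [lstdV, dif_neg (lt_irrefl H)]

theorem iterate_V (M : CMDP S A H) (F : Features S A ι₁ ι₂) (c : Params)
    (ω : Fin n → Trajectory S A H) (N : ℕ) (s : Signal) (h : Fin H) (x : S) :
    (iterate M F c ω (N + 1)).V s h x =
      ∑ a, (iterate M F c ω (N + 1)).Q s h x a * (iterate M F c ω (N + 1)).policy h x a := by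
  rw [iterate, if_neg N.succ_ne_zero]
  simp only [nextIterate]
  rw [lstdV, dif_pos h.2]

theorem iterate_Q (M : CMDP S A H) (F : Features S A ι₁ ι₂) {c : Params} (hlam : c.lam = 1)
    (ω : Fin n → Trajectory S A H) {N : ℕ} (hN : N ≤ n) (s : Signal) (h : Fin H) (x : S) (a : A) :
    (iterate M F c ω (N + 1)).Q s h x a = max 0 (min
      (lstdEst M F ω (iterate M F c ω) N s h ((iterate M F c ω (N + 1)).V s (h + 1)) x a +
        lstdWidth F c ω (iterate M F c ω) N s h ((iterate M F c ω (N + 1)).V s (h + 1)) x a)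
      ((H : ℝ) - h)) := by
  have hV : (iterate M F c ω (N + 1)).Q s h x a = lstdQ M F c ω
      (fun τ => if _h : τ < N + 1 then iterate M F c ω τ else initIterate M) (N + 1) s h
      ((iterate M F c ω (N + 1)).V s (h + 1)) x a := by
    rw [iterate, if_neg N.succ_ne_zero]
    rfl
  -- The recursion is given the iterates truncated after `N`; this is harmless, as the regression
  -- reads only those up to `N`.
  rw [hV, lstdQ_congr M F hlam hN hN (fun _ _ => rfl) (prev' := iterate M F c ω)
    (fun i hi => dif_pos (by omega)), lstdQ_eq M F hlam ω _ hN]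

theorem iterate_Q_mem (M : CMDP S A H) (F : Features S A ι₁ ι₂) (c : Params)
    (ω : Fin n → Trajectory S A H) (N : ℕ) (s : Signal) (h : Fin H) (x : S) (a : A) :
    (iterate M F c ω (N + 1)).Q s h x a ∈ Set.Icc 0 ((H : ℝ) - h) := by
  have hh : (0 : ℝ) ≤ (H : ℝ) - h := by
    have : ((h : ℕ) : ℝ) ≤ H := by exact_mod_cast h.2.le
    linarith
  rw [iterate, if_neg N.succ_ne_zero]
  simp only [nextIterate, lstdQ]
  exact ⟨le_max_left _ _, max_le hh (min_le_right _ _)⟩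

theorem iterate_V_mem (M : CMDP S A H) (F : Features S A ι₁ ι₂) {c : Params}
    (hθ : c.θ ∈ Set.Icc (0 : ℝ) 1) [Nonempty A] (ω : Fin n → Trajectory S A H) (N : ℕ)
    (s : Signal) {h : ℕ} (hh : h ≤ H) (x : S) :
    (iterate M F c ω (N + 1)).V s h x ∈ Set.Icc 0 ((H : ℝ) - h) := by
  rcases hh.eq_or_lt with rfl | hh
  · simp [iterate_V_last]
  · have h1 := iterate_V M F c ω N s ⟨h, hh⟩ x
    simp only [mul_comm ((iterate M F c ω (N + 1)).Q _ _ _ _)] at h1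
    rw [h1]
    exact sum_mul_mem_Icc (isPolicy_iterate M F c hθ ω (N + 1) _ x)
      fun a => iterate_Q_mem M F c ω N s ⟨h, hh⟩ x a

end Regression

/-! ### Supermartingales along a run of the algorithm. -/

section Run

set_option linter.unusedSectionVars false

variable {S A ι₁ ι₂ : Type*} [Fintype S] [DecidableEq S] [Fintype A]
  [Fintype ι₁] [DecidableEq ι₁] [Fintype ι₂] [DecidableEq ι₂] {H n : ℕ}

/-- Append one episode to a run. -/
def appendEpisode (ω : Fin n → Trajectory S A H) (τ : Trajectory S A H) :
    Fin (n + 1) → Trajectory S A H :=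
  Fin.snoc (α := fun _ => Trajectory S A H) ω τ

theorem appendEpisode_of_lt (ω : Fin n → Trajectory S A H) (τ : Trajectory S A H) {i : ℕ}
    (hi : i < n) : appendEpisode ω τ ⟨i, hi.trans n.lt_succ_self⟩ = ω ⟨i, hi⟩ :=
  Fin.snoc_castSucc (α := fun _ => Trajectory S A H) τ ω ⟨i, hi⟩

theorem appendEpisode_last (ω : Fin n → Trajectory S A H) (τ : Trajectory S A H) :
    appendEpisode ω τ ⟨n, n.lt_succ_self⟩ = τ :=
  Fin.snoc_last (α := fun _ => Trajectory S A H) τ ω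

theorem iterate_appendEpisode (M : CMDP S A H) (F : Features S A ι₁ ι₂) {c : Params}
    (hlam : c.lam = 1) (ω : Fin n → Trajectory S A H) (τ : Trajectory S A H) {k : ℕ}
    (hk : k ≤ n + 1) : iterate M F c (appendEpisode ω τ) k = iterate M F c ω k :=
  iterate_congr M F hlam n.le_succ le_rfl (fun _ hi => appendEpisode_of_lt ω τ hi) k hk

theorem episodePolicy_eq {K : ℕ} (M : CMDP S A H) (F : Features S A ι₁ ι₂) {c : Params}
    (hlam : c.lam = 1) (ω : Fin K → Trajectory S A H) (k : Fin K) :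
    episodePolicy M F c ω k = (iterate M F c ω (k + 1)).policy := by
  rw [episodePolicy, iterate_congr M F hlam le_rfl k.2.le (fun _ _ => rfl) _ le_rfl]

/-- The tower property: given the first `n` episodes, the next trajectory follows the policy of
iterate `n + 1`, which those episodes determine. -/
theorem sum_runWeight_succ_mul (M : CMDP S A H) (F : Features S A ι₁ ι₂) {c : Params}
    (hlam : c.lam = 1) (Φ : (Fin (n + 1) → Trajectory S A H) → ℝ) :
    ∑ ω : Fin (n + 1) → Trajectory S A H, runWeight M F c ω * Φ ω =
      ∑ ω : Fin n → Trajectory S A H, runWeight M F c ω *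
        ∑ τ, trajWeight M (iterate M F c ω (n + 1)).policy τ * Φ (appendEpisode ω τ) := by
  rw [← (Fin.snocEquiv (fun _ : Fin (n + 1) => Trajectory S A H)).sum_comp,
    Fintype.sum_prod_type_right]
  refine Finset.sum_congr rfl fun ω _ => ?_
  rw [Finset.mul_sum]
  refine Finset.sum_congr rfl fun τ _ => ?_
  change runWeight M F c (appendEpisode ω τ) * Φ (appendEpisode ω τ) = _
  rw [← mul_assoc]
  congr 1
  rw [runWeight, Fin.prod_univ_castSucc, runWeight]
  congr 1
  · refine Finset.prod_congr rfl fun k _ => ?_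
    rw [episodePolicy_eq M F hlam, episodePolicy_eq M F hlam, Fin.val_castSucc,
      iterate_appendEpisode M F hlam ω τ (by omega)]
    congr 1
    exact appendEpisode_of_lt ω τ k.2
  · rw [episodePolicy_eq M F hlam, Fin.val_last, iterate_appendEpisode M F hlam ω τ le_rfl]
    congr 1
    exact appendEpisode_last ω τ

theorem runWeight_nonneg [Nonempty A] (M : CMDP S A H) (F : Features S A ι₁ ι₂) {c : Params}
    (hθ : c.θ ∈ Set.Icc (0 : ℝ) 1) (ω : Fin n → Trajectory S A H) : 0 ≤ runWeight M F c ω :=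
  Finset.prod_nonneg fun _ _ => trajWeight_nonneg M (isPolicy_iterate M F c hθ _ _) _

/-- Supermartingales started at one have expectation at most one. -/
theorem sum_runWeight_mul_le_one [Nonempty A] (M : CMDP S A H) (F : Features S A ι₁ ι₂) {c : Params}
    (hlam : c.lam = 1) (hθ : c.θ ∈ Set.Icc (0 : ℝ) 1)
    (Ψ : ∀ n, (Fin n → Trajectory S A H) → ℕ → ℝ) (h0 : ∀ n ω, Ψ n ω 0 = 1)
    (hpre : ∀ n ω τ N, N ≤ n → Ψ (n + 1) (appendEpisode ω τ) N = Ψ n ω N)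
    (hstep : ∀ n ω, ∑ τ, trajWeight M (iterate M F c ω (n + 1)).policy τ *
      Ψ (n + 1) (appendEpisode ω τ) (n + 1) ≤ Ψ n ω n) (n N : ℕ) (hN : N ≤ n) :
    ∑ ω : Fin n → Trajectory S A H, runWeight M F c ω * Ψ n ω N ≤ 1 := by
  induction n generalizing N with
  | zero =>
    obtain rfl : N = 0 := by omega
    simp only [h0, mul_one]
    exact (sum_runWeight M F c hθ 0).le
  | succ n ih =>
    rw [sum_runWeight_succ_mul M F hlam]
    rcases hN.eq_or_lt with rfl | hN
    · refine (Finset.sum_le_sum fun ω _ => ?_).trans (ih n le_rfl)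
      exact mul_le_mul_of_nonneg_left (hstep n ω) (runWeight_nonneg M F hθ ω)
    · refine (Finset.sum_le_sum fun ω _ => ?_).trans (ih N (by omega))
      refine mul_le_mul_of_nonneg_left (le_of_eq ?_) (runWeight_nonneg M F hθ ω)
      simp only [hpre n ω _ N (by omega), ← Finset.sum_mul,
        sum_trajWeight M (isPolicy_iterate M F c hθ ω _), one_mul]

open Classical in
/-- Markov's inequality for the law of the run. -/
theorem sum_filter_runWeight_le [Nonempty A] (M : CMDP S A H) (F : Features S A ι₁ ι₂) {c : Params}
    (hθ : c.θ ∈ Set.Icc (0 : ℝ) 1) {δ : ℝ} (hδ : 0 < δ)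
    (Φ : (Fin n → Trajectory S A H) → ℝ) (hΦ0 : ∀ ω, 0 ≤ Φ ω)
    (hΦ : ∑ ω : Fin n → Trajectory S A H, runWeight M F c ω * Φ ω ≤ 1) :
    ∑ ω with ¬ Φ ω < 1 / δ, runWeight M F c ω ≤ δ := by
  have h1 : ∑ ω with ¬ Φ ω < 1 / δ, runWeight M F c ω ≤
      ∑ ω with ¬ Φ ω < 1 / δ, δ * (runWeight M F c ω * Φ ω) := by
    refine Finset.sum_le_sum fun ω hω => ?_
    have h2 := not_lt.1 (Finset.mem_filter.1 hω).2
    rw [div_le_iff₀ hδ] at h2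
    nlinarith [runWeight_nonneg M F hθ ω]
  refine h1.trans ?_
  rw [← Finset.mul_sum]
  refine (mul_le_mul_of_nonneg_left ((Finset.sum_le_sum_of_subset_of_nonneg
    (Finset.filter_subset _ _) fun ω _ _ => mul_nonneg (runWeight_nonneg M F hθ ω) (hΦ0 ω)).trans hΦ)
    hδ.le).trans_eq (mul_one _)

/-- The regression noise `V_{⋄,h+1}^τ(x_{h+1}^τ) - (P_h V_{⋄,h+1}^τ)(x_h^τ, a_h^τ)`. -/
def noiseSeq (M : CMDP S A H) (ω : Fin n → Trajectory S A H) (prev : ℕ → Iterate S A H)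
    (s : Signal) (h : Fin H) : ℕ → ℝ :=
  extendZero fun τ : Fin n => (prev (τ + 1)).V s (h + 1) ((ω τ).state h.succ) -
    ∑ y, M.P h ((ω τ).state h.castSucc) ((ω τ).action h) y * (prev (τ + 1)).V s (h + 1) y

/-- The self-normalized process of the regression at `(s, h)`. -/
def regressionExp (M : CMDP S A H) (F : Features S A ι₁ ι₂) (c : Params)
    (ω : Fin n → Trajectory S A H) (s : Signal) (h : Fin H) (N : ℕ) : ℝ :=
  selfNormExp ((H : ℝ) ^ 2 / 4) (phiSeq F ω (iterate M F c ω) s h)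
    (noiseSeq M ω (iterate M F c ω) s h) N

/-- Conditionally on the past and on `(x_h, a_h)`, the only randomness left in the new term is the
next state. The value estimate takes values in `[0, H]`, so Hoeffding's lemma gives the variance
proxy `H²/4`. -/
theorem sum_runWeight_mul_regressionExp_le [Nonempty A] (M : CMDP S A H) (F : Features S A ι₁ ι₂)
    {c : Params} (hlam : c.lam = 1) (hθ : c.θ ∈ Set.Icc (0 : ℝ) 1) (s : Signal) (h : Fin H)
    {N : ℕ} (hN : N ≤ n) :
    ∑ ω : Fin n → Trajectory S A H, runWeight M F c ω * regressionExp M F c ω s h N ≤ 1 := by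
  have hH : (0 : ℝ) < H := by exact_mod_cast h.pos
  have hphi : ∀ {n : ℕ} (ω : Fin n → Trajectory S A H) τ i, i < n →
      phiSeq F (appendEpisode ω τ) (iterate M F c (appendEpisode ω τ)) s h i =
        phiSeq F ω (iterate M F c ω) s h i := by
    intro n ω τ i hi
    rw [phiSeq, phiSeq, extendZero_of_lt _ hi, extendZero_of_lt _ (hi.trans n.lt_succ_self),
      appendEpisode_of_lt ω τ hi, iterate_appendEpisode M F hlam ω τ (by simpa using hi.le)]
  have hnoise : ∀ {n : ℕ} (ω : Fin n → Trajectory S A H) τ i, i < n →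
      noiseSeq M (appendEpisode ω τ) (iterate M F c (appendEpisode ω τ)) s h i =
        noiseSeq M ω (iterate M F c ω) s h i := by
    intro n ω τ i hi
    rw [noiseSeq, noiseSeq, extendZero_of_lt _ hi, extendZero_of_lt _ (hi.trans n.lt_succ_self),
      appendEpisode_of_lt ω τ hi, iterate_appendEpisode M F hlam ω τ (by simpa using hi.le)]
  refine sum_runWeight_mul_le_one M F hlam hθ (fun n ω N => regressionExp M F c ω s h N)
    (fun n ω => selfNormExp_zero _ _ _) (fun n ω τ N hN => ?_) (fun n ω => ?_) n N hN
  · exact selfNormExp_congr (fun i hi => hphi ω τ i (hi.trans_le hN))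
      fun i hi => hnoise ω τ i (hi.trans_le hN)
  · set V : S → ℝ := (iterate M F c ω (n + 1)).V s (h + 1) with hV
    have hVmem : ∀ y, V y ∈ Set.Icc (0 : ℝ) H := fun y => by
      have h1 := iterate_V_mem M F hθ ω n s (show (h : ℕ) + 1 ≤ H from h.2) y
      exact ⟨h1.1, h1.2.trans (sub_le_self _ (Nat.cast_nonneg _))⟩
    -- The new feature is a function of `(x, a)` and the new noise of `(x, a, x')`, all earlier
    -- entries being frozen; this makes the process a function of one transition.
    let f : S → A → ℕ → ι₁ → ℝ := fun x a =>
      Function.update (phiSeq F ω (iterate M F c ω) s h) n (phiOf F V x a)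
    let e : S → A → S → ℕ → ℝ := fun x a x' =>
      Function.update (noiseSeq M ω (iterate M F c ω) s h) n (V x' - ∑ y, M.P h x a y * V y)
    have hG : ∀ τ : Trajectory S A H,
        regressionExp M F c (appendEpisode ω τ) s h (n + 1) =
          selfNormExp ((H : ℝ) ^ 2 / 4) (f (τ.state h.castSucc) (τ.action h))
            (e (τ.state h.castSucc) (τ.action h) (τ.state h.succ)) (n + 1) := by
      intro τ
      refine selfNormExp_congr (fun i hi => ?_) fun i hi => ?_
      · rcases (Nat.lt_succ_iff.1 hi).eq_or_lt with rfl | hi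
        · rw [phiSeq, extendZero_of_lt _ (Nat.lt_succ_self _), appendEpisode_last,
            iterate_appendEpisode M F hlam ω τ le_rfl]
          simp [f, hV]
        · rw [hphi ω τ i hi]
          simp [f, hi.ne]
      · rcases (Nat.lt_succ_iff.1 hi).eq_or_lt with rfl | hi
        · rw [noiseSeq, extendZero_of_lt _ (Nat.lt_succ_self _), appendEpisode_last,
            iterate_appendEpisode M F hlam ω τ le_rfl]
          simp [e, hV]
        · rw [hnoise ω τ i hi]
          simp [e, hi.ne]
    simp only [hG]
    refine sum_trajWeight_mul_le M (isPolicy_iterate M F c hθ ω _) h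
      (fun x a x' => selfNormExp ((H : ℝ) ^ 2 / 4) (f x a) (e x a x') (n + 1)) fun x a => ?_
    refine (sum_mul_selfNormExp_succ_le (M.P_mem h x a)
      (ε := fun x' => V x' - ∑ y, M.P h x a y * V y) (by positivity) (fun t => ?_) (f x a) (e x a)
      (noiseSeq M ω (iterate M F c ω) s h) n (fun x' i hi => ?_) fun x' => ?_).trans_eq ?_
    · simpa using sum_mul_exp_le (M.P_mem h x a) hVmem t
    · simp [e, hi.ne]
    · simp [e]
    · exact selfNormExp_congr (fun i hi => by simp [f, hi.ne]) fun _ _ => rfl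

/-- The clipped bonus of the action value estimates of episode `N + 1`. -/
def clippedBonus (M : CMDP S A H) (F : Features S A ι₁ ι₂) (c : Params)
    (ω : Fin n → Trajectory S A H) (s : Signal) (N : ℕ) (h : Fin H) (x : S) (a : A) : ℝ :=
  min (H : ℝ) (2 * lstdWidth F c ω (iterate M F c ω) N s h
    ((iterate M F c ω (N + 1)).V s (h + 1)) x a)

theorem clippedBonus_mem (M : CMDP S A H) (F : Features S A ι₁ ι₂) {c : Params} (hβ : 0 ≤ c.β)
    (ω : Fin n → Trajectory S A H) (s : Signal) (N : ℕ) (h : Fin H) (x : S) (a : A) :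
    clippedBonus M F c ω s N h x a ∈ Set.Icc (0 : ℝ) H :=
  ⟨le_min (Nat.cast_nonneg _) (mul_nonneg zero_le_two (add_nonneg
    (mul_nonneg hβ (invNorm_nonneg _ _)) (mul_nonneg hβ (invNorm_nonneg _ _)))), min_le_left _ _⟩

/-- The sum of the clipped bonuses along a trajectory. -/
def trajBonus (M : CMDP S A H) (F : Features S A ι₁ ι₂) (c : Params)
    (ω : Fin n → Trajectory S A H) (s : Signal) (N : ℕ) (τ : Trajectory S A H) : ℝ :=
  ∑ h, clippedBonus M F c ω s N h (τ.state h.castSucc) (τ.action h)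

/-- The expected sum of the clipped bonuses in episode `N + 1`. -/
def meanBonus (M : CMDP S A H) (F : Features S A ι₁ ι₂) (c : Params)
    (ω : Fin n → Trajectory S A H) (s : Signal) (N : ℕ) : ℝ :=
  ∑ τ, trajWeight M (iterate M F c ω (N + 1)).policy τ * trajBonus M F c ω s N τ

theorem trajBonus_mem (M : CMDP S A H) (F : Features S A ι₁ ι₂) {c : Params} (hβ : 0 ≤ c.β)
    (ω : Fin n → Trajectory S A H) (s : Signal) (N : ℕ) (τ : Trajectory S A H) :
    trajBonus M F c ω s N τ ∈ Set.Icc (0 : ℝ) (H ^ 2) := by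
  refine ⟨Finset.sum_nonneg fun h _ => (clippedBonus_mem M F hβ ω s N h _ _).1, ?_⟩
  refine (Finset.sum_le_sum fun h _ => (clippedBonus_mem M F hβ ω s N h _ _).2).trans ?_
  simp [sq]

theorem trajBonus_appendEpisode (M : CMDP S A H) (F : Features S A ι₁ ι₂) {c : Params}
    (hlam : c.lam = 1) (ω : Fin n → Trajectory S A H) (τ : Trajectory S A H) (s : Signal) {N : ℕ}
    (hN : N ≤ n) : trajBonus M F c (appendEpisode ω τ) s N = trajBonus M F c ω s N := by
  funext τ'
  simp only [trajBonus, clippedBonus]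
  refine Finset.sum_congr rfl fun h _ => ?_
  rw [iterate_appendEpisode M F hlam ω τ (by omega : N + 1 ≤ n + 1),
    (lstdEst_congr M F (by omega : N ≤ n + 1) hN
      (fun i hi => appendEpisode_of_lt ω τ (hi.trans_le hN))
      (fun i hi => iterate_appendEpisode M F hlam ω τ (by omega)) s h).2]

theorem meanBonus_appendEpisode (M : CMDP S A H) (F : Features S A ι₁ ι₂) {c : Params}
    (hlam : c.lam = 1) (ω : Fin n → Trajectory S A H) (τ : Trajectory S A H) (s : Signal) {N : ℕ}
    (hN : N ≤ n) : meanBonus M F c (appendEpisode ω τ) s N = meanBonus M F c ω s N := by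
  rw [meanBonus, meanBonus, trajBonus_appendEpisode M F hlam ω τ s hN,
    iterate_appendEpisode M F hlam ω τ (by omega : N + 1 ≤ n + 1)]

/-- The deviation of the bonus of episode `i + 1` from its conditional expectation. -/
def bonusDeviation (M : CMDP S A H) (F : Features S A ι₁ ι₂) (c : Params)
    (ω : Fin n → Trajectory S A H) (s : Signal) : ℕ → ℝ :=
  extendZero fun i : Fin n => meanBonus M F c ω s i - trajBonus M F c ω s i (ω i)

/-- The exponential process of Azuma's inequality for the bonuses. -/
def bonusExp (M : CMDP S A H) (F : Features S A ι₁ ι₂) (c : Params)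
    (ω : Fin n → Trajectory S A H) (s : Signal) (t : ℝ) (N : ℕ) : ℝ :=
  Real.exp (t * ∑ i ∈ Finset.range N, bonusDeviation M F c ω s i - N * (t ^ 2 * (H : ℝ) ^ 4 / 8))

/-- The bonus functions of an episode are fixed before it is played, and their sum along a
trajectory lies in `[0, H²]` thanks to clipping. Hoeffding's lemma then bounds each conditional
exponential moment. -/
theorem sum_runWeight_mul_bonusExp_le [Nonempty A] (M : CMDP S A H) (F : Features S A ι₁ ι₂)
    {c : Params} (hlam : c.lam = 1) (hθ : c.θ ∈ Set.Icc (0 : ℝ) 1) (hβ : 0 ≤ c.β) (s : Signal)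
    (t : ℝ) {N : ℕ} (hN : N ≤ n) :
    ∑ ω : Fin n → Trajectory S A H, runWeight M F c ω * bonusExp M F c ω s t N ≤ 1 := by
  have hdev : ∀ {n : ℕ} (ω : Fin n → Trajectory S A H) τ i, i < n →
      bonusDeviation M F c (appendEpisode ω τ) s i = bonusDeviation M F c ω s i := by
    intro n ω τ i hi
    rw [bonusDeviation, bonusDeviation, extendZero_of_lt _ hi,
      extendZero_of_lt _ (hi.trans n.lt_succ_self), appendEpisode_of_lt ω τ hi]
    simp only [meanBonus_appendEpisode M F hlam ω τ s hi.le,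
      trajBonus_appendEpisode M F hlam ω τ s hi.le]
  have hsum : ∀ {n : ℕ} (ω : Fin n → Trajectory S A H) τ N, N ≤ n →
      ∑ i ∈ Finset.range N, bonusDeviation M F c (appendEpisode ω τ) s i =
        ∑ i ∈ Finset.range N, bonusDeviation M F c ω s i := fun ω τ N hN =>
    Finset.sum_congr rfl fun i hi => hdev ω τ i ((Finset.mem_range.1 hi).trans_le hN)
  refine sum_runWeight_mul_le_one M F hlam hθ (fun n ω N => bonusExp M F c ω s t N)
    (fun n ω => by simp [bonusExp]) (fun n ω τ N hN => ?_) (fun n ω => ?_) n N hN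
  · simp only [bonusExp, hsum ω τ N hN]
  · have hπ := isPolicy_iterate M F c hθ ω (n + 1)
    have hw : (fun τ => trajWeight M (iterate M F c ω (n + 1)).policy τ) ∈
        stdSimplex ℝ (Trajectory S A H) :=
      ⟨fun τ => trajWeight_nonneg M hπ τ, sum_trajWeight M hπ⟩
    have hoeff := sum_mul_exp_le hw (fun τ => trajBonus_mem M F hβ ω s n τ) (-t)
    have hfac : ∀ τ, bonusExp M F c (appendEpisode ω τ) s t (n + 1) =
        bonusExp M F c ω s t n * Real.exp (-(t ^ 2 * (H : ℝ) ^ 4 / 8)) *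
          Real.exp (-t * (trajBonus M F c ω s n τ - meanBonus M F c ω s n)) := by
      intro τ
      have hlast : bonusDeviation M F c (appendEpisode ω τ) s n =
          meanBonus M F c ω s n - trajBonus M F c ω s n τ := by
        rw [bonusDeviation, extendZero_of_lt _ n.lt_succ_self, appendEpisode_last]
        simp only [meanBonus_appendEpisode M F hlam ω τ s le_rfl,
          trajBonus_appendEpisode M F hlam ω τ s le_rfl]
      rw [bonusExp, bonusExp, Finset.sum_range_succ, hsum ω τ n le_rfl, hlast, ← Real.exp_add,
        ← Real.exp_add]
      congr 1
      push_cast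
      ring
    calc _ = bonusExp M F c ω s t n * Real.exp (-(t ^ 2 * (H : ℝ) ^ 4 / 8)) *
          ∑ τ, trajWeight M (iterate M F c ω (n + 1)).policy τ *
            Real.exp (-t * (trajBonus M F c ω s n τ - meanBonus M F c ω s n)) := by
          rw [Finset.mul_sum]
          refine Finset.sum_congr rfl fun τ _ => ?_
          rw [hfac]
          ring
      _ ≤ bonusExp M F c ω s t n * Real.exp (-(t ^ 2 * (H : ℝ) ^ 4 / 8)) *
          Real.exp ((-t) ^ 2 * (((H : ℝ) ^ 2 - 0) ^ 2 / 4) / 2) :=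
        mul_le_mul_of_nonneg_left hoeff (mul_nonneg (Real.exp_pos _).le (Real.exp_pos _).le)
      _ = bonusExp M F c ω s t n := by
        rw [mul_assoc, ← Real.exp_add]
        have : -(t ^ 2 * (H : ℝ) ^ 4 / 8) + (-t) ^ 2 * (((H : ℝ) ^ 2 - 0) ^ 2 / 4) / 2 = 0 := by ring
        rw [this, Real.exp_zero, mul_one]

end Run

/-! ### Optimism, primal and dual regret, and the use of the Slater condition. -/

section Analysis

set_option linter.unusedSectionVars false

variable {S A ι₁ ι₂ : Type*} [Fintype S] [DecidableEq S] [Fintype A]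
  [Fintype ι₁] [DecidableEq ι₁] [Fintype ι₂] [DecidableEq ι₂] {H n : ℕ}

/-- The one-step target `⋄_h + P_h V_{⋄,h+1}` of the estimates of episode `N + 1`. -/
def bellmanTarget (M : CMDP S A H) (F : Features S A ι₁ ι₂) (c : Params)
    (ω : Fin n → Trajectory S A H) (s : Signal) (N : ℕ) (h : Fin H) (x : S) (a : A) : ℝ :=
  M.signal s h x a + ∑ y, M.P h x a y * (iterate M F c ω (N + 1)).V s (h + 1) y

/-- The target lies in the clipping interval of the estimates, so clipping cannot destroy optimism.
Steps are counted from zero, whence the upper end `H - h`. -/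
theorem bellmanTarget_mem [Nonempty A] (M : CMDP S A H) (F : Features S A ι₁ ι₂) {c : Params}
    (hθ : c.θ ∈ Set.Icc (0 : ℝ) 1) (ω : Fin n → Trajectory S A H) (s : Signal) (N : ℕ) (h : Fin H)
    (x : S) (a : A) : bellmanTarget M F c ω s N h x a ∈ Set.Icc 0 ((H : ℝ) - h) := by
  have h1 := signal_mem M s h x a
  have h2 := sum_mul_mem_Icc (M.P_mem h x a)
    (iterate_V_mem M F hθ ω N s (show (h : ℕ) + 1 ≤ H from h.2))
  push_cast at h2
  exact ⟨add_nonneg h1.1 h2.1, (add_le_add h1.2 h2.2).trans (by linarith)⟩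

/-- Optimism: an estimate within the width gives an upper bound, up to the clipped bonus. -/
theorem iterate_Q_sub_bellmanTarget_mem [Nonempty A] (M : CMDP S A H) (F : Features S A ι₁ ι₂)
    {c : Params} (hlam : c.lam = 1) (hθ : c.θ ∈ Set.Icc (0 : ℝ) 1) (ω : Fin n → Trajectory S A H)
    {s : Signal} {N : ℕ} (hN : N ≤ n) {h : Fin H} {x : S} {a : A}
    (hest : |lstdEst M F ω (iterate M F c ω) N s h ((iterate M F c ω (N + 1)).V s (h + 1)) x a -
      bellmanTarget M F c ω s N h x a| ≤
        lstdWidth F c ω (iterate M F c ω) N s h ((iterate M F c ω (N + 1)).V s (h + 1)) x a) :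
    (iterate M F c ω (N + 1)).Q s h x a - bellmanTarget M F c ω s N h x a ∈
      Set.Icc 0 (clippedBonus M F c ω s N h x a) := by
  have hB := bellmanTarget_mem M F hθ ω s N h x a
  have hQ := iterate_Q M F hlam ω hN s h x a
  have hQm := iterate_Q_mem M F c ω N s h x a
  have hh : (0 : ℝ) ≤ (h : ℕ) := Nat.cast_nonneg _
  unfold clippedBonus
  set E := lstdEst M F ω (iterate M F c ω) N s h ((iterate M F c ω (N + 1)).V s (h + 1)) x a
  set W := lstdWidth F c ω (iterate M F c ω) N s h ((iterate M F c ω (N + 1)).V s (h + 1)) x a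
  set B := bellmanTarget M F c ω s N h x a
  obtain ⟨h1, h2⟩ := abs_le.1 hest
  constructor
  · rw [hQ, sub_nonneg]
    exact le_max_of_le_right (le_min (by linarith) hB.2)
  · refine le_min (by linarith [hQm.2, hB.1]) ?_
    rw [sub_le_iff_le_add, hQ]
    exact max_le (by linarith [hB.1]) ((min_le_left _ _).trans (by linarith))

theorem meanBonus_eq [Nonempty A] (M : CMDP S A H) (F : Features S A ι₁ ι₂) {c : Params}
    (hθ : c.θ ∈ Set.Icc (0 : ℝ) 1) (ω : Fin n → Trajectory S A H) (s : Signal) (N : ℕ) :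
    meanBonus M F c ω s N = ∑ h : Fin H, ∑ x, ∑ a,
      occ M (iterate M F c ω (N + 1)).policy h x * (iterate M F c ω (N + 1)).policy h x a *
        clippedBonus M F c ω s N h x a := by
  simp only [meanBonus, trajBonus, Finset.mul_sum]
  rw [Finset.sum_comm]
  exact Finset.sum_congr rfl fun h _ =>
    sum_trajWeight_mul' M (isPolicy_iterate M F c hθ ω _) h (clippedBonus M F c ω s N h)

/-- Performance difference for the executed policy itself: no policy mismatch term appears, and the
overestimation is the accumulated Bellman error. -/
theorem iterate_V_sub_value_le [Nonempty A] (M : CMDP S A H) (F : Features S A ι₁ ι₂) {c : Params}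
    (hθ : c.θ ∈ Set.Icc (0 : ℝ) 1) (ω : Fin n → Trajectory S A H) {s : Signal} {N : ℕ}
    (hQ : ∀ h x a, (iterate M F c ω (N + 1)).Q s h x a - bellmanTarget M F c ω s N h x a ≤
      clippedBonus M F c ω s N h x a) :
    (iterate M F c ω (N + 1)).V s 0 M.x₁ - value M s (iterate M F c ω (N + 1)).policy ≤
      meanBonus M F c ω s N := by
  have hπ := isPolicy_iterate M F c hθ ω (N + 1)
  have h := value_sub_eq M s hπ ((iterate M F c ω (N + 1)).V s) (iterate_V_last M F c ω N s)
  rw [meanBonus_eq M F hθ, ← neg_sub, h, ← Finset.sum_neg_distrib]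
  refine Finset.sum_le_sum fun h _ => ?_
  rw [← Finset.sum_neg_distrib]
  refine Finset.sum_le_sum fun x _ => ?_
  rw [iterate_V, ← mul_neg, neg_sub, ← Finset.sum_sub_distrib]
  simp only [mul_assoc]
  rw [← Finset.mul_sum]
  refine mul_le_mul_of_nonneg_left (Finset.sum_le_sum fun a _ => ?_) (occ_nonneg M hπ h.2.le x)
  have := mul_le_mul_of_nonneg_left (hQ h x a) ((hπ h x).1 a)
  simp only [bellmanTarget] at this
  linarith

/-- Performance difference for a comparator: optimism discards the Bellman errors and leaves only
the mismatch between the two policies. -/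
theorem value_sub_iterate_V_le [Nonempty A] (M : CMDP S A H) (F : Features S A ι₁ ι₂) {c : Params}
    (ω : Fin n → Trajectory S A H) {s : Signal} {N : ℕ}
    {π : Fin H → S → A → ℝ} (hπ : IsPolicy π)
    (hQ : ∀ h x a, 0 ≤ (iterate M F c ω (N + 1)).Q s h x a - bellmanTarget M F c ω s N h x a) :
    value M s π - (iterate M F c ω (N + 1)).V s 0 M.x₁ ≤ ∑ h : Fin H, ∑ x, occ M π h x *
      ∑ a, (iterate M F c ω (N + 1)).Q s h x a *
        (π h x a - (iterate M F c ω (N + 1)).policy h x a) := by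
  rw [value_sub_eq M s hπ _ (iterate_V_last M F c ω N s)]
  refine Finset.sum_le_sum fun h _ => Finset.sum_le_sum fun x _ =>
    mul_le_mul_of_nonneg_left ?_ (occ_nonneg M hπ h.2.le x)
  rw [iterate_V, ← Finset.sum_sub_distrib]
  refine Finset.sum_le_sum fun a _ => ?_
  have := mul_nonneg ((hπ h x).1 a) (hQ h x a)
  simp only [bellmanTarget] at this
  linarith

theorem iterate_Y_mem (M : CMDP S A H) (F : Features S A ι₁ ι₂) {c : Params} (hχ : 0 ≤ c.χ)
    (ω : Fin n → Trajectory S A H) (N : ℕ) : (iterate M F c ω (N + 1)).Y ∈ Set.Icc 0 c.χ := by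
  rw [iterate_Y]
  exact projDual_mem hχ _

/-- The primal regret of the policies against the estimated Lagrangians. -/
theorem primal_regret_le [Nonempty A] (M : CMDP S A H) (F : Features S A ι₁ ι₂) {c : Params}
    (hθ : 0 < c.θ) (hθ1 : c.θ ≤ 1) (hα : 0 ≤ c.α) (hχ : 0 ≤ c.χ)
    (ω : Fin n → Trajectory S A H) {π : Fin H → S → A → ℝ} (hπ : IsPolicy π) (K : ℕ)
    (hQ : ∀ s, ∀ N < K, ∀ h x a,
      0 ≤ (iterate M F c ω (N + 1)).Q s h x a - bellmanTarget M F c ω s N h x a) :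
    c.α * ∑ N ∈ Finset.range K,
      ((value M .reward π - (iterate M F c ω (N + 1)).V .reward 0 M.x₁) +
        (iterate M F c ω (N + 1)).Y *
          (value M .utility π - (iterate M F c ω (N + 1)).V .utility 0 M.x₁)) ≤
      H * (Real.log (Fintype.card A) + K * (c.θ * Real.log (Fintype.card A) +
        c.α ^ 2 * (H * (1 + c.χ)) ^ 2 / 8 + c.α * (c.θ * (H * (1 + c.χ))))) := by
  set q : ℕ → Fin H → S → A → ℝ := fun N => (iterate M F c ω (N + 1)).policy with hq
  set Q : ℕ → Fin H → S → A → ℝ := fun N h x a => (iterate M F c ω (N + 1)).Q .reward h x a +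
    (iterate M F c ω (N + 1)).Y * (iterate M F c ω (N + 1)).Q .utility h x a with hQdef
  set R := Real.log (Fintype.card A) + K * (c.θ * Real.log (Fintype.card A) +
        c.α ^ 2 * (H * (1 + c.χ)) ^ 2 / 8 + c.α * (c.θ * (H * (1 + c.χ)))) with hR
  have hY := iterate_Y_mem M F hχ ω
  have hmirror : ∀ h x, c.α * ∑ N ∈ Finset.range K, ∑ a, Q N h x a * (π h x a - q N h x a) ≤ R := by
    intro h x
    refine sum_mirror_le (hπ h x) (fun N => q N h x) (fun N => Q N h x) hθ hθ1 hα
      (fun N a => ?_) (fun a => ?_) (fun N a => ?_) K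
    · have hh : (0 : ℝ) ≤ (h : ℕ) := Nat.cast_nonneg _
      have h1 := iterate_Q_mem M F c ω N .reward h x a
      have h2 := iterate_Q_mem M F c ω N .utility h x a
      have h3 := hY N
      have h4 := mul_le_mul h3.2 (h2.2.trans (sub_le_self _ hh)) h2.1 hχ
      refine ⟨add_nonneg h1.1 (mul_nonneg h3.1 h2.1), ?_⟩
      simp only [hQdef]
      linarith [h1.2]
    -- Since `Q^0 = 0` and mixing preserves the uniform law, the policy of episode 1 is uniform, so
    -- mirror descent may be started there.
    · have hmix : ∀ a', mixPolicy c.θ (initIterate M : Iterate S A H).policy h x a' =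
          1 / (Fintype.card A : ℝ) := fun a' => by
        simp only [mixPolicy, initIterate]
        ring
      simp only [hq, iterate_policy, iterate_zero, improve, hmix]
      simp [initIterate]
    · simp only [hq]
      rw [iterate_policy]
      rfl
  have hstep : ∀ N ∈ Finset.range K,
      ((value M .reward π - (iterate M F c ω (N + 1)).V .reward 0 M.x₁) +
        (iterate M F c ω (N + 1)).Y *
          (value M .utility π - (iterate M F c ω (N + 1)).V .utility 0 M.x₁)) ≤
      ∑ h : Fin H, ∑ x, occ M π h x * ∑ a, Q N h x a * (π h x a - q N h x a) := by
    intro N hN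
    have hN' := Finset.mem_range.1 hN
    have h1 := value_sub_iterate_V_le M F ω hπ (hQ .reward N hN')
    have h2 := mul_le_mul_of_nonneg_left (value_sub_iterate_V_le M F ω hπ (hQ .utility N hN'))
      (hY N).1
    refine (add_le_add h1 h2).trans_eq ?_
    simp only [Finset.mul_sum, ← Finset.sum_add_distrib]
    refine Finset.sum_congr rfl fun h _ => Finset.sum_congr rfl fun x _ =>
      Finset.sum_congr rfl fun a _ => ?_
    simp only [hQdef, hq]
    ring
  -- The weights are the comparator's occupancies, which do not depend on the episode; hence the sum
  -- over episodes can be moved inside.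
  calc _ ≤ c.α * ∑ N ∈ Finset.range K,
        ∑ h : Fin H, ∑ x, occ M π h x * ∑ a, Q N h x a * (π h x a - q N h x a) :=
        mul_le_mul_of_nonneg_left (Finset.sum_le_sum hstep) hα
    _ = ∑ h : Fin H, ∑ x, occ M π h x *
        (c.α * ∑ N ∈ Finset.range K, ∑ a, Q N h x a * (π h x a - q N h x a)) := by
        rw [Finset.sum_comm, Finset.mul_sum]
        refine Finset.sum_congr rfl fun h _ => ?_
        rw [Finset.sum_comm, Finset.mul_sum]
        refine Finset.sum_congr rfl fun x _ => ?_
        rw [← Finset.mul_sum]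
        ring
    _ ≤ ∑ h : Fin H, ∑ x, occ M π h x * R :=
        Finset.sum_le_sum fun h _ => Finset.sum_le_sum fun x _ =>
          mul_le_mul_of_nonneg_left (hmirror h x) (occ_nonneg M hπ h.2.le x)
    _ = H * R := by
        simp only [← Finset.sum_mul]
        rw [Finset.sum_congr rfl fun h _ => sum_occ M hπ (Fin.is_le' (a := h))]
        simp

theorem dual_regret_le [Nonempty A] (M : CMDP S A H) (F : Features S A ι₁ ι₂) {c : Params}
    (hθ : c.θ ∈ Set.Icc (0 : ℝ) 1) (hη : 0 < c.η) (hχ : 0 ≤ c.χ)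
    (ω : Fin n → Trajectory S A H) {y : ℝ} (hy : y ∈ Set.Icc 0 c.χ) (K : ℕ) :
    ∑ N ∈ Finset.range K, (y - (iterate M F c ω (N + 1)).Y) *
        (M.b - (iterate M F c ω (N + 1)).V .utility 0 M.x₁) ≤
      y ^ 2 / (2 * c.η) + c.η * K * (H : ℝ) ^ 2 / 2 := by
  refine sum_dual_le hη hy (fun N => (iterate M F c ω (N + 1)).Y)
    (fun N => M.b - (iterate M F c ω (N + 1)).V .utility 0 M.x₁) ?_ (fun N => iterate_Y M F c ω _)
    (fun N => ?_) K
  -- The initial value `V_g^0 = b` makes the first dual step trivial, so `Y^1 = 0`.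
  · simp [iterate_Y, iterate_zero, initIterate, projDual, hχ]
  · have h1 := iterate_V_mem M F hθ ω N .utility (Nat.zero_le H) M.x₁
    have h2 := M.b_mem
    simp only [Nat.cast_zero, sub_zero] at h1
    exact abs_le.2 ⟨by linarith [h1.2, h2.1], by linarith [h1.1, h2.2]⟩

/-- If the average utility of some policies is below the threshold, their average reward exceeds the
optimal reward by at most the deficit times `H / γ`. -/
theorem neg_le_sum_value_sub [Nonempty A] (M : CMDP S A H) {γ : ℝ} (hγ : Slater M γ)
    {πstar : Fin H → S → A → ℝ} (hstar : IsOptimalPolicy M πstar) {K : ℕ} (hK : 1 ≤ K)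
    (π : Fin K → Fin H → S → A → ℝ) (hπ : ∀ k, IsPolicy (π k))
    (hneg : 0 ≤ ∑ k, (M.b - value M .utility (π k))) :
    -(H / γ * ∑ k, (M.b - value M .utility (π k))) ≤
      ∑ k, (value M .reward πstar - value M .reward (π k)) := by
  obtain ⟨hγ0, πs, hπs, hs⟩ := hγ
  have hK0 : (0 : ℝ) < K := by exact_mod_cast hK
  -- The executed policies are replaced by one policy that attains their average values.
  obtain ⟨πm, hπm, hm⟩ := exists_policy_value_eq M (w := fun _ : Fin K => 1 / (K : ℝ))
    ⟨fun _ => by positivity, by simp [hK0.ne']⟩ π hπ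
  have hsum : ∀ s, ∑ k, value M s (π k) = K * value M s πm := fun s => by
    rw [hm s, ← Finset.mul_sum]
    field_simp
  simp only [Finset.sum_sub_distrib, hsum, Finset.sum_const, Finset.card_univ, Fintype.card_fin,
    nsmul_eq_mul, ← mul_sub] at hneg ⊢
  set ξ := M.b - value M .utility πm with hξ
  have hξ0 : 0 ≤ ξ := nonneg_of_mul_nonneg_right hneg hK0
  have hden : 0 < ξ + γ := by linarith
  -- The mean policy misses the constraint by `ξ` and the Slater policy has slack `γ`, so these
  -- weights make the mixture just feasible. Optimality against it gives the reward bound.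
  have hw : (fun i : Bool => if i then ξ / (ξ + γ) else γ / (ξ + γ)) ∈ stdSimplex ℝ Bool := by
    refine ⟨fun i => ?_, ?_⟩
    · cases i <;> simp <;> positivity
    · simp only [Fintype.sum_bool, if_true, Bool.false_eq_true, if_false]
      rw [← add_div, div_self hden.ne']
  obtain ⟨πc, hπc, hc⟩ := exists_policy_value_eq M hw (fun i => if i then πs else πm)
    (fun i => by cases i <;> simpa)
  simp only [Fintype.sum_bool, if_true, Bool.false_eq_true, if_false] at hc
  have hfeas : M.b ≤ value M .utility πc := by
    rw [hc, div_mul_eq_mul_div, div_mul_eq_mul_div, ← add_div, le_div_iff₀ hden]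
    nlinarith
  have hopt := hstar.2.2 πc hπc hfeas
  have hr1 := (value_mem M .reward hπs).1
  have hr2 := value_mem M .reward hπm
  rw [hc, div_mul_eq_mul_div, div_mul_eq_mul_div, ← add_div, div_le_iff₀ hden] at hopt
  have h1 : -(H / γ * ξ) ≤ value M .reward πstar - value M .reward πm := by
    have h2 : γ * (value M .reward πm - value M .reward πstar) ≤ H * ξ := by
      have h3 := (value_mem M .reward hstar.1).2
      have h4 := mul_nonneg hξ0 hr1
      have h5 := mul_le_mul_of_nonneg_left h3 hξ0
      linarith
    have h3 : value M .reward πm - value M .reward πstar ≤ H * ξ / γ := by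
      rw [le_div_iff₀ hγ0]
      linarith
    have h4 : H * ξ / γ = H / γ * ξ := by ring
    linarith
  have h2 := mul_le_mul_of_nonneg_left h1 hK0.le
  linarith

end Analysis

/-! ### Tabular features, the bonus sum, and the combination of the regret bounds. -/

section Tabular

set_option linter.unusedSectionVars false

variable {S A : Type*} [Fintype S] [DecidableEq S] [Fintype A] [DecidableEq A] {H n : ℕ}

theorem phiOf_tabular_apply (V : S → ℝ) (x : S) (a : A) (y : S) :
    phiOf (tabularFeatures S A) V x a (x, a, y) = V y := by
  simp [phiOf, tabularFeatures, Pi.single_apply]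

theorem phiOf_tabular_dotProduct (V : S → ℝ) (x : S) (a : A) (v : S × A × S → ℝ) :
    phiOf (tabularFeatures S A) V x a ⬝ᵥ v = ∑ y, V y * v (x, a, y) := by
  simp [phiOf, tabularFeatures, sum_dotProduct]

theorem phiOf_tabular_dotProduct_self_le {V : S → ℝ} {B : ℝ} (hV : ∀ y, V y ∈ Set.Icc 0 B) (x : S)
    (a : A) : phiOf (tabularFeatures S A) V x a ⬝ᵥ phiOf (tabularFeatures S A) V x a ≤
      Fintype.card S * B ^ 2 := by
  rw [phiOf_tabular_dotProduct]
  simp only [phiOf_tabular_apply]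
  refine (Finset.sum_le_sum (g := fun _ => B ^ 2) fun y _ => ?_).trans (by simp)
  nlinarith [(hV y).1, (hV y).2]

theorem phi_tabular_dotProduct (x : S) (a : A) (v : S × A → ℝ) :
    (tabularFeatures S A).φ x a ⬝ᵥ v = v (x, a) := by
  simp [tabularFeatures]

/-- The least-squares estimates are within the width of their targets when the self-normalized
noise is controlled. -/
theorem abs_lstdEst_sub_le (M : CMDP S A H) (c : Params) (ω : Fin n → Trajectory S A H)
    (s : Signal) (N : ℕ) (h : Fin H) (x : S) (a : A)
    (hβ : invNorm (gram (phiSeq (tabularFeatures S A) ω (iterate M (tabularFeatures S A) c ω) s h) N)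
        (∑ i ∈ Finset.range N, noiseSeq M ω (iterate M (tabularFeatures S A) c ω) s h i •
          phiSeq (tabularFeatures S A) ω (iterate M (tabularFeatures S A) c ω) s h i) +
      √((Fintype.card S : ℝ) * Fintype.card A) ≤ c.β) :
    |lstdEst M (tabularFeatures S A) ω (iterate M (tabularFeatures S A) c ω) N s h
        ((iterate M (tabularFeatures S A) c ω (N + 1)).V s (h + 1)) x a -
      bellmanTarget M (tabularFeatures S A) c ω s N h x a| ≤
    lstdWidth (tabularFeatures S A) c ω (iterate M (tabularFeatures S A) c ω) N s h
        ((iterate M (tabularFeatures S A) c ω (N + 1)).V s (h + 1)) x a := by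
  set F := tabularFeatures S A with hF
  set prev := iterate M F c ω with hprev
  set V := (prev (N + 1)).V s (h + 1) with hV
  let r : S × A → ℝ := fun z => M.signal s h z.1 z.2
  let P : S × A × S → ℝ := fun z => M.P h z.1 z.2.1 z.2.2
  -- The signals are deterministic, so this regression has only regularization bias.
  have hsig : ∀ i, signalSeq M ω s h i = valSeq F ω h i ⬝ᵥ r + (fun _ => (0 : ℝ)) i := by
    intro i
    simp only [signalSeq, valSeq, extendZero]
    split_ifs
    · rw [hF, phi_tabular_dotProduct, add_zero]
    · simp
  have htar : ∀ i, targetSeq ω prev s h i = phiSeq F ω prev s h i ⬝ᵥ P + noiseSeq M ω prev s h i := by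
    intro i
    simp only [targetSeq, phiSeq, noiseSeq, extendZero]
    split_ifs
    · rw [hF, phiOf_tabular_dotProduct]
      simp only [P, mul_comm (M.P _ _ _ _)]
      ring
    · simp
  have hr : r ⬝ᵥ r ≤ (Fintype.card S : ℝ) * Fintype.card A := by
    refine (Finset.sum_le_sum (g := fun _ => (1 : ℝ)) fun z _ => ?_).trans (by simp)
    have := signal_mem M s h z.1 z.2
    exact mul_le_one₀ this.2 this.1 this.2
  -- Each transition row is a probability vector, so its squared norm is at most one; there are
  -- `|S||A|` rows.
  have hP : P ⬝ᵥ P ≤ (Fintype.card S : ℝ) * Fintype.card A := by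
    have h1 : P ⬝ᵥ P = ∑ y, ∑ b, ∑ y', M.P h y b y' * M.P h y b y' := by
      simp only [dotProduct, Fintype.sum_prod_type, P]
    rw [h1]
    refine (Finset.sum_le_sum (g := fun _ => (Fintype.card A : ℝ)) fun y _ => ?_).trans (by simp)
    refine (Finset.sum_le_sum (g := fun _ => (1 : ℝ)) fun b _ => ?_).trans (by simp)
    have hm := M.P_mem h y b
    exact (sum_mul_mem_Icc hm fun y' => ⟨hm.1 y',
      (Finset.single_le_sum (fun z _ => hm.1 z) (Finset.mem_univ y')).trans_eq hm.2⟩).2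
  have e1 := abs_ridge_sub_le (valSeq F ω h) (fun _ => 0) N r (F.φ x a)
  have e2 := abs_ridge_sub_le (phiSeq F ω prev s h) (noiseSeq M ω prev s h) N P (phiOf F V x a)
  simp only [← hsig] at e1
  simp only [← htar] at e2
  have z0 : invNorm (gram (valSeq F ω h) N) (∑ i ∈ Finset.range N, (0 : ℝ) • valSeq F ω h i) = 0 := by
    simp [invNorm]
  rw [z0, zero_add] at e1
  have h0 : √(r ⬝ᵥ r) ≤ c.β := (Real.sqrt_le_sqrt hr).trans
    ((le_add_of_nonneg_left (invNorm_nonneg _ _)).trans hβ)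
  have e1' := e1.trans (mul_le_mul_of_nonneg_left h0 (invNorm_nonneg _ _))
  have e2' := e2.trans (mul_le_mul_of_nonneg_left
    ((add_le_add le_rfl (Real.sqrt_le_sqrt hP)).trans hβ) (invNorm_nonneg _ _))
  have hb : bellmanTarget M F c ω s N h x a = F.φ x a ⬝ᵥ r + phiOf F V x a ⬝ᵥ P := by
    rw [hF, phi_tabular_dotProduct, phiOf_tabular_dotProduct]
    simp only [bellmanTarget, r, P, mul_comm (M.P _ _ _ _)]
    rfl
  have hsplit : ∀ u v u' v' : ℝ, |u + v - (u' + v')| ≤ |u - u'| + |v - v'| := fun u v u' v' => by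
    rw [add_sub_add_comm]
    exact abs_add_le _ _
  rw [hb, lstdEst]
  refine (hsplit _ _ _ _).trans ?_
  rw [lstdWidth, mul_comm c.β, mul_comm c.β]
  exact add_le_add e1' e2'

theorem phiSeq_dotProduct_self_le [Nonempty A] (M : CMDP S A H) {c : Params}
    (hθ : c.θ ∈ Set.Icc (0 : ℝ) 1) (ω : Fin n → Trajectory S A H) (s : Signal) (h : Fin H) (i : ℕ) :
    phiSeq (tabularFeatures S A) ω (iterate M (tabularFeatures S A) c ω) s h i ⬝ᵥ
      phiSeq (tabularFeatures S A) ω (iterate M (tabularFeatures S A) c ω) s h i ≤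
      Fintype.card S * (H : ℝ) ^ 2 := by
  simp only [phiSeq, extendZero]
  split_ifs
  · refine phiOf_tabular_dotProduct_self_le (fun y => ?_) _ _
    have h1 := iterate_V_mem M (tabularFeatures S A) hθ ω i s (show (h : ℕ) + 1 ≤ H from h.2) y
    exact ⟨h1.1, h1.2.trans (sub_le_self _ (Nat.cast_nonneg _))⟩
  · simp only [zero_dotProduct]
    positivity

theorem valSeq_dotProduct_self_le (ω : Fin n → Trajectory S A H) (h : Fin H) (i : ℕ) :
    valSeq (tabularFeatures S A) ω h i ⬝ᵥ valSeq (tabularFeatures S A) ω h i ≤ 1 := by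
  simp only [valSeq, extendZero]
  split_ifs
  · rw [phi_tabular_dotProduct]
    simp [tabularFeatures]
  · simp

/-- Because `H ≤ 2β`, clipping the bonus at `H` allows each norm to be clipped at one, which is the
form required by the elliptical potential lemma. -/
theorem sum_trajBonus_le {ι₁ ι₂ : Type*} [Fintype ι₁] [DecidableEq ι₁] [Fintype ι₂] [DecidableEq ι₂]
    (M : CMDP S A H) (F : Features S A ι₁ ι₂) {c : Params} (ω : Fin n → Trajectory S A H)
    (s : Signal) (hβ : (H : ℝ) ≤ 2 * c.β) {l : ℝ}
    (h1 : ∀ h, Real.log (gram (valSeq F ω h) n).det ≤ l)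
    (h2 : ∀ h, Real.log (gram (phiSeq F ω (iterate M F c ω) s h) n).det ≤ l) :
    ∑ i : Fin n, trajBonus M F c ω s i (ω i) ≤ H * (2 * c.β * (2 * √(n * (2 * l)))) := by
  have hβ0 : 0 ≤ 2 * c.β := (Nat.cast_nonneg _).trans hβ
  simp only [trajBonus]
  rw [Finset.sum_comm]
  refine (Finset.sum_le_sum (g := fun _ => 2 * c.β * (2 * √(n * (2 * l)))) fun h _ => ?_).trans
    (by simp)
  have hterm : ∀ i : Fin n, clippedBonus M F c ω s i h ((ω i).state h.castSucc) ((ω i).action h) ≤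
      2 * c.β * (min 1 (invNorm (gram (valSeq F ω h) i) (valSeq F ω h i)) +
        min 1 (invNorm (gram (phiSeq F ω (iterate M F c ω) s h) i)
          (phiSeq F ω (iterate M F c ω) s h i))) := by
    intro i
    have e1 : phiSeq F ω (iterate M F c ω) s h i = phiOf F
        ((iterate M F c ω (i + 1)).V s (h + 1)) ((ω i).state h.castSucc) ((ω i).action h) :=
      extendZero_of_lt _ i.2
    have e2 : valSeq F ω h i = F.φ ((ω i).state h.castSucc) ((ω i).action h) :=
      extendZero_of_lt _ i.2
    rw [clippedBonus, lstdWidth, ← e1, ← e2]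
    set u := invNorm (gram (valSeq F ω h) i) (valSeq F ω h i)
    set v := invNorm (gram (phiSeq F ω (iterate M F c ω) s h) i) (phiSeq F ω (iterate M F c ω) s h i)
    have hu : 0 ≤ u := invNorm_nonneg _ _
    have hv : 0 ≤ v := invNorm_nonneg _ _
    rcases le_total 1 u with hu1 | hu1
    · rw [min_eq_left hu1]
      have := le_min zero_le_one hv
      exact (min_le_left _ _).trans (by nlinarith)
    · rcases le_total 1 v with hv1 | hv1
      · rw [min_eq_left hv1, min_eq_right hu1]
        exact (min_le_left _ _).trans (by nlinarith)
      · rw [min_eq_right hv1, min_eq_right hu1]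
        exact (min_le_right _ _).trans (by linarith)
  refine (Finset.sum_le_sum fun i _ => hterm i).trans ?_
  rw [Fin.sum_univ_eq_sum_range (fun i => 2 * c.β *
    (min 1 (invNorm (gram (valSeq F ω h) i) (valSeq F ω h i)) +
        min 1 (invNorm (gram (phiSeq F ω (iterate M F c ω) s h) i)
          (phiSeq F ω (iterate M F c ω) s h i)))) n, ← Finset.mul_sum, Finset.sum_add_distrib]
  refine mul_le_mul_of_nonneg_left ?_ hβ0
  have hs : ∀ {y : ℝ}, y ≤ l → √(n * (2 * y)) ≤ √(n * (2 * l)) := fun hy =>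
    Real.sqrt_le_sqrt (mul_le_mul_of_nonneg_left (by linarith) (Nat.cast_nonneg _))
  have g1 := (sum_min_one_invNorm_le (valSeq F ω h) n).trans (hs (h1 h))
  have g2 := (sum_min_one_invNorm_le (phiSeq F ω (iterate M F c ω) s h) n).trans (hs (h2 h))
  linarith

/-- On runs where the estimates are optimistic, the bonuses control the regret and the violation. -/
theorem regret_violation_le {ι₁ ι₂ : Type*} [Fintype ι₁] [DecidableEq ι₁] [Fintype ι₂]
    [DecidableEq ι₂] [Nonempty A] {K : ℕ} (hK : 1 ≤ K) (M : CMDP S A H) (F : Features S A ι₁ ι₂)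
    {c : Params} (hlam : c.lam = 1) (hθ : c.θ ∈ Set.Icc (0 : ℝ) 1) (hη : 0 < c.η) {γ : ℝ}
    (hγ : Slater M γ) (hχ : c.χ = 2 * H / γ)
    {πstar : Fin H → S → A → ℝ} (hstar : IsOptimalPolicy M πstar) (ω : Fin K → Trajectory S A H)
    (hQ : ∀ s, ∀ N < K, ∀ h x a,
      (iterate M F c ω (N + 1)).Q s h x a - bellmanTarget M F c ω s N h x a ∈
        Set.Icc 0 (clippedBonus M F c ω s N h x a))
    {P W : ℝ} (hP : ∑ N ∈ Finset.range K,
      ((value M .reward πstar - (iterate M F c ω (N + 1)).V .reward 0 M.x₁) +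
        (iterate M F c ω (N + 1)).Y *
          (value M .utility πstar - (iterate M F c ω (N + 1)).V .utility 0 M.x₁)) ≤ P)
    (hW : ∀ s, ∑ N ∈ Finset.range K, meanBonus M F c ω s N ≤ W) :
    regret M F c πstar ω ≤ P + c.η * K * (H : ℝ) ^ 2 / 2 + W ∧
    H / γ * violation M F c ω ≤ max 0 (P + ((2 * H / γ) ^ 2 / (2 * c.η) +
      c.η * K * (H : ℝ) ^ 2 / 2) + (1 + 2 * H / γ) * W) := by
  have hγ0 := hγ.1
  have hχ0 : 0 ≤ c.χ := by rw [hχ]; positivity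
  set Vr : ℕ → ℝ := fun N => (iterate M F c ω (N + 1)).V .reward 0 M.x₁ with hVr
  set Vg : ℕ → ℝ := fun N => (iterate M F c ω (N + 1)).V .utility 0 M.x₁ with hVg
  set Y : ℕ → ℝ := fun N => (iterate M F c ω (N + 1)).Y with hY
  set vr : ℕ → ℝ := fun N => value M .reward (iterate M F c ω (N + 1)).policy with hvr
  set vg : ℕ → ℝ := fun N => value M .utility (iterate M F c ω (N + 1)).policy with hvg
  have hreg : regret M F c πstar ω = ∑ N ∈ Finset.range K, (value M .reward πstar - vr N) := by
    rw [← Fin.sum_univ_eq_sum_range, regret]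
    exact Finset.sum_congr rfl fun k _ => by rw [episodePolicy_eq M F hlam]
  have hvio : ∑ k : Fin K, (M.b - value M .utility (episodePolicy M F c ω k)) =
      ∑ N ∈ Finset.range K, (M.b - vg N) := by
    rw [← Fin.sum_univ_eq_sum_range (fun N => M.b - vg N)]
    exact Finset.sum_congr rfl fun k _ => by rw [episodePolicy_eq M F hlam]
  have hW' : ∀ s, ∑ N ∈ Finset.range K, ((iterate M F c ω (N + 1)).V s 0 M.x₁ -
      value M s (iterate M F c ω (N + 1)).policy) ≤ W := fun s =>
    (Finset.sum_le_sum fun N hN => iterate_V_sub_value_le M F hθ ω fun h x a =>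
      (hQ s N (Finset.mem_range.1 hN) h x a).2).trans (hW s)
  have hWr := hW' .reward
  have hWg := hW' .utility
  have hlag : ∀ y ∈ Set.Icc 0 c.χ, ∑ N ∈ Finset.range K, (value M .reward πstar - Vr N) +
      y * ∑ N ∈ Finset.range K, (M.b - Vg N) ≤
        P + (y ^ 2 / (2 * c.η) + c.η * K * (H : ℝ) ^ 2 / 2) := by
    intro y hy
    refine le_trans ?_ (add_le_add hP (dual_regret_le M F hθ hη hχ0 ω hy K))
    rw [Finset.mul_sum, ← Finset.sum_add_distrib, ← Finset.sum_add_distrib]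
    refine Finset.sum_le_sum fun N _ => ?_
    -- Feasibility of the optimal policy and `Y ≥ 0` let `b` stand in for its utility, so the
    -- multiplier terms cancel between primal and dual.
    have := mul_le_mul_of_nonneg_left hstar.2.1 (iterate_Y_mem M F hχ0 ω N).1
    simp only [hVr, hVg]
    linarith
  have hsplit : ∑ N ∈ Finset.range K, (value M .reward πstar - vr N) =
      ∑ N ∈ Finset.range K, (value M .reward πstar - Vr N) +
        ∑ N ∈ Finset.range K, (Vr N - vr N) := by
    rw [← Finset.sum_add_distrib]
    exact Finset.sum_congr rfl fun N _ => by ring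
  have hsplit' : ∑ N ∈ Finset.range K, (M.b - vg N) =
      ∑ N ∈ Finset.range K, (M.b - Vg N) + ∑ N ∈ Finset.range K, (Vg N - vg N) := by
    rw [← Finset.sum_add_distrib]
    exact Finset.sum_congr rfl fun N _ => by ring
  constructor
  · have h0 := hlag 0 ⟨le_rfl, hχ0⟩
    rw [hreg, hsplit]
    have : (0 : ℝ) ^ 2 / (2 * c.η) = 0 := by simp
    linarith
  · rw [violation, mul_max_of_nonneg _ _ (by positivity), mul_zero]
    rcases le_total (∑ k : Fin K, (M.b - value M .utility (episodePolicy M F c ω k))) 0 with hle | hge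
    · exact max_le (le_max_left _ _)
        ((mul_nonpos_of_nonneg_of_nonpos (by positivity) hle).trans (le_max_left _ _))
    · refine max_le_max le_rfl ?_
      have hneg := neg_le_sum_value_sub M hγ hstar hK (fun k => episodePolicy M F c ω k)
        (fun k => isPolicy_iterate M F c hθ _ _) hge
      change _ ≤ regret M F c πstar ω at hneg
      rw [hvio] at hneg ⊢
      rw [hreg, hsplit] at hneg
      -- The range of the multiplier is twice the slope `H/γ` in `hneg`: half of it absorbs a
      -- possibly negative regret, the other half bounds the violation.
      have hl := hlag c.χ ⟨hχ0, le_rfl⟩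
      rw [hχ] at hl
      have h3 := mul_le_mul_of_nonneg_left hWg (show 0 ≤ 2 * H / γ by positivity)
      have h4 : 2 * H / γ * ∑ N ∈ Finset.range K, (M.b - vg N) =
        2 * (H / γ * ∑ N ∈ Finset.range K, (M.b - vg N)) := by ring
      have h5 := congrArg (fun z => 2 * H / γ * z) hsplit'
      simp only [mul_add] at h5
      linarith

end Tabular

/-! ### Numerical constants. -/

section Constants

/-- Bounds on the logarithms that appear in the analysis by `log X` for `X = sahk/p`. -/
theorem log_bounds {s a h k p : ℝ} (hs : 1 ≤ s) (ha : 2 ≤ a) (hh : 1 ≤ h) (hk : 1 ≤ k)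
    (hp0 : 0 < p) (hp1 : p < 1) :
    Real.log a ≤ Real.log (s * a * (h * k) / p) ∧
    1 / 2 < Real.log (s * a * (h * k) / p) ∧
    Real.log (s ^ 2 * a + k * (s * h ^ 2)) ≤ 3 * Real.log (s * a * (h * k) / p) ∧
    Real.log (s * a + k * 1) ≤ 3 * Real.log (s * a * (h * k) / p) ∧
    Real.log (4 * (h * k) / p) ≤ 2 * Real.log (s * a * (h * k) / p) ∧
    Real.log (4 / p) ≤ 2 * Real.log (s * a * (h * k) / p) := by
  set X := s * a * (h * k) / p with hX
  have hsa : 2 ≤ s * a := by nlinarith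
  have hhk : 1 ≤ h * k := by nlinarith
  have hXm : s * a * (h * k) ≤ X := by
    rw [hX, le_div_iff₀ hp0]
    nlinarith [mul_pos (mul_pos (by linarith : 0 < s) (by linarith : 0 < a))
      (by linarith : 0 < h * k)]
  have hsaX : s * a ≤ X := le_trans (by nlinarith) hXm
  have haX : a ≤ X := le_trans (by nlinarith) hsaX
  have hX2 : 2 ≤ X := hsa.trans hsaX
  have hX0 : 0 < X := by linarith
  have hhkX : 2 * (h * k) ≤ X := le_trans (by nlinarith) hXm
  have hkX : k ≤ X := by nlinarith
  have hX3 : 2 * X ^ 2 ≤ X ^ 3 := by nlinarith [sq_nonneg X]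
  have h1 : s ^ 2 * a ≤ X ^ 2 := by
    have : s ^ 2 * a ≤ (s * a) ^ 2 := by
      rw [mul_pow]
      exact mul_le_mul_of_nonneg_left (by nlinarith) (sq_nonneg s)
    exact this.trans (pow_le_pow_left₀ (by positivity) hsaX 2)
  have h2 : k * (s * h ^ 2) ≤ X ^ 2 := by
    have h3 : k * (s * h ^ 2) ≤ (s * a * (h * k)) ^ 2 := by
      have e1 : s ≤ (s * a) ^ 2 := by nlinarith
      have e2 : k * h ^ 2 ≤ (h * k) ^ 2 := by
        rw [mul_pow, mul_comm]
        exact mul_le_mul_of_nonneg_left (by nlinarith) (sq_nonneg h)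
      calc k * (s * h ^ 2) = s * (k * h ^ 2) := by ring
        _ ≤ (s * a) ^ 2 * (h * k) ^ 2 := mul_le_mul e1 e2 (by positivity) (by positivity)
        _ = _ := by ring
    exact h3.trans (pow_le_pow_left₀ (by positivity) hXm 2)
  have hlog : ∀ {y : ℝ} (m : ℕ), 0 < y → y ≤ X ^ m → Real.log y ≤ m * Real.log X := by
    intro y m hy hym
    rw [← Real.log_pow]
    exact Real.log_le_log hy hym
  refine ⟨Real.log_le_log (by linarith) haX, ?_, ?_, ?_, ?_, ?_⟩
  · have := Real.log_le_log two_pos hX2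
    linarith [Real.log_two_gt_d9]
  · exact_mod_cast hlog 3 (by positivity) (by linarith)
  · have h3 : s * a + k * 1 ≤ X ^ 3 := by nlinarith
    exact_mod_cast hlog 3 (by positivity) h3
  · have h3 : 4 * (h * k) / p ≤ 2 * X := by
      rw [hX, mul_div_assoc', div_le_div_iff_of_pos_right hp0]
      nlinarith
    have h4 : 4 * (h * k) / p ≤ X ^ 2 := by nlinarith
    exact_mod_cast hlog 2 (by positivity) h4
  · have h3 : 4 / p ≤ 2 * X := by
      rw [hX, mul_div_assoc', div_le_div_iff_of_pos_right hp0]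
      nlinarith
    have h4 : 4 / p ≤ X ^ 2 := by nlinarith
    exact_mod_cast hlog 2 (by positivity) h4

theorem le_mul_of_sq_le {w d L : ℝ} (hd : 2 ≤ d) (hL : 1 / 2 < L) (hw : w ^ 2 ≤ L) :
    w ≤ d * L := by
  have h1 : 2 * L ≤ d * L := mul_le_mul_of_nonneg_right hd (by linarith)
  have h2 : 0 ≤ (w - 1) ^ 2 := sq_nonneg _
  linarith

/-- The origin of `C₁ = 3`: the noise part and the bias part each cost at most `3/2` times the root.
Here `z` bounds the variance proxy times (twice the log of the inverse failure probability plus the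
log-determinant). -/
theorem confidence_width_le {d h L u z ρ : ℝ} (hd : 2 ≤ d) (hh : 1 ≤ h) (hL : 1 / 2 < L)
    (hu : u ≤ d) (hz : z ≤ h ^ 2 / 4 * (2 * (2 * L) + d * (3 * L))) (hρ : ρ ≤ √z) :
    ρ + √u ≤ 3 * √(d * h ^ 2 * L) := by
  have hh2 : 1 ≤ h ^ 2 := one_le_pow₀ hh
  have hdL : 0 < d * L := mul_pos (by linarith) (by linarith)
  have h9 : √(9 / 4 * (d * h ^ 2 * L)) = 3 / 2 * √(d * h ^ 2 * L) := by
    rw [Real.sqrt_mul (by norm_num)]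
    congr 1
    rw [show (9 / 4 : ℝ) = (3 / 2) ^ 2 by norm_num, Real.sqrt_sq (by norm_num)]
  have h1 : √z ≤ 3 / 2 * √(d * h ^ 2 * L) := by
    rw [← h9]
    refine Real.sqrt_le_sqrt (hz.trans ?_)
    have : 2 * (2 * L) + d * (3 * L) ≤ 9 * (d * L) := by nlinarith
    nlinarith
  have h2 : √u ≤ 3 / 2 * √(d * h ^ 2 * L) := by
    rw [← h9]
    refine Real.sqrt_le_sqrt (hu.trans ?_)
    nlinarith [mul_le_mul_of_nonneg_left hh2 hdL.le]
  linarith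

/-- Here `r = √K`. The potential term contributes `12√6 ≤ 30`, and the martingale deviation fits in
the remaining 3. -/
theorem bonus_sum_le {d h L r : ℝ} (hd : 2 ≤ d) (hh : 1 ≤ h) (hL : 1 / 2 < L) (hr : 1 ≤ r) :
    h * (2 * (3 * √(d * h ^ 2 * L)) * (2 * √(r ^ 2 * (2 * (d * (3 * L)))))) +
      h ^ 2 * r * (2 * L + 1 / 8) ≤ 33 * (h ^ 2 * r * (d * L)) := by
  have hdL : 0 < d * L := mul_pos (by linarith) (by linarith)
  have e1 : √(d * h ^ 2 * L) = h * √(d * L) := by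
    rw [show d * h ^ 2 * L = h ^ 2 * (d * L) by ring, Real.sqrt_mul (sq_nonneg h),
      Real.sqrt_sq (by linarith)]
  have e2 : √(r ^ 2 * (2 * (d * (3 * L)))) = r * (√6 * √(d * L)) := by
    rw [Real.sqrt_mul (sq_nonneg r), Real.sqrt_sq (by linarith), ← Real.sqrt_mul (by norm_num)]
    congr 2
    ring
  have e3 : √6 ≤ 5 / 2 := by
    rw [Real.sqrt_le_left (by norm_num)]
    norm_num
  have e4 := Real.mul_self_sqrt hdL.le
  have hhr : 0 < h ^ 2 * r := by positivity
  rw [e1, e2]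
  calc _ = 12 * √6 * (h ^ 2 * r) * (√(d * L) * √(d * L)) + h ^ 2 * r * (2 * L + 1 / 8) := by ring
    _ = h ^ 2 * r * (12 * √6 * (d * L) + (2 * L + 1 / 8)) := by rw [e4]; ring
    _ ≤ h ^ 2 * r * (33 * (d * L)) := by
      refine mul_le_mul_of_nonneg_left ?_ hhr.le
      nlinarith
    _ = _ := by ring

theorem dual_range_le {h γ : ℝ} (hh : 1 ≤ h) (hγ : 0 < γ) :
    1 + 2 * h / γ ≤ 2 * h * (1 + 1 / γ ^ 2) ∧ (1 + 2 * h / γ) ^ 2 ≤ 8 * h ^ 2 * (1 + 1 / γ ^ 2) := by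
  set y := 1 / γ with hy
  have hy0 : 0 < y := by positivity
  have e1 : 2 * h / γ = 2 * h * y := by rw [hy]; ring
  have e2 : 1 / γ ^ 2 = y ^ 2 := by rw [hy]; ring
  rw [e1, e2]
  constructor
  · nlinarith [mul_nonneg (by linarith : 0 ≤ h) (sq_nonneg (y - 1))]
  · nlinarith [sq_nonneg (1 - 2 * h * y)]

/-- Division by `α`, with `w = √(log |A|)` and `kθ = 1`. The initial divergence and the mixing cost
together give 2, the quadratic term 1, and the mixing bias 2. -/
theorem primal_const_le {h r k γ w D P α θ : ℝ} (hh : 1 ≤ h) (hr : 1 ≤ r) (hk : r ^ 2 = k)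
    (hγ : 0 < γ) (hw : 0 < w) (hwD : w ≤ D) (hD : 1 ≤ D) (hα : α = w / (h ^ 2 * r))
    (hθ : θ = 1 / k)
    (hP : α * P ≤ h * (w ^ 2 + k * (θ * w ^ 2 + α ^ 2 * (h * (1 + 2 * h / γ)) ^ 2 / 8 +
      α * (θ * (h * (1 + 2 * h / γ)))))) :
    P ≤ 5 * (h ^ 3 * r * D * (1 + 1 / γ ^ 2)) := by
  obtain ⟨g1, g2⟩ := dual_range_le hh hγ
  set G := 1 + 1 / γ ^ 2 with hG
  have hG1 : 1 ≤ G := by rw [hG]; linarith [show 0 < 1 / γ ^ 2 by positivity]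
  set q := 1 + 2 * h / γ with hq
  have hr0 : 0 < r := by linarith
  have hh0 : 0 < h := by linarith
  have hα0 : 0 < α := by rw [hα]; positivity
  have h1 : P ≤ h * (2 * w * h ^ 2 * r + w * r * q ^ 2 / 8 + h * q) := by
    refine le_of_mul_le_mul_left (hP.trans_eq ?_) hα0
    rw [hα, hθ, ← hk]
    field_simp
    ring
  have t1 : w * h ^ 2 * r ≤ h ^ 2 * r * D * G := by
    have : w ≤ D * G := hwD.trans (by nlinarith)
    nlinarith [mul_le_mul_of_nonneg_left this (show 0 ≤ h ^ 2 * r by positivity)]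
  have t2 : w * r * q ^ 2 ≤ 8 * (h ^ 2 * r * D * G) := by
    have := mul_le_mul (mul_le_mul_of_nonneg_right hwD hr0.le) g2 (sq_nonneg q)
      (by positivity : 0 ≤ D * r)
    linarith
  have t3 : h * q ≤ 2 * (h ^ 2 * r * D * G) := by
    have e1 := mul_le_mul_of_nonneg_left g1 hh0.le
    have e2 : 1 ≤ r * D := by nlinarith
    have e3 := mul_le_mul_of_nonneg_left e2 (show 0 ≤ 2 * (h ^ 2 * G) by positivity)
    linarith
  refine h1.trans ?_
  have := mul_le_mul_of_nonneg_left (add_le_add (add_le_add (mul_le_mul_of_nonneg_left t1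
    (zero_le_two (α := ℝ))) (div_le_div_of_nonneg_right t2 (by norm_num : (0 : ℝ) ≤ 8))) t3) hh0.le
  refine le_trans (le_of_eq ?_) (this.trans_eq ?_) <;> ring

theorem regret_const_le {h r γ D P W : ℝ} (hh : 1 ≤ h) (hr : 1 ≤ r) (hγ : 0 < γ) (hD : 1 ≤ D)
    (hP : P ≤ 5 * (h ^ 3 * r * D * (1 + 1 / γ ^ 2))) (hW : W ≤ 33 * (h ^ 2 * r * D)) :
    P + r * h ^ 2 / 2 + W ≤ 40 * (h ^ 3 * r * D * (1 + 1 / γ ^ 2)) := by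
  have hG1 : 1 ≤ 1 + 1 / γ ^ 2 := by linarith [show 0 < 1 / γ ^ 2 by positivity]
  set G := 1 + 1 / γ ^ 2
  have hb : 0 < h ^ 2 * r := by positivity
  have e1 : h ^ 2 * r * D ≤ h ^ 3 * r * D * G := by
    have : 1 ≤ h * G := by nlinarith
    nlinarith [mul_le_mul_of_nonneg_left this (show 0 ≤ h ^ 2 * r * D by positivity)]
  have e2 : h ^ 2 * r ≤ h ^ 2 * r * D := by nlinarith
  linarith

/-- Everything is compared with `z U`, where `z = h/γ ≥ 1`, and `z` is then cancelled. The shares `5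
+ 1 + 1/2 + 99` stay below 106. -/
theorem violation_const_le {h r γ D P W v : ℝ} (hh : 1 ≤ h) (hr : 1 ≤ r) (hγ : 0 < γ) (hγh : γ ≤ h)
    (hD : 1 ≤ D) (hP : P ≤ 5 * (h ^ 3 * r * D * (1 + 1 / γ ^ 2)))
    (hW : W ≤ 33 * (h ^ 2 * r * D))
    (hv : h / γ * v ≤ max 0 (P + ((2 * h / γ) ^ 2 / 2 * r + r * h ^ 2 / 2) +
      (1 + 2 * h / γ) * W)) :
    v ≤ 106 * (h ^ 3 * r * D * (1 + 1 / γ ^ 2)) := by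
  have hG1 : 1 ≤ 1 + 1 / γ ^ 2 := by linarith [show 0 < 1 / γ ^ 2 by positivity]
  have h2y : 2 / γ ≤ 1 + 1 / γ ^ 2 := by
    have e1 : 2 / γ = 2 * (1 / γ) := by ring
    have e2 : 1 / γ ^ 2 = (1 / γ) ^ 2 := by ring
    rw [e1, e2]
    nlinarith [sq_nonneg (1 / γ - 1)]
  set G := 1 + 1 / γ ^ 2
  set U := h ^ 3 * r * D * G with hU
  have hh0 : 0 < h := by linarith
  have hU0 : 0 < U := by positivity
  set z := h / γ with hz
  have hz1 : 1 ≤ z := (one_le_div hγ).2 hγh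
  have e1 : h ^ 2 * r * D ≤ U := by
    have : 1 ≤ h * G := by nlinarith
    nlinarith [mul_le_mul_of_nonneg_left this (show 0 ≤ h ^ 2 * r * D by positivity)]
  have e2 : r * h ^ 2 ≤ U := by
    have : h ^ 2 * r ≤ h ^ 2 * r * D := by nlinarith [show 0 < h ^ 2 * r by positivity]
    linarith
  have e3 : (2 * h / γ) ^ 2 / 2 * r ≤ z * U := by
    have e4 : (2 * h / γ) ^ 2 / 2 * r = z * (h * r * (2 / γ)) := by
      rw [hz]
      field_simp
    rw [e4]
    refine mul_le_mul_of_nonneg_left ?_ (by linarith)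
    have e5 := mul_le_mul_of_nonneg_left h2y (show 0 ≤ h * r by positivity)
    have e6 : 1 ≤ h ^ 2 * D := by nlinarith [one_le_pow₀ hh (n := 2)]
    have e7 := mul_le_mul_of_nonneg_left e6 (show 0 ≤ h * r * G by positivity)
    rw [hU]
    linarith
  have e8 : (1 + 2 * h / γ) * W ≤ 99 * (z * U) := by
    have e9 : 2 * h / γ = 2 * z := by rw [hz]; ring
    rw [e9]
    have e10 : W ≤ 33 * U := by linarith
    have := mul_le_mul_of_nonneg_left e10 (show 0 ≤ 1 + 2 * z by linarith)
    nlinarith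
  have e11 : U ≤ z * U := by nlinarith
  have e12 : z * v ≤ z * (106 * U) := by
    refine hv.trans (max_le (by positivity) ?_)
    linarith
  exact le_of_mul_le_mul_left e12 (by linarith)

theorem horizon_rpow_mul_sqrt {h k : ℝ} (hh : 0 ≤ h) :
    h ^ (5 / 2 : ℝ) * √(h * k) = h ^ 3 * √k := by
  rw [Real.sqrt_mul hh, Real.sqrt_eq_rpow, ← mul_assoc,
    ← Real.rpow_add_of_nonneg hh (by norm_num) (by norm_num)]
  norm_num

end Constants

/-! ### From exponential moments to a high-probability event. -/

section HighProbability

set_option linter.unusedSectionVars false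

variable {S A ι₁ ι₂ : Type*} [Fintype S] [DecidableEq S] [Fintype A]
  [Fintype ι₁] [DecidableEq ι₁] [Fintype ι₂] [DecidableEq ι₂] {H K : ℕ}

theorem ofReal_le_runLaw [Nonempty A] (M : CMDP S A H) (F : Features S A ι₁ ι₂) {c : Params}
    (hθ : c.θ ∈ Set.Icc (0 : ℝ) 1) {p : ℝ} (hp : 0 < p)
    (Φ : (Fin K → Trajectory S A H) → ℝ) (hΦ0 : ∀ ω, 0 ≤ Φ ω)
    (hΦ : ∑ ω : Fin K → Trajectory S A H, runWeight M F c ω * Φ ω ≤ 1)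
    {G : Set (Fin K → Trajectory S A H)} (hG : ∀ ω, Φ ω < 1 / p → ω ∈ G) :
    ENNReal.ofReal (1 - p) ≤ runLaw M F c K G := by
  classical
  have hbad := sum_filter_runWeight_le M F hθ hp Φ hΦ0 hΦ
  have hsplit := Finset.sum_filter_add_sum_filter_not Finset.univ (fun ω => Φ ω < 1 / p)
    (runWeight (K := K) M F c)
  rw [sum_runWeight M F c hθ K] at hsplit
  have hgood : 1 - p ≤ ∑ ω with Φ ω < 1 / p, runWeight M F c ω := by linarith
  refine (ENNReal.ofReal_le_ofReal hgood).trans ?_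
  rw [ENNReal.ofReal_sum_of_nonneg fun ω _ => runWeight_nonneg M F hθ ω]
  simp only [runLaw, Measure.coe_finsetSum, Finset.sum_apply, Measure.smul_apply, smul_eq_mul]
  rw [Finset.sum_filter]
  refine Finset.sum_le_sum fun ω _ => ?_
  split_ifs with hω
  · refine le_trans ?_ (mul_le_mul_right (Measure.le_dirac_apply (s := G) (a := ω)) _)
    simp [hG ω hω]
  · exact zero_le

/-- The average of the exponential processes that control one signal. -/
def signalExp (M : CMDP S A H) (F : Features S A ι₁ ι₂) (c : Params) (t : ℝ) (s : Signal)
    (ω : Fin K → Trajectory S A H) : ℝ :=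
  (∑ h : Fin H, ∑ N : Fin K, regressionExp M F c ω s h N) / (H * K) + bonusExp M F c ω s t K

theorem regressionExp_nonneg (M : CMDP S A H) (F : Features S A ι₁ ι₂) (c : Params)
    (ω : Fin K → Trajectory S A H) (s : Signal) (h : Fin H) (N : ℕ) :
    0 ≤ regressionExp M F c ω s h N := selfNormExp_nonneg _ _ _ _

theorem bonusExp_le_signalExp (M : CMDP S A H) (F : Features S A ι₁ ι₂) (c : Params) (t : ℝ)
    (s : Signal) (ω : Fin K → Trajectory S A H) :
    bonusExp M F c ω s t K ≤ signalExp M F c t s ω :=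
  le_add_of_nonneg_left (div_nonneg (Finset.sum_nonneg fun h _ => Finset.sum_nonneg fun N _ =>
    regressionExp_nonneg M F c ω s h N) (by positivity))

theorem signalExp_nonneg (M : CMDP S A H) (F : Features S A ι₁ ι₂) (c : Params) (t : ℝ)
    (s : Signal) (ω : Fin K → Trajectory S A H) : 0 ≤ signalExp M F c t s ω :=
  (Real.exp_pos _).le.trans (bonusExp_le_signalExp M F c t s ω)

/-- Replaces the union bound: a nonnegative term is at most `HK` times the average, and this factor
enters the confidence width only through a logarithm. -/
theorem regressionExp_le_signalExp (M : CMDP S A H) (F : Features S A ι₁ ι₂) (c : Params) (t : ℝ)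
    (s : Signal) (ω : Fin K → Trajectory S A H) (h : Fin H) (N : Fin K) :
    regressionExp M F c ω s h N ≤ H * K * signalExp M F c t s ω := by
  have hHK : (0 : ℝ) < H * K :=
    mul_pos (by exact_mod_cast h.pos) (by exact_mod_cast N.pos)
  rw [signalExp, mul_add, mul_div_cancel₀ _ hHK.ne']
  refine le_add_of_le_of_nonneg ?_ (mul_nonneg hHK.le (Real.exp_pos _).le)
  refine le_trans ?_ (Finset.single_le_sum (f := fun h => ∑ N : Fin K, regressionExp M F c ω s h N)
    (fun h _ => Finset.sum_nonneg fun N _ => regressionExp_nonneg M F c ω s h N)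
    (Finset.mem_univ h))
  exact Finset.single_le_sum (f := fun N : Fin K => regressionExp M F c ω s h N)
    (fun N _ => regressionExp_nonneg M F c ω s h N) (Finset.mem_univ N)

theorem sum_runWeight_mul_signalExp_le [Nonempty A] (hH : 1 ≤ H) (hK : 1 ≤ K) (M : CMDP S A H)
    (F : Features S A ι₁ ι₂) {c : Params} (hlam : c.lam = 1) (hθ : c.θ ∈ Set.Icc (0 : ℝ) 1)
    (hβ : 0 ≤ c.β) (t : ℝ) (s : Signal) :
    ∑ ω : Fin K → Trajectory S A H, runWeight M F c ω * signalExp M F c t s ω ≤ 2 := by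
  have hHK : (0 : ℝ) < H * K := mul_pos (by exact_mod_cast hH) (by exact_mod_cast hK)
  simp only [signalExp, mul_add, Finset.sum_add_distrib, mul_div_assoc', ← Finset.sum_div]
  have h1 : ∑ ω : Fin K → Trajectory S A H,
      runWeight M F c ω * ∑ h : Fin H, ∑ N : Fin K, regressionExp M F c ω s h N ≤ H * K := by
    simp only [Finset.mul_sum]
    rw [Finset.sum_comm]
    refine (Finset.sum_le_sum (g := fun _ => (K : ℝ)) fun h _ => ?_).trans (by simp)
    rw [Finset.sum_comm]
    refine (Finset.sum_le_sum (g := fun _ => (1 : ℝ)) fun N _ => ?_).trans (by simp)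
    exact sum_runWeight_mul_regressionExp_le M F hlam hθ s h N.2.le
  have h2 := (div_le_one hHK).2 h1
  have h3 := sum_runWeight_mul_bonusExp_le M F hlam hθ hβ s t (le_refl K)
  linarith

theorem sum_meanBonus_eq (M : CMDP S A H) (F : Features S A ι₁ ι₂) (c : Params)
    (ω : Fin K → Trajectory S A H) (s : Signal) :
    ∑ N ∈ Finset.range K, meanBonus M F c ω s N = ∑ i : Fin K, trajBonus M F c ω s i (ω i) +
      ∑ i ∈ Finset.range K, bonusDeviation M F c ω s i := by
  rw [← Fin.sum_univ_eq_sum_range, ← Fin.sum_univ_eq_sum_range (bonusDeviation M F c ω s),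
    ← Finset.sum_add_distrib]
  refine Finset.sum_congr rfl fun i _ => ?_
  rw [bonusDeviation, extendZero_of_lt _ i.2]
  ring

/-- The choice `t = 1 / (H²√K)` makes the total compensator the constant `1/8`, which yields the
rate `√K` after division by `t`. -/
theorem sum_bonusDeviation_le (hH : 1 ≤ H) (hK : 1 ≤ K) (M : CMDP S A H) (F : Features S A ι₁ ι₂)
    (c : Params) (ω : Fin K → Trajectory S A H) (s : Signal) {B : ℝ} (hB : 0 < B)
    (h : bonusExp M F c ω s (1 / ((H : ℝ) ^ 2 * √K)) K < B) :
    ∑ i ∈ Finset.range K, bonusDeviation M F c ω s i ≤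
      (H : ℝ) ^ 2 * √K * (Real.log B + 1 / 8) := by
  have hH0 : (0 : ℝ) < H := by exact_mod_cast hH
  have hK0 : (0 : ℝ) < K := by exact_mod_cast hK
  have hsq := Real.sq_sqrt hK0.le
  have hsK : 0 < √(K : ℝ) := Real.sqrt_pos.2 hK0
  rw [bonusExp, ← Real.lt_log_iff_exp_lt hB] at h
  have e1 : (K : ℝ) * ((1 / ((H : ℝ) ^ 2 * √K)) ^ 2 * (H : ℝ) ^ 4 / 8) = 1 / 8 := by
    rw [div_pow, mul_pow, hsq]
    field_simp
  rw [e1, one_div_mul_eq_div, sub_lt_iff_lt_add, div_lt_iff₀ (by positivity)] at h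
  linarith

end HighProbability

/-! ### Assembly of the bounds. -/

section Main

variable {S A : Type*} [Fintype S] [DecidableEq S] [Fintype A] [DecidableEq A] {H K : ℕ}

theorem tabularParams_θ_mem (hK : 1 ≤ K) (C : ℝ) (nS nA H : ℕ) (p γ : ℝ) :
    (tabularParams C nS nA H K p γ).θ ∈ Set.Icc (0 : ℝ) 1 := by
  have hK1 : (1 : ℝ) ≤ K := by exact_mod_cast hK
  exact ⟨by simp only [tabularParams]; positivity, by
    simp only [tabularParams]
    exact (div_le_one (by linarith)).2 hK1⟩

/-- With a single action all policies agree. -/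
theorem IsPolicy.eq_of_card_le_one {S A : Type*} [Fintype A] {H : ℕ} (hA : Fintype.card A ≤ 1) {π π' : Fin H → S → A → ℝ}
    (hπ : IsPolicy π) (hπ' : IsPolicy π') : π = π' := by
  have := Fintype.card_le_one_iff_subsingleton.1 hA
  funext h x a
  have h1 := (hπ h x).2
  have h2 := (hπ' h x).2
  rw [Fintype.sum_subsingleton _ a] at h1 h2
  rw [h1, h2]

/-- A separate case because `log |A| = 0` makes `α` vanish, and the mirror descent bound can then
not be divided by it. -/
theorem regret_violation_of_card_le_one [Nonempty A] (hA : Fintype.card A ≤ 1) (M : CMDP S A H)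
    {c : Params} (hθ : c.θ ∈ Set.Icc (0 : ℝ) 1) {πstar : Fin H → S → A → ℝ}
    (hstar : IsOptimalPolicy M πstar) (ω : Fin K → Trajectory S A H) :
    regret M (tabularFeatures S A) c πstar ω = 0 ∧ violation M (tabularFeatures S A) c ω = 0 := by
  have h : ∀ k, episodePolicy M (tabularFeatures S A) c ω k = πstar := fun k =>
    IsPolicy.eq_of_card_le_one hA (isPolicy_iterate M _ c hθ _ _) hstar.1
  constructor
  · simp [regret, h]
  · simp only [violation, h]
    exact max_eq_left (Finset.sum_nonpos fun _ _ => by linarith [hstar.2.1])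

/-- The bounds hold on every run on which the exponential processes are small. -/
theorem regret_violation_le_of_signalExp_lt [Nonempty A] (hA : 2 ≤ Fintype.card A) (hH : 1 ≤ H)
    (hK : 1 ≤ K) (M : CMDP S A H) {γ : ℝ} (hγ : Slater M γ) {p : ℝ} (hp : p ∈ Set.Ioo (0 : ℝ) 1)
    {πstar : Fin H → S → A → ℝ} (hstar : IsOptimalPolicy M πstar) {c : Params}
    (hc : c = tabularParams 3 (Fintype.card S) (Fintype.card A) H K p γ)
    (ω : Fin K → Trajectory S A H)
    (hω : ∀ s, signalExp M (tabularFeatures S A) c (1 / ((H : ℝ) ^ 2 * √K)) s ω < 4 / p) :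
    regret M (tabularFeatures S A) c πstar ω ≤ 106 * ((H : ℝ) ^ 3 * √K *
      ((Fintype.card S : ℝ) ^ 2 * Fintype.card A *
        Real.log (Fintype.card S * Fintype.card A * (H * K) / p)) * (1 + 1 / γ ^ 2)) ∧
    violation M (tabularFeatures S A) c ω ≤ 106 * ((H : ℝ) ^ 3 * √K *
      ((Fintype.card S : ℝ) ^ 2 * Fintype.card A *
        Real.log (Fintype.card S * Fintype.card A * (H * K) / p)) * (1 + 1 / γ ^ 2)) := by
  set F := tabularFeatures S A with hF
  have hθ : c.θ ∈ Set.Icc (0 : ℝ) 1 := hc ▸ tabularParams_θ_mem hK _ _ _ _ _ _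
  have hlam : c.lam = 1 := by rw [hc]; rfl
  have hχ : c.χ = 2 * H / γ := by rw [hc]; rfl
  have hη : c.η = 1 / √K := by rw [hc]; rfl
  have hcθ : c.θ = 1 / K := by rw [hc]; rfl
  have hα : c.α = √(Real.log (Fintype.card A)) / ((H : ℝ) ^ 2 * √K) := by rw [hc]; rfl
  have hβ : c.β = 3 * √((Fintype.card S : ℝ) ^ 2 * Fintype.card A * (H : ℝ) ^ 2 *
    Real.log (Fintype.card S * Fintype.card A * (H * K) / p)) := by rw [hc]; rfl
  clear hc
  have hS : (1 : ℝ) ≤ Fintype.card S := by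
    exact_mod_cast Fintype.card_pos_iff.2 ⟨M.x₁⟩
  have hA' : (2 : ℝ) ≤ Fintype.card A := by exact_mod_cast hA
  have hH' : (1 : ℝ) ≤ H := by exact_mod_cast hH
  have hK' : (1 : ℝ) ≤ K := by exact_mod_cast hK
  obtain ⟨l1, l2, l3, l4, l5, l6⟩ := log_bounds hS hA' hH' hK' hp.1 hp.2
  set L := Real.log (Fintype.card S * Fintype.card A * (H * K) / p) with hL
  set d : ℝ := (Fintype.card S : ℝ) ^ 2 * Fintype.card A with hd
  have hSA : (Fintype.card S : ℝ) * Fintype.card A ≤ d := by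
    rw [hd]
    exact mul_le_mul_of_nonneg_right (by nlinarith) (by linarith)
  have hd2 : 2 ≤ d := by nlinarith
  have hr : 1 ≤ √(K : ℝ) := Real.one_le_sqrt.2 hK'
  have hr2 : √(K : ℝ) ^ 2 = K := Real.sq_sqrt (by linarith)
  have hD : 1 ≤ d * L := by nlinarith
  have hp0 := hp.1
  have hβH : (H : ℝ) ≤ 2 * c.β := by
    have : (H : ℝ) ≤ √(d * (H : ℝ) ^ 2 * L) := by
      refine Real.le_sqrt_of_sq_le ?_
      nlinarith [mul_le_mul_of_nonneg_right hD (sq_nonneg (H : ℝ))]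
    rw [hβ]
    linarith
  have hphi : ∀ s h, ∀ N ≤ K,
      Real.log (gram (phiSeq F ω (iterate M F c ω) s h) N).det ≤ d * (3 * L) := by
    intro s h N hN
    refine (log_det_gram_le _ N fun i _ => phiSeq_dotProduct_self_le M hθ ω s h i).trans ?_
    have hcard : (Fintype.card (S × A × S) : ℝ) = d := by
      rw [hd]
      simp only [Fintype.card_prod]
      push_cast
      ring
    rw [hcard]
    refine mul_le_mul_of_nonneg_left (le_trans (Real.log_le_log (by positivity) ?_) l3)
      (by linarith)
    have : (N : ℝ) ≤ K := by exact_mod_cast hN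
    gcongr
  have hval : ∀ h, Real.log (gram (valSeq F ω h) K).det ≤ d * (3 * L) := by
    intro h
    refine (log_det_gram_le _ K fun i _ => valSeq_dotProduct_self_le ω h i).trans ?_
    simp only [Fintype.card_prod]
    push_cast
    exact mul_le_mul hSA l4 (Real.log_nonneg (by nlinarith)) (by linarith)
  have hQ : ∀ s, ∀ N < K, ∀ h x a,
      (iterate M F c ω (N + 1)).Q s h x a - bellmanTarget M F c ω s N h x a ∈
        Set.Icc 0 (clippedBonus M F c ω s N h x a) := by
    intro s N hN h x a
    refine iterate_Q_sub_bellmanTarget_mem M F hlam hθ ω hN.le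
      (abs_lstdEst_sub_le M c ω s N h x a ?_)
    rw [hβ]
    -- The effective failure probability is `p / (4HK)`: the factor 4 comes from the final Markov
    -- bound, `HK` from the averaging.
    have hreg : regressionExp M F c ω s h N < 1 / (p / (4 * (H * K))) := by
      refine (regressionExp_le_signalExp M F c (1 / ((H : ℝ) ^ 2 * √K)) s ω h ⟨N, hN⟩).trans_lt ?_
      refine (mul_lt_mul_of_pos_left (hω s) (by positivity)).trans_eq ?_
      field_simp
    refine confidence_width_le hd2 hH' l2 hSA ?_
      (invNorm_le_of_selfNormExp_lt (by positivity) (by positivity) _ _ _ hreg)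
    rw [one_div_div]
    refine mul_le_mul_of_nonneg_left ?_ (by positivity)
    linarith [hphi s h N hN.le]
  have hW : ∀ s, ∑ N ∈ Finset.range K, meanBonus M F c ω s N ≤
      33 * ((H : ℝ) ^ 2 * √K * (d * L)) := by
    intro s
    rw [sum_meanBonus_eq]
    have h1 := sum_trajBonus_le M F ω s hβH hval fun h => hphi s h K le_rfl
    have h2 := sum_bonusDeviation_le hH hK M F c ω s (by positivity)
      ((bonusExp_le_signalExp M F c _ s ω).trans_lt (hω s))
    have h3 : (H : ℝ) ^ 2 * √K * (Real.log (4 / p) + 1 / 8) ≤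
        (H : ℝ) ^ 2 * √K * (2 * L + 1 / 8) :=
      mul_le_mul_of_nonneg_left (by linarith) (by positivity)
    have h4 := bonus_sum_le hd2 hH' l2 hr
    rw [hr2, ← hβ] at h4
    linarith
  have hlogA : 0 < Real.log (Fintype.card A) := Real.log_pos (by linarith)
  have hα0 : 0 < c.α := by
    rw [hα]
    have := Real.sqrt_pos.2 hlogA
    positivity
  have hγ0 := hγ.1
  have hχ0 : 0 ≤ c.χ := by rw [hχ]; positivity
  have hP := primal_regret_le M F (by rw [hcθ]; positivity) hθ.2 hα0.le hχ0 ω hstar.1 K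
    fun s N hN h x a => (hQ s N hN h x a).1
  have hwD : √(Real.log (Fintype.card A)) ≤ d * L :=
    le_mul_of_sq_le hd2 l2 ((Real.sq_sqrt hlogA.le).trans_le l1)
  rw [hχ] at hP
  rw [← Real.sq_sqrt hlogA.le] at hP
  have hP' := primal_const_le hH' hr hr2 hγ0 (Real.sqrt_pos.2 hlogA) hwD hD hα hcθ hP
  have hη0 : 0 < c.η := by rw [hη]; positivity
  -- The primal bound is instantiated by the primal sum itself, which `hP'` estimates.
  obtain ⟨hR, hV⟩ := regret_violation_le hK M F hlam hθ hη0 hγ hχ hstar ω hQ le_rfl hW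
  have hηK : c.η * K = √K := by
    rw [hη, one_div_mul_eq_div, Real.div_sqrt]
  rw [hηK] at hR hV
  have hη2 : (2 * (H : ℝ) / γ) ^ 2 / (2 * c.η) = (2 * H / γ) ^ 2 / 2 * √K := by
    rw [hη]
    field_simp
  rw [hη2] at hV
  -- The Slater policy has utility at least `b + γ` with `b > 0`, while no value exceeds `H`.
  have hγH : γ ≤ H := by
    obtain ⟨-, πs, hπs, hs⟩ := hγ
    linarith [(value_mem M .utility hπs).2, M.b_mem.1]
  refine ⟨(hR.trans (regret_const_le hH' hr hγ0 hD hP' le_rfl)).trans ?_,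
    violation_const_le hH' hr hγ0 hγH hD hP' le_rfl hV⟩
  exact mul_le_mul_of_nonneg_right (by norm_num) (by positivity)

end Main

end OPDOP

end

theorem mainTheorem3 :
    ∃ C₁ C C' : ℝ, 0 < C₁ ∧ 0 < C ∧ 0 < C' ∧
      ∀ (S A : Type*) [Fintype S] [DecidableEq S] [Fintype A] [DecidableEq A] [Nonempty A]
        (H K : ℕ) (_hH : 1 ≤ H) (_hK : 1 ≤ K)
        (M : OPDOP.CMDP S A H) (γ : ℝ) (_hγ : OPDOP.Slater M γ)
        (p : ℝ) (_hp : p ∈ Set.Ioo (0 : ℝ) 1)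
        (πstar : Fin H → S → A → ℝ) (_hstar : OPDOP.IsOptimalPolicy M πstar)
        (c : OPDOP.Params)
        (_hc : c = OPDOP.tabularParams C₁ (Fintype.card S) (Fintype.card A) H K p γ)
        (T : ℝ) (_hT : T = (H : ℝ) * K),
        ENNReal.ofReal (1 - p) ≤
          OPDOP.runLaw M (OPDOP.tabularFeatures S A) c K
            {ω | OPDOP.regret M (OPDOP.tabularFeatures S A) c πstar ω ≤
                  C * (1 + 1 / γ ^ 2) * (Fintype.card S : ℝ) ^ 2 * Fintype.card A *
                    (H : ℝ) ^ (5 / 2 : ℝ) * √T *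
                    Real.log (Fintype.card S * Fintype.card A * T / p) ∧
                OPDOP.violation M (OPDOP.tabularFeatures S A) c ω ≤
                  C' * (1 + 1 / γ ^ 2) * (Fintype.card S : ℝ) ^ 2 * Fintype.card A *
                    (H : ℝ) ^ (5 / 2 : ℝ) * √T *
                    Real.log (Fintype.card S * Fintype.card A * T / p)} := by
  -- The 3 is set by `confidence_width_le` and 106 by `violation_const_le`; the regret alone would
  -- need only 40.
  refine ⟨3, 106, 106, by norm_num, by norm_num, by norm_num, ?_⟩
  intro S A _ _ _ _ _ H K hH hK M γ hγ p hp πstar hstar c hc T hT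
  subst hT
  have hθ : c.θ ∈ Set.Icc (0 : ℝ) 1 := hc ▸ OPDOP.tabularParams_θ_mem hK _ _ _ _ _ _
  have hlam : c.lam = 1 := by rw [hc]; rfl
  have hβ : 0 ≤ c.β := by
    rw [hc]
    exact mul_nonneg (by norm_num) (Real.sqrt_nonneg _)
  have hbound : 106 * (1 + 1 / γ ^ 2) * (Fintype.card S : ℝ) ^ 2 * Fintype.card A *
      (H : ℝ) ^ (5 / 2 : ℝ) * √((H : ℝ) * K) *
        Real.log (Fintype.card S * Fintype.card A * (H * K) / p) =
      106 * ((H : ℝ) ^ 3 * √K * ((Fintype.card S : ℝ) ^ 2 * Fintype.card A *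
        Real.log (Fintype.card S * Fintype.card A * (H * K) / p)) * (1 + 1 / γ ^ 2)) := by
    rw [← OPDOP.horizon_rpow_mul_sqrt (Nat.cast_nonneg H)]
    ring
  rw [hbound]
  rcases le_or_gt (Fintype.card A) 1 with hA | hA
  -- With one action the bounds hold on every run, so the zero process is a sufficient control.
  · refine OPDOP.ofReal_le_runLaw M _ hθ hp.1 (fun _ => 0) (fun _ => le_rfl) (by simp) ?_
    intro ω _
    obtain ⟨h1, h2⟩ := OPDOP.regret_violation_of_card_le_one hA M hθ hstar ω
    have hS : (1 : ℝ) ≤ Fintype.card S := by exact_mod_cast Fintype.card_pos_iff.2 ⟨M.x₁⟩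
    have hA' : (1 : ℝ) ≤ Fintype.card A := by exact_mod_cast Fintype.card_pos
    have hH' : (1 : ℝ) ≤ H := by exact_mod_cast hH
    have hK' : (1 : ℝ) ≤ K := by exact_mod_cast hK
    have hlog : 0 ≤ Real.log (Fintype.card S * Fintype.card A * (H * K) / p) := by
      refine Real.log_nonneg ((one_le_div hp.1).2 (hp.2.le.trans ?_))
      exact one_le_mul_of_one_le_of_one_le (one_le_mul_of_one_le_of_one_le hS hA')
        (one_le_mul_of_one_le_of_one_le hH' hK')
    rw [Set.mem_ofPred_eq, h1, h2]
    constructor <;> positivity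
  · set F := OPDOP.tabularFeatures S A
    set t : ℝ := 1 / ((H : ℝ) ^ 2 * √K)
    have h0 := OPDOP.signalExp_nonneg (K := K) M F c t
    -- Each of the two signals has expectation at most 2, whence the division by 4. On the good
    -- event the sum is below `4 / p`, and by nonnegativity so is each summand.
    refine OPDOP.ofReal_le_runLaw M F hθ hp.1 (fun ω => (OPDOP.signalExp M F c t .reward ω +
      OPDOP.signalExp M F c t .utility ω) / 4)
      (fun ω => by linarith [h0 .reward ω, h0 .utility ω]) ?_ ?_
    · have h1 := OPDOP.sum_runWeight_mul_signalExp_le hH hK M F hlam hθ hβ t .reward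
      have h2 := OPDOP.sum_runWeight_mul_signalExp_le hH hK M F hlam hθ hβ t .utility
      simp only [mul_div_assoc', ← Finset.sum_div, mul_add, Finset.sum_add_distrib]
      linarith
    · intro ω hω
      refine OPDOP.regret_violation_le_of_signalExp_lt hA hH hK M hγ hp hstar hc ω fun s => ?_
      rw [div_lt_iff₀ (by norm_num), one_div_mul_eq_div] at hω
      cases s
      · linarith [h0 .utility ω]
      · linarith [h0 .reward ω]
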